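/- **Setting.** Let $\mathcal X(\mathbb R)=\{v\in H^1_{\rm loc}(\mathbb R;\mathbb C): 1-|v|^2\in L^2(\mathbb R),\ v'\in L^2(\mathbb R)\}$ (each $v$ being identified with its continuous representative) and $\mathcal{NX}(\mathbb R)=\{v\in\mathcal X(\mathbb R):\inf_{\mathbb R}|v|>0\}$. For $\kappa\le 0$ put, with $\langle z,w\rangle=\mathrm{Re}(z\bar w)$, $$E_\kappa(u)=\tfrac12\int_{\mathbb R}|u'|^2+\tfrac14\int_{\mathbb R}(1-|u|^2)^2-\tfrac{\kappa}{4}\int_{\mathbb R}\big((|u|^2)'\big)^2\quad(u\in\mathcal X(\mathbb R)),$$ $$p(u)=\tfrac12\int_{\mathbb R}\langle iu',u\rangle\Big(1-\frac1{|u|^2}\Big)\quad(u\in\mathcal{NX}(\mathbb R)),$$ $$\mathcal E_\kappa(\mathfrak q)=\inf\{E_\kappa(u):u\in\mathcal{NX}(\mathbb R),\ p(u)=\mathfrak q\}.$$ For $0\le c<\sqrt2$ let $\eta_{c,\kappa}:\mathbb R\to(0,1-c^2/2]$ be the even function whose restriction to $[0,\infty)$ is the inverse of the decreasing bijection $G_{c,\kappa}:(0,1-c^2/2]\to[0,\infty)$,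 $$G_{c,\kappa}(y)=-2\sqrt{-\kappa}\,\mathrm{atanh}\Big(\sqrt{-\kappa}\sqrt{\tfrac{2-c^2-2y}{1-2\kappa+2\kappa y}}\Big)+2\sqrt{\tfrac{1-2\kappa}{2-c^2}}\,\mathrm{atanh}\Big(\sqrt{\tfrac{(1-2\kappa)(2-c^2-2y)}{(2-c^2)(1-2\kappa+2\kappa y)}}\Big).$$ The dark soliton of speed $c\in(0,\sqrt2)$ is $u_{c,\kappa}=\sqrt{1-\eta_{c,\kappa}}\,e^{i\theta_{c,\kappa}}$ with $\theta_{c,\kappa}(x)=\frac c2\int_0^x\frac{\eta_{c,\kappa}}{1-\eta_{c,\kappa}}$, and the black soliton is $u_{0,\kappa}(x)=\pm\sqrt{1-\eta_{0,\kappa}(x)}$ for $\pm x\ge0$. Finally let $$\mathfrak q^*_\kappa=\sup\{\mathfrak q>0:\ \forall v\in\mathcal X(\mathbb R),\ E_\kappa(v)\le\mathcal E_\kappa(\mathfrak q)\Rightarrow\inf_{\mathbb R}|v|>0\},$$ $$c^*_\kappa=\sup\{c\in[0,\sqrt2):E_\kappa(u_{c,\kappa})=E_\kappa(u_{0,\kappa})\}.$$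 **Theorem.** Let $\kappa\le0$. 1. The supremum defining $c^*_\kappa$ is a maximum. One has $\mathfrak q^*_\kappa=p(u_{c^*_\kappa,\kappa})$ if $c^*_\kappa>0$, and $\mathfrak q^*_\kappa=\pi/2$ if $c^*_\kappa=0$. The map $c\mapsto p(u_{c,\kappa})$ is a bijection from $(c^*_\kappa,\sqrt2)$ onto $(0,\mathfrak q^*_\kappa)$; let $\mathfrak c=\mathfrak c_\kappa:(0,\mathfrak q^*_\kappa)\to(c^*_\kappa,\sqrt2)$ be its inverse. 2. For every $\mathfrak q\in(0,\mathfrak q^*_\kappa)$ one has $\mathcal E_\kappa(\mathfrak q)=E_\kappa(u_{\mathfrak c(\mathfrak q),\kappa})$, and the set of minimizers, i.e. of all $v\in\mathcal{NX}(\mathbb R)$ with $p(v)=\mathfrak q$ and $E_\kappa(v)=\mathcal E_\kappa(\mathfrak q)$, is exactly $\{e^{i\phi}u_{\mathfrak c(\mathfrak q),\kappa}(\cdot-a):a,\phi\in\mathbb R\}$. 3. Let $\mathfrak q\in(0,\mathfrak q^*_\kappa)$ and let $(u_n)$ in $\mathcal{NX}(\mathbb R)$ satisfy $E_\kappa(u_n)\to\mathcal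 E_\kappa(\mathfrak q)$ and $p(u_n)\to\mathfrak q$. Then there are $\theta\in\mathbb R$, a subsequence, still denoted $(u_n)$, and points $x_n\in\mathbb R$ such that, as $n\to\infty$, $$u_n(\cdot+x_n)\to e^{i\theta}u_{\mathfrak c(\mathfrak q),\kappa}\ \text{ in }L^\infty_{\rm loc}(\mathbb R),\qquad 1-|u_n(\cdot+x_n)|^2\to1-|u_{\mathfrak c(\mathfrak q),\kappa}|^2\ \text{ in }L^2(\mathbb R),$$ $$u_n'(\cdot+x_n)\to e^{i\theta}u_{\mathfrak c(\mathfrak q),\kappa}'\ \text{ in }L^2(\mathbb R).$$ 4. $\mathcal E_\kappa$ is strictly increasing on $(0,\mathfrak q^*_\kappa)$. For every $\mathfrak q\ge\mathfrak q^*_\kappa$ one has $\mathcal E_\kappa(\mathfrak q)=E_\kappa(u_{0,\kappa})$, and for every $\mathfrak q>\mathfrak q^*_\kappa$ this infimum is not attained. -/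

import Mathlib

namespace QGP

noncomputable section

/-- `g` is the weak (distributional) derivative of `f` on `ℝ`; both functions are locally
integrable and `∫ φ' f = - ∫ φ g` for all real test functions `φ`. -/
def HasWeakDeriv {F : Type*} [NormedAddCommGroup F] [NormedSpace ℝ F] (f g : ℝ → F) : Prop :=
  MeasureTheory.LocallyIntegrable f MeasureTheory.volume ∧
  MeasureTheory.LocallyIntegrable g MeasureTheory.volume ∧
  ∀ φ : ℝ → ℝ, ContDiff ℝ ((⊤ : ℕ∞) : WithTop ℕ∞) φ → HasCompactSupport φ →
    ∫ x, deriv φ x • f x = - ∫ x, φ x • g x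

open Classical in
/-- The weak derivative of `f`. It is unique up to null sets when it exists, and it is set to
be `0` when it does not exist. -/
def weakDeriv {F : Type*} [NormedAddCommGroup F] [NormedSpace ℝ F] (f : ℝ → F) : ℝ → F :=
  if h : ∃ g, HasWeakDeriv f g then Classical.choose h else 0

/-- The energy space `X(ℝ)` of all `v ∈ H¹_loc(ℝ; ℂ)` with `v' ∈ L²` and `1 - |v|² ∈ L²`.
Every such `v` is represented by its continuous representative (which lies in `L²_loc`), so that
pointwise statements make sense. -/
def energySpace : Set (ℝ → ℂ) :=
  {v | Continuous v ∧
    (∃ g : ℝ → ℂ, HasWeakDeriv v g ∧ MeasureTheory.MemLp g 2 MeasureTheory.volume) ∧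
    MeasureTheory.MemLp (fun x => 1 - ‖v x‖ ^ 2) 2 MeasureTheory.volume}

/-- The nonvanishing energy space `NX(ℝ)`. -/
def nonvanishingSpace : Set (ℝ → ℂ) :=
  {v | v ∈ energySpace ∧ 0 < ⨅ x, ‖v x‖}

/-- The energy `E_κ`. -/
def energy (κ : ℝ) (u : ℝ → ℂ) : ℝ :=
  1 / 2 * (∫ x, ‖weakDeriv u x‖ ^ 2)
    + 1 / 4 * (∫ x, (1 - ‖u x‖ ^ 2) ^ 2)
    - κ / 4 * (∫ x, (weakDeriv (fun y => ‖u y‖ ^ 2) x) ^ 2)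

/-- The renormalized momentum `p`, with the real scalar product `⟪z, w⟫ = Re (z * conj w)`. -/
def momentum (u : ℝ → ℂ) : ℝ :=
  1 / 2 * (∫ x, inner ℝ (Complex.I * weakDeriv u x) (u x) * (1 - 1 / ‖u x‖ ^ 2))

/-- The competitors of the minimization problem at momentum `q`. -/
def admissible (q : ℝ) : Set (ℝ → ℂ) :=
  {u | u ∈ nonvanishingSpace ∧ momentum u = q}

/-- The minimization curve, `inf {E_κ(u) : u ∈ NX(ℝ), p(u) = q}`. -/
def minEnergy (κ q : ℝ) : ℝ := sInf (energy κ '' admissible q)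

/-- The set of all minimizers of `E_κ` at momentum `q`. -/
def minimizers (κ q : ℝ) : Set (ℝ → ℂ) :=
  {u | u ∈ admissible q ∧ energy κ u = minEnergy κ q}

/-- All the functions obtained from `u` by a translation and a constant phase shift. -/
def orbit (u : ℝ → ℂ) : Set (ℝ → ℂ) :=
  {v | ∃ a φ : ℝ, ∀ x, v x = Complex.exp (Complex.I * φ) * u (x - a)}

/-- The function `G_{c,κ}`, used on `(0, 1 - c²/2]` for `0 ≤ c < √2` and `κ ≤ 0`; there it
decreases from `∞` to `0`. -/
def implicitProfile (c κ y : ℝ) : ℝ :=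
  -2 * √(-κ) * Real.artanh (√(-κ) * √((2 - c ^ 2 - 2 * y) / (1 - 2 * κ + 2 * κ * y)))
    + 2 * √((1 - 2 * κ) / (2 - c ^ 2)) *
      Real.artanh (√(((1 - 2 * κ) * (2 - c ^ 2 - 2 * y)) /
        ((2 - c ^ 2) * (1 - 2 * κ + 2 * κ * y))))

/-- The intensity profile `η_{c,κ}`: the even extension to `ℝ` of the inverse function of
`G_{c,κ} : (0, 1 - c²/2] → [0, ∞)`. -/
def intensityProfile (c κ x : ℝ) : ℝ :=
  Function.invFunOn (implicitProfile c κ) (Set.Ioc 0 (1 - c ^ 2 / 2)) |x|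

/-- The phase `θ_{c,κ}` of the dark soliton of speed `c > 0`. -/
def solitonPhase (c κ x : ℝ) : ℝ :=
  c / 2 * (∫ y in (0 : ℝ)..x, intensityProfile c κ y / (1 - intensityProfile c κ y))

/-- The black soliton `u_{0,κ}`, odd and real-valued. -/
def blackSoliton (κ x : ℝ) : ℂ :=
  ((Real.sign x * √(1 - intensityProfile 0 κ x) : ℝ) : ℂ)

open Classical in
/-- The soliton `u_{c,κ}`, for `0 ≤ c < √2` and `κ ≤ 0`: the black soliton if `c = 0`, and
`√(1 - η) e^{iθ}` if `c > 0`. -/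
def darkSoliton (c κ x : ℝ) : ℂ :=
  if c = 0 then blackSoliton κ x
  else ((√(1 - intensityProfile c κ x) : ℝ) : ℂ) *
    Complex.exp (Complex.I * ((solitonPhase c κ x : ℝ) : ℂ))

/-- The critical momentum `q*_κ`: the supremum of all `q > 0` such that every finite-energy
map of energy at most `minEnergy κ q` is nonvanishing. -/
def criticalMomentum (κ : ℝ) : ℝ :=
  sSup {q : ℝ | 0 < q ∧ ∀ v ∈ energySpace, energy κ v ≤ minEnergy κ q → 0 < ⨅ x, ‖v x‖}

/-- The speeds in `[0, √2)` whose soliton has the same energy as the black soliton. -/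
def blackEnergySpeeds (κ : ℝ) : Set ℝ :=
  {c | 0 ≤ c ∧ c < √2 ∧ energy κ (darkSoliton c κ) = energy κ (darkSoliton 0 κ)}

/-- The critical speed `c*_κ`, the largest element of `blackEnergySpeeds κ`. -/
def criticalSpeed (κ : ℝ) : ℝ := sSup (blackEnergySpeeds κ)

/-- The function `c ↦ p(u_{c,κ})`. -/
def solitonMomentum (κ c : ℝ) : ℝ := momentum (darkSoliton c κ)

/-- The speed `c(q)`: the inverse of `c ↦ p(u_{c,κ})` on `(c*_κ, √2)`. -/
def speedOfMomentum (κ q : ℝ) : ℝ :=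
  Function.invFunOn (solitonMomentum κ) (Set.Ioo (criticalSpeed κ) √2) q

end

end QGP

/-! Write η = 1 - |u|² for the intensity. If a nonvanishing map has η > 0 somewhere, then η attains
a maximum, of the form 1 - c²/2 with 0 < c < √2. For this c the density of E - c p is the derivative
of a function Φ_c(η), with opposite signs on the two sides of the maximum, plus two squares
(`energyDensity_sub_momentumDensity`). Integration gives E(u) - c p(u) = 2 Φ_c(1 - c²/2) + ∫ defect
(`energy_sub_momentum_eq`). The soliton of speed c, with energy E(c) and momentum p(c), has no
defect, hence E(u) ≥ E(c) + c (p(u) - p(c)) (`tangent_le_energy`). If η ≤ 0 everywhere, then E(u) ≥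
√2 p(u).

The problem is thus reduced to minimizing T_q(c) = E(c) + c (q - p(c)) in c. As E' = c p', its
derivative is q - p(c). Explicit integrals show that p' changes sign at most once, from plus to
minus (`profileSlope_neg_of_nonpos`), so T_q is concave up to some speed c₀ and convex beyond it.
Only E(0) and the value E(c₁) with p(c₁) = q on the decreasing branch compete, and the critical
speed is where they agree (`SolitonBranch.exists_isCritical`).

For q ≥ q* the value E(0) is approached by solitons of speed c → 0, cut at the center, with a plane
wave of modulus c/√2 inserted. They still have no defect, their momentum can be raised at will, and
their energy T_q(c) tends to E(0) (`minEnergy_of_le`). Letting c → 0 in the calibrated bound also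
shows that a map with a zero has energy at least E(0).

For compactness, minimizing sequences are translated so that η is maximal at 0. The strict minimum
of T_q forces their speeds to converge, so the defect tends to zero and u' times the conjugate of u
approaches in L² an explicit function of η. The limit of η solves a first order equation without
uniqueness, since plateaus are allowed, but the soliton profile is its smallest solution
(`intensityProfile_le_of_integral_eq`). Fatou's lemma and the convergence of the momentum exclude
larger solutions (`NearSoliton.intensity_limit_eq_profile`); strong convergence follows, and
constant sequences yield the uniqueness of minimizers. -/

open MeasureTheory Set Filter Topology

namespace QGP

/-! ### Weak derivatives and absolutely continuous primitives. -/

section Primitives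

theorem locallyIntegrable_norm {F : Type*} [NormedAddCommGroup F] {g : ℝ → F}
    (hg : LocallyIntegrable g volume) :
    LocallyIntegrable (fun x => ‖g x‖) volume := fun x => (hg x).norm

theorem locallyIntegrable_intervalIntegrable {F : Type*} [NormedAddCommGroup F]
    {g : ℝ → F} (hg : LocallyIntegrable g volume)
    (a b : ℝ) : IntervalIntegrable g volume a b :=
  intervalIntegrable_iff.mpr
    ((hg.integrableOn_isCompact isCompact_uIcc).mono_set uIoc_subset_uIcc)

variable {F : Type*} [NormedAddCommGroup F] [NormedSpace ℝ F]

/-- `f` is a primitive of the locally integrable function `g`. -/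
def IsPrimitive (f g : ℝ → F) : Prop :=
  LocallyIntegrable g volume ∧ ∀ x, f x = f 0 + ∫ t in (0 : ℝ)..x, g t

theorem IsPrimitive.sub_eq {f g : ℝ → F} (h : IsPrimitive f g) (a b : ℝ) :
    f b - f a = ∫ t in a..b, g t := by
  rw [h.2 a, h.2 b, add_sub_add_left_eq_sub]
  exact intervalIntegral.integral_interval_sub_left
    (locallyIntegrable_intervalIntegrable h.1 _ _) (locallyIntegrable_intervalIntegrable h.1 _ _)

theorem IsPrimitive.congr_ae {f g g' : ℝ → F} (h : IsPrimitive f g) (hg : g =ᵐ[volume] g') :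
    IsPrimitive f g' := by
  refine ⟨h.1.congr hg, fun x => ?_⟩
  rw [h.2 x]
  congr 1
  exact intervalIntegral.integral_congr_ae (hg.mono fun t ht _ => ht)

/-- The increments of `f` are dominated by those of the primitive of `‖g‖`, from which absolute
continuity is inherited. -/
theorem IsPrimitive.absolutelyContinuous {f g : ℝ → F} (h : IsPrimitive f g) (a b : ℝ) :
    AbsolutelyContinuousOnInterval f a b := by
  have hn : LocallyIntegrable (fun x => ‖g x‖) volume := locallyIntegrable_norm h.1
  have key := (locallyIntegrable_intervalIntegrable hn
    a b).absolutelyContinuousOnInterval_intervalIntegral (c := a) (by simp)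
  refine squeeze_zero (fun _ => Finset.sum_nonneg fun _ _ => dist_nonneg) (fun E => ?_) key
  refine Finset.sum_le_sum fun i _ => ?_
  rw [dist_comm, dist_eq_norm, h.sub_eq, dist_comm, Real.dist_eq,
    intervalIntegral.integral_interval_sub_left
    (locallyIntegrable_intervalIntegrable hn _ _) (locallyIntegrable_intervalIntegrable hn _ _)]
  exact intervalIntegral.norm_integral_le_abs_integral_norm

theorem IsPrimitive.ae_hasDerivAt [CompleteSpace F] {f g : ℝ → F} (h : IsPrimitive f g) :
    ∀ᵐ x, HasDerivAt f (g x) x := by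
  filter_upwards [LocallyIntegrable.ae_hasDerivAt_integral h.1] with x hx
  have := (hx 0).const_add (f 0)
  exact this.congr_of_eventuallyEq (Eventually.of_forall fun y => h.2 y)

/-- `f` minus the primitive of `g` is absolutely continuous with derivative zero almost everywhere,
hence constant. The chain and product rules for primitives rest on this. -/
theorem isPrimitive_of_absolutelyContinuous [CompleteSpace F] {f g : ℝ → F}
    (hf : ∀ a b, AbsolutelyContinuousOnInterval f a b) (hd : ∀ᵐ x, HasDerivAt f (g x) x)
    (hg : LocallyIntegrable g volume) : IsPrimitive f g := by
  refine ⟨hg, fun x => ?_⟩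
  have hG : IsPrimitive (fun x => ∫ t in (0 : ℝ)..x, g t) g := ⟨hg, fun x => by simp⟩
  have hsub := (hf 0 x).sub (hG.absolutelyContinuous 0 x)
  obtain ⟨C, hC⟩ := hsub.const_of_ae_hasDerivAt_zero (by
    filter_upwards [hd, hG.ae_hasDerivAt] with y h1 h2 _
    simpa using h1.sub h2)
  have h0 := hC 0 (by simp)
  have h1 := hC x (by simp)
  simp only [Pi.sub_apply, intervalIntegral.integral_same, sub_zero] at h0 h1
  rw [h0, ← h1]; abel

theorem IsPrimitive.continuous {f g : ℝ → F} (h : IsPrimitive f g) : Continuous f := by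
  rw [continuous_iff_continuousAt]
  intro x
  exact (h.absolutelyContinuous (x - 1) (x + 1)).continuousOn.continuousAt (by
    rw [uIcc_of_le (by linarith)]
    exact Icc_mem_nhds (by linarith) (by linarith))

theorem isPrimitive_of_hasDerivAt [CompleteSpace F] {f g : ℝ → F}
    (h : ∀ x, HasDerivAt f (g x) x) (hg : Continuous g) : IsPrimitive f g := by
  refine ⟨hg.locallyIntegrable, fun x => ?_⟩
  rw [intervalIntegral.integral_eq_sub_of_hasDerivAt (fun y _ => h y)
    (hg.intervalIntegrable _ _)]
  abel

theorem locallyIntegrable_continuous_smul {φ : ℝ → ℝ} {g : ℝ → F}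
    (hg : LocallyIntegrable g volume) (hφ : Continuous φ) :
    LocallyIntegrable (fun x => φ x • g x) volume := by
  rw [MeasureTheory.locallyIntegrable_iff]
  intro K hK
  exact (hg.integrableOn_isCompact hK).continuousOn_smul hφ.continuousOn hK

/-- Chain rule for a primitive composed with a `C¹` map. -/
theorem IsPrimitive.comp {E : Type*} [NormedAddCommGroup E] [NormedSpace ℝ E]
    [FiniteDimensional ℝ E] [CompleteSpace F] {f g : ℝ → E} (h : IsPrimitive f g)
    {Ψ : E → F} (hΨ : ContDiff ℝ 1 Ψ) :
    IsPrimitive (fun x => Ψ (f x)) (fun x => fderiv ℝ Ψ (f x) (g x)) := by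
  have hE : CompleteSpace E := FiniteDimensional.complete ℝ E
  have hP : ProperSpace E := FiniteDimensional.proper ℝ E
  refine isPrimitive_of_absolutelyContinuous (fun a b => ?_) ?_ ?_
  -- Between `a` and `b` the values of `f` stay in a ball, on which a C¹ map is Lipschitz;
  -- composition with it preserves absolute continuity.
  · obtain ⟨R, hR⟩ := (h.absolutelyContinuous a b).exists_bound
    obtain ⟨K, hK⟩ := (hΨ.contDiffOn (s := Metric.closedBall 0 R)).exists_lipschitzOnWith
      (by decide) (convex_closedBall _ _) (isCompact_closedBall _ _)
    have key := (show Tendsto _ _ _ from h.absolutelyContinuous a b).const_mul (K : ℝ)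
    rw [mul_zero] at key
    refine squeeze_zero' (Eventually.of_forall fun _ => Finset.sum_nonneg fun _ _ => dist_nonneg)
      ?_ key
    filter_upwards [mem_inf_of_right (mem_principal_self _)] with e he
    rw [Finset.mul_sum]
    refine Finset.sum_le_sum fun i hi => ?_
    have h1 := hR _ (he.1 i hi).1
    have h2 := hR _ (he.1 i hi).2
    exact hK.dist_le_mul _ (by simpa using h1) _ (by simpa using h2)
  · filter_upwards [h.ae_hasDerivAt] with x hx
    exact ((hΨ.differentiable (by decide)) (f x)).hasFDerivAt.comp_hasDerivAt x hx
  · have hc : Continuous (fun x => fderiv ℝ Ψ (f x)) :=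
      (hΨ.continuous_fderiv (by decide)).comp h.continuous
    refine (locallyIntegrable_continuous_smul h.1 hc.norm).mono ?_ ?_
    · exact isBoundedBilinearMap_apply.continuous.comp_aestronglyMeasurable
        (hc.aestronglyMeasurable.prodMk h.1.aestronglyMeasurable)
    · refine Eventually.of_forall fun x => ?_
      rw [norm_smul, norm_norm]
      exact (fderiv ℝ Ψ (f x)).le_opNorm (g x)

theorem IsPrimitive.smul {𝕂 : Type*} [RCLike 𝕂] [NormedSpace 𝕂 F] [IsScalarTower ℝ 𝕂 F]
    [CompleteSpace F] {φ φ' : ℝ → 𝕂} {f g : ℝ → F} (hφ : IsPrimitive φ φ')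
    (h : IsPrimitive f g) :
    IsPrimitive (fun x => φ x • f x) (fun x => φ x • g x + φ' x • f x) := by
  refine isPrimitive_of_absolutelyContinuous (fun a b => ?_) ?_ ?_
  · exact (hφ.absolutelyContinuous a b).smul (h.absolutelyContinuous a b)
  · filter_upwards [h.ae_hasDerivAt, hφ.ae_hasDerivAt] with x h1 h2
    exact h2.smul h1
  · refine LocallyIntegrable.add ?_ ?_
    · refine (locallyIntegrable_continuous_smul h.1 hφ.continuous.norm).mono
        (hφ.continuous.aestronglyMeasurable.smul h.1.aestronglyMeasurable) ?_
      exact Eventually.of_forall fun x => by simp [norm_smul]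
    · refine (locallyIntegrable_continuous_smul hφ.1 h.continuous.norm).mono
        (hφ.1.aestronglyMeasurable.smul h.continuous.aestronglyMeasurable) ?_
      exact Eventually.of_forall fun x => by simp [norm_smul, mul_comm]

theorem IsPrimitive.const_sub_eq {f g : ℝ → F} (h : IsPrimitive f g) (c : F) :
    IsPrimitive (fun x => c - f x) (fun x => - g x) := by
  refine ⟨h.1.neg, fun x => ?_⟩
  have := h.2 x
  simp only [intervalIntegral.integral_neg]
  rw [this]
  abel

theorem isPrimitive_integral {g : ℝ → F} (hg : LocallyIntegrable g volume) :
    IsPrimitive (fun x => ∫ t in (0 : ℝ)..x, g t) g := ⟨hg, fun x => by simp⟩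

theorem hasCompactSupport_subset_Ioc {φ : ℝ → ℝ} (hc : HasCompactSupport φ) :
    ∃ R > 0, tsupport φ ⊆ Ioo (-R) R := by
  obtain ⟨R, hR⟩ := hc.isCompact.isBounded.subset_ball (0 : ℝ)
  refine ⟨max R 1, by positivity, fun x hx => ?_⟩
  have := hR hx
  rw [Metric.mem_ball, Real.dist_eq, sub_zero, abs_lt] at this
  exact ⟨by linarith [le_max_left R 1], lt_of_lt_of_le this.2 (le_max_left _ _)⟩

theorem IsPrimitive.hasWeakDeriv [CompleteSpace F] {f g : ℝ → F} (h : IsPrimitive f g) :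
    HasWeakDeriv f g := by
  refine ⟨h.continuous.locallyIntegrable, h.1, fun φ hφ hc => ?_⟩
  have hd : Differentiable ℝ φ := hφ.differentiable (by simp)
  have hcd : Continuous (deriv φ) := hφ.continuous_deriv (by simp)
  have hp : IsPrimitive φ (deriv φ) :=
    isPrimitive_of_hasDerivAt (fun x => (hd x).hasDerivAt) hcd
  have hs := hp.smul h
  obtain ⟨R, hR0, hR⟩ := hasCompactSupport_subset_Ioc hc
  have hz : ∀ x, x ∉ Ioo (-R) R → φ x = 0 := fun x hx =>
    image_eq_zero_of_notMem_tsupport fun h' => hx (hR h')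
  have hz' : ∀ x, x ∉ Ioo (-R) R → deriv φ x = 0 := fun x hx => by
    by_contra hne
    exact hx (hR (support_deriv_subset hne))
  have e1 : ∫ x in (-R)..R, deriv φ x • f x = ∫ x, deriv φ x • f x :=
    intervalIntegral.integral_eq_integral_of_support_subset fun x hx => by
      by_contra hne
      exact hx (by simp [hz' x fun hx' => hne ⟨hx'.1, hx'.2.le⟩])
  have e2 : ∫ x in (-R)..R, φ x • g x = ∫ x, φ x • g x :=
    intervalIntegral.integral_eq_integral_of_support_subset fun x hx => by
      by_contra hne
      exact hx (by simp [hz x fun hx' => hne ⟨hx'.1, hx'.2.le⟩])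
  have e3 := hs.sub_eq (-R) R
  rw [hz R (by simp), hz (-R) (by simp), intervalIntegral.integral_add, e1, e2] at e3
  · simp only [zero_smul, sub_zero] at e3
    exact (neg_eq_of_add_eq_zero_left (by rw [add_comm]; exact e3.symm)).symm
  · exact locallyIntegrable_intervalIntegrable
      (locallyIntegrable_continuous_smul h.1 hφ.continuous) _ _
  · exact locallyIntegrable_intervalIntegrable
      (locallyIntegrable_continuous_smul h.continuous.locallyIntegrable hcd) _ _

theorem HasWeakDeriv.ae_unique [CompleteSpace F] {f g g' : ℝ → F} (h : HasWeakDeriv f g)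
    (h' : HasWeakDeriv f g') : g =ᵐ[volume] g' := by
  refine ae_eq_of_integral_contDiff_smul_eq h.2.1 h'.2.1 fun φ hφ hc => ?_
  have := (h.2.2 φ hφ hc).symm.trans (h'.2.2 φ hφ hc)
  exact neg_injective this

theorem integrable_smul_test {φ : ℝ → ℝ} {f : ℝ → F} (hf : LocallyIntegrable f volume)
    (hφ : Continuous φ) (hc : HasCompactSupport φ) : Integrable (fun x => φ x • f x) volume := by
  have h1 : IntegrableOn (fun x => φ x • f x) (tsupport φ) volume :=
    (hf.integrableOn_isCompact hc.isCompact).continuousOn_smul hφ.continuousOn hc.isCompact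
  refine (integrableOn_iff_integrable_of_support_subset fun x hx => ?_).1 h1
  by_contra hne
  exact hx (by simp [image_eq_zero_of_notMem_tsupport hne])

/-- Mean zero is what makes the primitive based at `-R` vanish again to the right of the support. -/
theorem exists_test_primitive {φ : ℝ → ℝ} (hφ : ContDiff ℝ ((⊤ : ℕ∞) : WithTop ℕ∞) φ)
    (hc : HasCompactSupport φ) (h0 : ∫ x, φ x = 0) :
    ∃ Φ : ℝ → ℝ, ContDiff ℝ ((⊤ : ℕ∞) : WithTop ℕ∞) Φ ∧ HasCompactSupport Φ ∧ deriv Φ = φ := by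
  obtain ⟨R, hR0, hR⟩ := hasCompactSupport_subset_Ioc hc
  have hz : ∀ x, x ∉ Ioo (-R) R → φ x = 0 := fun x hx =>
    image_eq_zero_of_notMem_tsupport fun h' => hx (hR h')
  have hd : ∀ x, HasDerivAt (fun x => ∫ t in (-R)..x, φ t) (φ x) x := fun x =>
    intervalIntegral.integral_hasDerivAt_right (hφ.continuous.intervalIntegrable _ _)
      (hφ.continuous.stronglyMeasurableAtFilter _ _) hφ.continuous.continuousAt
  have hder : deriv (fun x => ∫ t in (-R)..x, φ t) = φ := funext fun x => (hd x).deriv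
  refine ⟨fun x => ∫ t in (-R)..x, φ t, ?_, ?_, hder⟩
  · rw [contDiff_infty_iff_deriv, hder]
    exact ⟨fun x => (hd x).differentiableAt, hφ⟩
  · refine HasCompactSupport.of_support_subset_isCompact (isCompact_Icc (a := -R) (b := R)) ?_
    intro x hx
    by_contra hne
    apply hx
    rcases lt_or_ge x (-R) with h | h
    · change ∫ t in (-R)..x, φ t = 0
      rw [intervalIntegral.integral_of_ge h.le, setIntegral_eq_zero_of_forall_eq_zero, neg_zero]
      exact fun t ht => hz t fun ht' => by linarith [ht.2, ht'.1]
    · have hx2 : R < x := by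
        by_contra h'
        exact hne ⟨h, not_lt.1 h'⟩
      have := intervalIntegral.integral_eq_integral_of_support_subset (f := φ) (μ := volume)
        (a := -R) (b := x) fun t ht => by
          by_contra hne'
          exact ht (hz t fun h' => hne' ⟨h'.1, by linarith [h'.2]⟩)
      change ∫ t in (-R)..x, φ t = 0
      rw [this, h0]

/-- A continuous function with a weak derivative is a primitive of it. -/
theorem HasWeakDeriv.isPrimitive [CompleteSpace F] {f g : ℝ → F} (h : HasWeakDeriv f g)
    (hf : Continuous f) : IsPrimitive f g := by
  have hG := isPrimitive_integral h.2.1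
  -- Du Bois-Reymond's argument: `D` pairs to zero with derivatives of test functions, and a test
  -- function becomes such a derivative once its mean times a fixed normalized bump is subtracted.
  -- Hence `D` is constant.
  set D : ℝ → F := fun x => f x - ∫ t in (0 : ℝ)..x, g t with hD
  have hDc : Continuous D := hf.sub hG.continuous
  have hD0 : ∀ Φ : ℝ → ℝ, ContDiff ℝ ((⊤ : ℕ∞) : WithTop ℕ∞) Φ → HasCompactSupport Φ →
      ∫ x, deriv Φ x • D x = 0 := by
    intro Φ hΦ hc
    have hcd : Continuous (deriv Φ) := hΦ.continuous_deriv (by simp)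
    simp only [hD, smul_sub]
    rw [integral_sub (integrable_smul_test h.1 hcd hc.deriv)
      (integrable_smul_test hG.continuous.locallyIntegrable hcd hc.deriv),
      h.2.2 Φ hΦ hc, hG.hasWeakDeriv.2.2 Φ hΦ hc, sub_self]
  let b : ContDiffBump (0 : ℝ) := ⟨1, 2, one_pos, one_lt_two⟩
  set φ₀ : ℝ → ℝ := b.normed volume
  have hφ₀ : ContDiff ℝ ((⊤ : ℕ∞) : WithTop ℕ∞) φ₀ := b.contDiff_normed
  have hφ₀c : HasCompactSupport φ₀ := b.hasCompactSupport_normed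
  have hφ₀i : ∫ x, φ₀ x = 1 := b.integral_normed
  set C : F := ∫ x, φ₀ x • D x
  have key : ∀ᵐ x, D x - C = 0 := by
    refine ae_eq_zero_of_integral_contDiff_smul_eq_zero
      (hDc.sub continuous_const).locallyIntegrable fun ψ hψ hψc => ?_
    have hψi : Integrable ψ := hψ.continuous.integrable_of_hasCompactSupport hψc
    have hφi : Integrable φ₀ := hφ₀.continuous.integrable_of_hasCompactSupport hφ₀c
    obtain ⟨Φ, h1, h2, h3⟩ := exists_test_primitive
      (φ := fun x => ψ x - (∫ y, ψ y) * φ₀ x) (hψ.sub (contDiff_const.mul hφ₀))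
      (hψc.sub (hφ₀c.mul_left))
      (by rw [integral_sub hψi (hφi.const_mul _), integral_const_mul, hφ₀i]; ring)
    have h4 := hD0 Φ h1 h2
    rw [h3] at h4
    have e1 := integrable_smul_test hDc.locallyIntegrable hψ.continuous hψc
    have e2 := integrable_smul_test hDc.locallyIntegrable hφ₀.continuous hφ₀c
    simp only [sub_smul, mul_smul] at h4
    have e3 : Integrable (fun x => (∫ y, ψ y) • φ₀ x • D x) volume := e2.smul _
    rw [integral_sub e1 e3, integral_smul] at h4
    simp only [smul_sub]
    rw [integral_sub e1 (hψi.smul_const C), integral_smul_const]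
    exact h4
  have hall : (fun x => D x - C) = fun _ => 0 :=
    (Continuous.ae_eq_iff_eq volume (hDc.sub continuous_const) continuous_const).1 key
  refine ⟨h.2.1, fun x => ?_⟩
  have hx := congrFun hall x
  have h0 := congrFun hall 0
  simp only [hD, intervalIntegral.integral_same, sub_zero] at hx h0
  rw [sub_eq_zero] at hx h0
  rw [h0, ← hx]; abel

theorem weakDeriv_ae_eq [CompleteSpace F] {f g : ℝ → F} (h : HasWeakDeriv f g) :
    weakDeriv f =ᵐ[volume] g := by
  have hex : ∃ g, HasWeakDeriv f g := ⟨g, h⟩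
  rw [weakDeriv, dif_pos hex]
  exact (Classical.choose_spec hex).ae_unique h

end Primitives

/-! ### The energy space: slopes, uniform bounds, decay at infinity, energy density. -/

/-- The intensity `1 - |v|²`. -/
noncomputable def intensity (v : ℝ → ℂ) (x : ℝ) : ℝ := 1 - ‖v x‖ ^ 2

/-- The product `⟨v', v⟩`, i.e. half the derivative of `|v|²`. -/
noncomputable def radialSlope (v : ℝ → ℂ) (x : ℝ) : ℝ := inner ℝ (weakDeriv v x) (v x)

/-- The product `⟨iv', v⟩`. -/
noncomputable def angularSlope (v : ℝ → ℂ) (x : ℝ) : ℝ :=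
  inner ℝ (Complex.I * weakDeriv v x) (v x)

/-- Expansion of `w` in the orthogonal directions `z` and `iz`; it splits `|v'|²` into a radial and
an angular part. -/
theorem norm_sq_mul_norm_sq (z w : ℂ) :
    ‖w‖ ^ 2 * ‖z‖ ^ 2 = inner ℝ w z ^ 2 + inner ℝ (Complex.I * w) z ^ 2 := by
  simp only [Complex.sq_norm, Complex.normSq_apply, Complex.inner, Complex.mul_re, Complex.conj_re,
    Complex.conj_im, Complex.mul_im, Complex.I_re, Complex.I_im]
  ring

theorem sq_integral_le {f : ℝ → ℝ} (hf : MemLp f 2 volume) (a b : ℝ) :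
    (∫ x in a..b, f x) ^ 2 ≤ |b - a| * ∫ x, f x ^ 2 := by
  wlog hab : a ≤ b generalizing a b
  · rw [intervalIntegral.integral_symm, neg_sq, abs_sub_comm]
    exact this b a (not_le.1 hab).le
  rcases hab.eq_or_lt with rfl | hlt
  · simp
  have hi : Integrable (fun x => f x ^ 2) := hf.integrable_sq
  have hli : LocallyIntegrable f volume := hf.locallyIntegrable (by norm_num)
  have hii := locallyIntegrable_intervalIntegrable hli a b
  have hii2 : IntervalIntegrable (fun x => f x ^ 2) volume a b := hi.intervalIntegrable
  -- With `c` the mean of `f`, nonnegativity of the integral of `(f - c)²` is the Cauchy–Schwarz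
  -- inequality on `[a, b]`.
  set c : ℝ := (∫ x in a..b, f x) / (b - a) with hc
  have h0 : 0 ≤ ∫ x in a..b, (f x - c) ^ 2 :=
    intervalIntegral.integral_nonneg hab fun x _ => sq_nonneg _
  have h1 : ∫ x in a..b, (f x - c) ^ 2 =
      (∫ x in a..b, f x ^ 2) - 2 * c * (∫ x in a..b, f x) + c ^ 2 * (b - a) := by
    have : ∀ x, (f x - c) ^ 2 = f x ^ 2 - 2 * c * f x + c ^ 2 := fun x => by ring
    simp only [this]
    rw [intervalIntegral.integral_add (hii2.sub (hii.const_mul _)) (by simp),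
      intervalIntegral.integral_sub hii2 (hii.const_mul _), intervalIntegral.integral_const_mul]
    simp; ring
  have h2 : ∫ x in a..b, f x ^ 2 ≤ ∫ x, f x ^ 2 := by
    rw [intervalIntegral.integral_of_le hab]
    exact setIntegral_le_integral hi (Eventually.of_forall fun x => sq_nonneg _)
  have hpos : 0 < b - a := sub_pos.2 hlt
  have h3 : (∫ x in a..b, f x) = c * (b - a) := by rw [hc]; field_simp
  rw [abs_of_pos hpos]
  rw [h3] at h1 ⊢
  nlinarith

theorem IsPrimitive.norm_sub_sq_le {F : Type*} [NormedAddCommGroup F] [NormedSpace ℝ F]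
    {f g : ℝ → F} (h : IsPrimitive f g) (hg : MemLp g 2 volume) (a b : ℝ) :
    ‖f b - f a‖ ^ 2 ≤ |b - a| * ∫ x, ‖g x‖ ^ 2 := by
  rw [h.sub_eq]
  refine le_trans ?_ (sq_integral_le hg.norm a b)
  rw [sq_le_sq, abs_norm]
  exact intervalIntegral.norm_integral_le_abs_integral_norm

section EnergySpace

variable {v : ℝ → ℂ}

theorem energySpace_isPrimitive (hv : v ∈ energySpace) : IsPrimitive v (weakDeriv v) := by
  obtain ⟨hc, ⟨g, hg, -⟩, -⟩ := hv
  exact (hg.isPrimitive hc).congr_ae (weakDeriv_ae_eq hg).symm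

theorem energySpace_memLp_weakDeriv (hv : v ∈ energySpace) :
    MemLp (weakDeriv v) 2 volume := by
  obtain ⟨hc, ⟨g, hg, h2⟩, -⟩ := hv
  exact h2.ae_eq (weakDeriv_ae_eq hg).symm

theorem energySpace_memLp_intensity (hv : v ∈ energySpace) : MemLp (intensity v) 2 volume :=
  hv.2.2

theorem isPrimitive_intensity {g : ℝ → ℂ} (h : IsPrimitive v g) :
    IsPrimitive (intensity v) (fun x => -2 * inner ℝ (g x) (v x)) := by
  have hd : ContDiff ℝ 1 (fun z : ℂ => 1 - ‖z‖ ^ 2) := contDiff_const.sub (contDiff_norm_sq ℝ)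
  have hc := h.comp hd
  have : (fun x => fderiv ℝ (fun z : ℂ => 1 - ‖z‖ ^ 2) (v x) (g x)) =
      fun x => -2 * inner ℝ (g x) (v x) := by
    funext x
    have h1 : HasFDerivAt (fun z : ℂ => ‖z‖ ^ 2) (2 • innerSL ℝ (v x)) (v x) :=
      (hasStrictFDerivAt_norm_sq (v x)).hasFDerivAt
    rw [(h1.const_sub 1).fderiv]
    simp [real_inner_comm]
    ring
  rw [this] at hc
  exact hc

theorem energySpace_isPrimitive_intensity (hv : v ∈ energySpace) :
    IsPrimitive (intensity v) (fun x => -2 * radialSlope v x) :=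
  isPrimitive_intensity (energySpace_isPrimitive hv)

theorem weakDeriv_norm_sq_ae {g : ℝ → ℂ} (h : IsPrimitive v g) :
    weakDeriv (fun x => ‖v x‖ ^ 2) =ᵐ[volume] fun x => 2 * inner ℝ (g x) (v x) := by
  have h1 := (isPrimitive_intensity h).const_sub_eq 1
  have h2 : (fun x => 1 - intensity v x) = fun x => ‖v x‖ ^ 2 := by
    funext x; simp [intensity]
  rw [h2] at h1
  refine (weakDeriv_ae_eq h1.hasWeakDeriv).trans (Eventually.of_forall fun x => ?_)
  simp

/-- Every unit interval contains a point where the modulus is at most `2 + A`, as otherwise the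
squared intensity would have integral at least `(1 + A)² > A` there; Hölder continuity of exponent
1/2 carries the bound to `x`. The constant depends on `A` only, as is needed along sequences. -/
theorem energySpace_norm_le (hv : v ∈ energySpace) {A : ℝ}
    (hA : ∫ x, ‖weakDeriv v x‖ ^ 2 ≤ A) (hA' : ∫ x, intensity v x ^ 2 ≤ A) (x : ℝ) :
    ‖v x‖ ≤ 3 + 2 * A := by
  have hA0 : 0 ≤ A := le_trans (integral_nonneg fun x => sq_nonneg _) hA
  obtain ⟨y, hy, hyN⟩ : ∃ y ∈ Icc x (x + 1), ‖v y‖ ≤ 2 + A := by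
    by_contra! hcon
    have hi : Integrable (fun x => intensity v x ^ 2) :=
      (energySpace_memLp_intensity hv).integrable_sq
    have h1 : ∫ t in x..(x + 1), (1 + A) ^ 2 ≤ ∫ t in x..(x + 1), intensity v t ^ 2 := by
      refine intervalIntegral.integral_mono_on (by linarith) (by simp) hi.intervalIntegrable ?_
      intro t ht
      have := hcon t ht
      have h3 : (1 + A) ≤ ‖v t‖ ^ 2 - 1 := by nlinarith
      calc (1 + A) ^ 2 ≤ (‖v t‖ ^ 2 - 1) ^ 2 := by gcongr
        _ = intensity v t ^ 2 := by rw [intensity]; ring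
    have h2 : ∫ t in x..(x + 1), intensity v t ^ 2 ≤ ∫ t, intensity v t ^ 2 := by
      rw [intervalIntegral.integral_of_le (by linarith)]
      exact setIntegral_le_integral hi (Eventually.of_forall fun x => sq_nonneg _)
    simp at h1
    nlinarith
  have h3 := (energySpace_isPrimitive hv).norm_sub_sq_le (energySpace_memLp_weakDeriv hv) y x
  have h4 : |x - y| ≤ 1 := by rw [abs_le]; constructor <;> linarith [hy.1, hy.2]
  have h5 : ‖v x - v y‖ ^ 2 ≤ A := by
    calc _ ≤ _ := h3
      _ ≤ 1 * A := by gcongr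
      _ = A := one_mul A
  have h6 : ‖v x - v y‖ ≤ 1 + A := by
    by_contra! h
    nlinarith [norm_nonneg (v x - v y)]
  have h7 : ‖v x‖ ≤ ‖v x - v y‖ + ‖v y‖ := by
    simpa using norm_add_le (v x - v y) (v y)
  linarith

theorem energySpace_bounded (hv : v ∈ energySpace) : ∃ C, 0 < C ∧ ∀ x, ‖v x‖ ≤ C := by
  set A := max (∫ x, ‖weakDeriv v x‖ ^ 2) (∫ x, intensity v x ^ 2)
  have hA : 0 ≤ A := le_trans (integral_nonneg fun x => sq_nonneg _) (le_max_right _ _)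
  exact ⟨3 + 2 * A, by linarith, energySpace_norm_le hv (le_max_left _ _) (le_max_right _ _)⟩

theorem continuous_intensity (hv : Continuous v) : Continuous (intensity v) := by
  unfold intensity; fun_prop

theorem aestronglyMeasurable_radialSlope (hv : v ∈ energySpace) :
    AEStronglyMeasurable (radialSlope v) volume :=
  (energySpace_memLp_weakDeriv hv).1.inner hv.1.aestronglyMeasurable

theorem aestronglyMeasurable_angularSlope (hv : v ∈ energySpace) :
    AEStronglyMeasurable (angularSlope v) volume :=
  ((energySpace_memLp_weakDeriv hv).1.const_mul _).inner hv.1.aestronglyMeasurable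

theorem abs_radialSlope_le (v : ℝ → ℂ) (x : ℝ) :
    |radialSlope v x| ≤ ‖weakDeriv v x‖ * ‖v x‖ := abs_real_inner_le_norm _ _

theorem abs_angularSlope_le (v : ℝ → ℂ) (x : ℝ) :
    |angularSlope v x| ≤ ‖weakDeriv v x‖ * ‖v x‖ := by
  have := abs_real_inner_le_norm (Complex.I * weakDeriv v x) (v x)
  rwa [norm_mul, Complex.norm_I, one_mul] at this

theorem memLp_radialSlope (hv : v ∈ energySpace) : MemLp (radialSlope v) 2 volume := by
  obtain ⟨C, -, hC⟩ := energySpace_bounded hv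
  refine (energySpace_memLp_weakDeriv hv).of_le_mul (aestronglyMeasurable_radialSlope hv)
    (c := C) (Eventually.of_forall fun x => ?_)
  rw [mul_comm]
  exact (abs_radialSlope_le v x).trans (by gcongr; exact hC x)

theorem memLp_angularSlope (hv : v ∈ energySpace) : MemLp (angularSlope v) 2 volume := by
  obtain ⟨C, -, hC⟩ := energySpace_bounded hv
  refine (energySpace_memLp_weakDeriv hv).of_le_mul (aestronglyMeasurable_angularSlope hv)
    (c := C) (Eventually.of_forall fun x => ?_)
  rw [mul_comm]
  exact (abs_angularSlope_le v x).trans (by gcongr; exact hC x)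

/-- Integrability of `h'` gives limits at both ends, and an integrable function cannot have a
nonzero limit at infinity. -/
theorem IsPrimitive.tendsto_zero {h h' : ℝ → ℝ} (hp : IsPrimitive h h') (hi : Integrable h)
    (hi' : Integrable h') : Tendsto h atTop (𝓝 0) ∧ Tendsto h atBot (𝓝 0) := by
  have h1 : Tendsto h atTop (𝓝 (h 0 + ∫ t in Ioi (0 : ℝ), h' t)) := by
    have := (intervalIntegral_tendsto_integral_Ioi 0 hi'.integrableOn tendsto_id).const_add (h 0)
    exact this.congr fun x => (hp.2 x).symm
  have h2 : Tendsto h atBot (𝓝 (h 0 + -∫ t in Iic (0 : ℝ), h' t)) := by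
    have := (intervalIntegral_tendsto_integral_Iic 0 hi'.integrableOn tendsto_id).neg.const_add
      (h 0)
    refine this.congr fun x => ?_
    rw [hp.2 x, intervalIntegral.integral_symm, neg_neg]; rfl
  have e1 : h 0 + ∫ t in Ioi (0 : ℝ), h' t = 0 := by
    refine IntegrableAtFilter.eq_zero_of_tendsto (f := h) (μ := volume) (l := atTop)
      ⟨univ, univ_mem, hi.integrableOn⟩ ?_ h1
    intro s hs
    obtain ⟨b, hb⟩ := mem_atTop_sets.1 hs
    exact top_unique (le_trans (by simp) (measure_mono (show Ici b ⊆ s from hb)))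
  have e2 : h 0 + -∫ t in Iic (0 : ℝ), h' t = 0 := by
    refine IntegrableAtFilter.eq_zero_of_tendsto (f := h) (μ := volume) (l := atBot)
      ⟨univ, univ_mem, hi.integrableOn⟩ ?_ h2
    intro s hs
    obtain ⟨b, hb⟩ := mem_atBot_sets.1 hs
    exact top_unique (le_trans (by simp) (measure_mono (show Iic b ⊆ s from hb)))
  rw [e1] at h1; rw [e2] at h2
  exact ⟨h1, h2⟩

/-- The previous lemma is applied to the square of the intensity, whose derivative is a product of
two L² functions; the intensity itself need not be integrable. -/
theorem intensity_tendsto_zero (hv : v ∈ energySpace) :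
    Tendsto (intensity v) atTop (𝓝 0) ∧ Tendsto (intensity v) atBot (𝓝 0) := by
  have hp := energySpace_isPrimitive_intensity hv
  have hm := energySpace_memLp_intensity hv
  have hs := hp.smul (𝕂 := ℝ) hp
  have key := hs.tendsto_zero (by simpa [sq] using hm.integrable_sq) (by
    have h1 : Integrable (fun x => intensity v x * (-2 * radialSlope v x)) :=
      hm.integrable_mul ((memLp_radialSlope hv).const_mul (-2))
    refine (h1.add h1).congr (Eventually.of_forall fun x => ?_)
    simp only [Pi.add_apply, smul_eq_mul]; ring)
  simp only [smul_eq_mul] at key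
  have aux : ∀ l : Filter ℝ, Tendsto (fun x => intensity v x * intensity v x) l (𝓝 0) →
      Tendsto (intensity v) l (𝓝 0) := by
    intro l hl
    rw [tendsto_zero_iff_abs_tendsto_zero]
    have := hl.sqrt
    rw [Real.sqrt_zero] at this
    exact this.congr fun x => by rw [Real.sqrt_mul_self_eq_abs]; rfl
  exact ⟨aux _ key.1, aux _ key.2⟩

/-- The energy density in terms of the weak derivative. -/
noncomputable def energyDensity (κ : ℝ) (v : ℝ → ℂ) (x : ℝ) : ℝ :=
  1 / 2 * ‖weakDeriv v x‖ ^ 2 + 1 / 4 * intensity v x ^ 2 - κ * radialSlope v x ^ 2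

theorem integrable_energyDensity (κ : ℝ) (hv : v ∈ energySpace) :
    Integrable (energyDensity κ v) :=
  (((energySpace_memLp_weakDeriv hv).norm.integrable_sq.const_mul _).add
    ((energySpace_memLp_intensity hv).integrable_sq.const_mul _)).sub
    ((memLp_radialSlope hv).integrable_sq.const_mul _)

theorem energy_eq_integral (κ : ℝ) (hv : v ∈ energySpace) :
    energy κ v = ∫ x, energyDensity κ v x := by
  have h1 := (energySpace_memLp_weakDeriv hv).norm.integrable_sq.const_mul (1 / 2)
  have h2 := (energySpace_memLp_intensity hv).integrable_sq.const_mul (1 / 4)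
  have h3 := (memLp_radialSlope hv).integrable_sq.const_mul κ
  have h4 : ∫ x, (weakDeriv (fun y => ‖v y‖ ^ 2) x) ^ 2 = 4 * ∫ x, radialSlope v x ^ 2 := by
    rw [← integral_const_mul]
    refine integral_congr_ae ((weakDeriv_norm_sq_ae (energySpace_isPrimitive hv)).mono
      fun x hx => ?_)
    simp only [hx, radialSlope]; ring
  unfold energyDensity
  rw [integral_sub (by exact h1.add h2) h3, integral_add h1 h2, integral_const_mul, integral_const_mul,
    integral_const_mul, energy, h4]
  simp only [intensity]
  ring

theorem energyDensity_nonneg {κ : ℝ} (hκ : κ ≤ 0) (v : ℝ → ℂ) (x : ℝ) :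
    0 ≤ energyDensity κ v x := by
  have := mul_nonneg (neg_nonneg.2 hκ) (sq_nonneg (radialSlope v x))
  unfold energyDensity
  nlinarith [sq_nonneg ‖weakDeriv v x‖, sq_nonneg (intensity v x)]

theorem energy_nonneg {κ : ℝ} (hκ : κ ≤ 0) (hv : v ∈ energySpace) : 0 ≤ energy κ v := by
  rw [energy_eq_integral κ hv]
  exact integral_nonneg (energyDensity_nonneg hκ v)

theorem integral_weakDeriv_sq_le {κ : ℝ} (hκ : κ ≤ 0) (hv : v ∈ energySpace) :
    ∫ x, ‖weakDeriv v x‖ ^ 2 ≤ 4 * energy κ v ∧ ∫ x, intensity v x ^ 2 ≤ 4 * energy κ v := by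
  have h1 := (energySpace_memLp_weakDeriv hv).norm.integrable_sq
  have h2 := (energySpace_memLp_intensity hv).integrable_sq
  have hk : ∀ x, 0 ≤ -κ * radialSlope v x ^ 2 := fun x =>
    mul_nonneg (neg_nonneg.2 hκ) (sq_nonneg _)
  rw [energy_eq_integral κ hv, ← integral_const_mul]
  constructor
  · refine integral_mono h1 ((integrable_energyDensity κ hv).const_mul _) fun x => ?_
    have := hk x
    simp only [energyDensity]
    nlinarith [sq_nonneg ‖weakDeriv v x‖, sq_nonneg (intensity v x)]
  · refine integral_mono h2 ((integrable_energyDensity κ hv).const_mul _) fun x => ?_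
    have := hk x
    simp only [energyDensity]
    nlinarith [sq_nonneg ‖weakDeriv v x‖, sq_nonneg (intensity v x)]

end EnergySpace

/-! ### The calibration and the lower bound for `E - c p`. -/

/-- The derivative of the calibration; it vanishes for `y ≥ 1 - c² / 2`. -/
noncomputable def calibrationRate (c κ y : ℝ) : ℝ :=
  y * √(1 - 2 * κ * (1 - y)) * √(2 - c ^ 2 - 2 * y) / (4 * (1 - y))

/-- The calibration, whose variation along the intensity bounds `E - c p` from below. -/
noncomputable def calibration (c κ y : ℝ) : ℝ := ∫ z in (0 : ℝ)..y, calibrationRate c κ z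

theorem calibrationRate_eq_zero {c κ y : ℝ} (h : 1 - c ^ 2 / 2 ≤ y) :
    calibrationRate c κ y = 0 := by
  rw [calibrationRate, Real.sqrt_eq_zero_of_nonpos (by linarith : 2 - c ^ 2 - 2 * y ≤ 0)]
  simp

/-- The pole of the formula at `y = 1` is invisible: `1 - c² / 2 < 1` because `c > 0`, and beyond
this level the square root of a negative number is `0`. -/
theorem continuous_calibrationRate {c : ℝ} (hc : 0 < c) (κ : ℝ) :
    Continuous (calibrationRate c κ) := by
  rw [continuous_iff_continuousAt]
  intro y
  by_cases hy : y < 1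
  · unfold calibrationRate
    refine ContinuousAt.div (by fun_prop) (by fun_prop) (by nlinarith)
  · have h1 : 1 - c ^ 2 / 2 < y := by nlinarith
    have : calibrationRate c κ =ᶠ[𝓝 y] fun _ => 0 := by
      filter_upwards [lt_mem_nhds h1] with z hz
      exact calibrationRate_eq_zero hz.le
    exact continuousAt_const.congr this.symm

theorem hasDerivAt_calibration {c : ℝ} (hc : 0 < c) (κ y : ℝ) :
    HasDerivAt (calibration c κ) (calibrationRate c κ y) y :=
  intervalIntegral.integral_hasDerivAt_right
    ((continuous_calibrationRate hc κ).intervalIntegrable _ _)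
    ((continuous_calibrationRate hc κ).stronglyMeasurableAtFilter _ _)
    (continuous_calibrationRate hc κ).continuousAt

theorem continuous_calibration {c : ℝ} (hc : 0 < c) (κ : ℝ) : Continuous (calibration c κ) :=
  continuous_iff_continuousAt.2 fun y => (hasDerivAt_calibration hc κ y).continuousAt

theorem calibration_zero (c κ : ℝ) : calibration c κ 0 = 0 := by simp [calibration]

theorem calibration_eq_of_le {c : ℝ} (hc : 0 < c) (κ : ℝ) {y : ℝ} (h : 1 - c ^ 2 / 2 ≤ y) :
    calibration c κ y = calibration c κ (1 - c ^ 2 / 2) := by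
  have hi := fun a b => (continuous_calibrationRate hc κ).intervalIntegrable (μ := volume) a b
  rw [← sub_eq_zero, calibration, calibration,
    intervalIntegral.integral_interval_sub_left (hi _ _) (hi _ _)]
  rw [intervalIntegral.integral_congr (g := fun _ => (0 : ℝ)), intervalIntegral.integral_zero]
  intro z hz
  rw [uIcc_of_le h] at hz
  exact calibrationRate_eq_zero hz.1

theorem IsPrimitive.comp_calibration {h h' : ℝ → ℝ} (hp : IsPrimitive h h') {c : ℝ} (hc : 0 < c)
    (κ : ℝ) : IsPrimitive (fun x => calibration c κ (h x))
      (fun x => calibrationRate c κ (h x) * h' x) := by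
  have hd : deriv (calibration c κ) = calibrationRate c κ :=
    funext fun y => (hasDerivAt_calibration hc κ y).deriv
  have hC : ContDiff ℝ 1 (calibration c κ) := by
    rw [contDiff_one_iff_deriv, hd]
    exact ⟨fun y => (hasDerivAt_calibration hc κ y).differentiableAt,
      continuous_calibrationRate hc κ⟩
  refine (hp.comp hC).congr_ae (Eventually.of_forall fun x => ?_)
  simp only
  rw [(hasDerivAt_calibration hc κ (h x)).hasFDerivAt.fderiv]
  simp [mul_comm]

theorem IsPrimitive.integral_Ioi {h h' : ℝ → ℝ} (hp : IsPrimitive h h') (hi : Integrable h')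
    (ht : Tendsto h atTop (𝓝 0)) (a : ℝ) : ∫ x in Ioi a, h' x = - h a := by
  have h1 := intervalIntegral_tendsto_integral_Ioi a hi.integrableOn tendsto_id
  have h2 : Tendsto (fun x => h x - h a) atTop (𝓝 (0 - h a)) := ht.sub_const _
  rw [zero_sub] at h2
  exact tendsto_nhds_unique h1 (h2.congr fun x => hp.sub_eq a x)

theorem IsPrimitive.integral_Iic {h h' : ℝ → ℝ} (hp : IsPrimitive h h') (hi : Integrable h')
    (ht : Tendsto h atBot (𝓝 0)) (a : ℝ) : ∫ x in Iic a, h' x = h a := by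
  have h1 := intervalIntegral_tendsto_integral_Iic a hi.integrableOn tendsto_id
  have h2 : Tendsto (fun x => h a - h x) atBot (𝓝 (h a - 0)) := ht.const_sub _
  rw [sub_zero] at h2
  exact tendsto_nhds_unique h1 (h2.congr fun x => hp.sub_eq x a)

/-- The momentum density. -/
noncomputable def momentumDensity (v : ℝ → ℂ) (x : ℝ) : ℝ :=
  1 / 2 * (angularSlope v x * (1 - 1 / ‖v x‖ ^ 2))

theorem momentum_eq_integral (v : ℝ → ℂ) : momentum v = ∫ x, momentumDensity v x := by
  unfold momentumDensity
  rw [integral_const_mul]; rfl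

section Bounds

variable {v : ℝ → ℂ}

theorem energyDensity_eq_of_ne_zero (κ : ℝ) {x : ℝ} (h : v x ≠ 0) :
    energyDensity κ v x = (radialSlope v x ^ 2 + angularSlope v x ^ 2) / (2 * ‖v x‖ ^ 2)
      + intensity v x ^ 2 / 4 - κ * radialSlope v x ^ 2 := by
  have h0 : ‖v x‖ ≠ 0 := norm_ne_zero_iff.2 h
  rw [radialSlope, angularSlope, ← norm_sq_mul_norm_sq, energyDensity, radialSlope]
  field_simp

/-- Multiplied by `8 (1 - η)`, the density reads `4β² + 4α²b² + η²(t² + c²)`, with `α`, `β` the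
radial and angular slopes, and `4|αbηt| ≤ 4α²b² + η²t²`. Where the intensity exceeds `1 - c² / 2`
the rate is zero, so that zeros of `v` do no harm. -/
theorem abs_calibrationRate_mul_le {κ : ℝ} (hκ : κ ≤ 0) {c : ℝ} (hc : 0 < c) (v : ℝ → ℂ)
    (x : ℝ) :
    |calibrationRate c κ (intensity v x) * (-2 * radialSlope v x)| ≤ energyDensity κ v x := by
  by_cases hy : 1 - c ^ 2 / 2 ≤ intensity v x
  · rw [calibrationRate_eq_zero hy, zero_mul, abs_zero]
    exact energyDensity_nonneg hκ v x
  push Not at hy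
  have hρ : c ^ 2 / 2 < ‖v x‖ ^ 2 := by unfold intensity at hy; linarith
  have hρ0 : 0 < ‖v x‖ ^ 2 := lt_trans (by positivity) hρ
  have hne : v x ≠ 0 := by
    rintro h0
    simp [h0] at hρ0
  rw [energyDensity_eq_of_ne_zero κ hne, calibrationRate]
  set η := intensity v x with hη
  set α := radialSlope v x
  set β := angularSlope v x
  have hr : ‖v x‖ ^ 2 = 1 - η := by rw [hη, intensity]; ring
  rw [hr] at hρ0 hρ ⊢
  set b := √(1 - 2 * κ * (1 - η)) with hb
  set t := √(2 - c ^ 2 - 2 * η) with ht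
  have hb2 : b ^ 2 = 1 - 2 * κ * (1 - η) := Real.sq_sqrt (by nlinarith)
  have ht2 : t ^ 2 = 2 - c ^ 2 - 2 * η := Real.sq_sqrt (by linarith)
  have hc2 : 0 < c ^ 2 := by positivity
  have e1 : η * b * t / (4 * (1 - η)) * (-2 * α) = -(4 * α * b * η * t) / (8 * (1 - η)) := by
    field_simp; ring
  have e2 : (α ^ 2 + β ^ 2) / (2 * (1 - η)) + η ^ 2 / 4 - κ * α ^ 2 =
      (4 * β ^ 2 + 4 * α ^ 2 * b ^ 2 + η ^ 2 * (t ^ 2 + c ^ 2)) / (8 * (1 - η)) := by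
    rw [hb2, ht2]; field_simp; ring
  rw [e1, e2, abs_div, abs_of_pos (by linarith : 0 < 8 * (1 - η))]
  gcongr
  rw [abs_le]
  constructor <;> nlinarith [sq_nonneg (2 * α * b - η * t), sq_nonneg (2 * α * b + η * t),
    sq_nonneg β, mul_nonneg (sq_nonneg η) hc2.le]

theorem calibration_intensity_facts {κ : ℝ} (hκ : κ ≤ 0) {c : ℝ} (hc : 0 < c)
    (hv : v ∈ energySpace) :
    IsPrimitive (fun x => calibration c κ (intensity v x))
      (fun x => calibrationRate c κ (intensity v x) * (-2 * radialSlope v x)) ∧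
    Integrable (fun x => calibrationRate c κ (intensity v x) * (-2 * radialSlope v x)) ∧
    Tendsto (fun x => calibration c κ (intensity v x)) atTop (𝓝 0) ∧
    Tendsto (fun x => calibration c κ (intensity v x)) atBot (𝓝 0) := by
  have hp := (energySpace_isPrimitive_intensity hv).comp_calibration hc κ
  have h0 := (continuous_calibration hc κ).tendsto 0
  rw [calibration_zero] at h0
  refine ⟨hp, ?_, h0.comp (intensity_tendsto_zero hv).1, h0.comp (intensity_tendsto_zero hv).2⟩
  exact (integrable_energyDensity κ hv).mono' hp.1.aestronglyMeasurable
    (Eventually.of_forall fun x => abs_calibrationRate_mul_le hκ hc v x)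

/-- A map whose intensity reaches the level `1 - c² / 2` has energy at least twice the total
calibration. -/
theorem two_mul_calibration_le_energy {κ : ℝ} (hκ : κ ≤ 0) {c : ℝ} (hc : 0 < c)
    (hv : v ∈ energySpace) {x₀ : ℝ} (hx : 1 - c ^ 2 / 2 ≤ intensity v x₀) :
    2 * calibration c κ (1 - c ^ 2 / 2) ≤ energy κ v := by
  obtain ⟨hp, hi, h1, h2⟩ := calibration_intensity_facts hκ hc hv
  have hE := integrable_energyDensity κ hv
  rw [energy_eq_integral κ hv, ← intervalIntegral.integral_Iic_add_Ioi (b := x₀)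
    hE.integrableOn hE.integrableOn]
  have e1 := hp.integral_Ioi hi h1 x₀
  have e2 := hp.integral_Iic hi h2 x₀
  -- The calibration is constant above the level `1 - c² / 2`, so its value at `x₀` does not depend
  -- on the height reached there.
  simp only [calibration_eq_of_le hc κ hx] at e1 e2
  have i1 : ∫ x in Ioi x₀, -(calibrationRate c κ (intensity v x) * (-2 * radialSlope v x)) ≤
      ∫ x in Ioi x₀, energyDensity κ v x :=
    integral_mono hi.neg.integrableOn hE.integrableOn fun x =>
      (neg_le_abs _).trans (abs_calibrationRate_mul_le hκ hc v x)
  have i2 : ∫ x in Iic x₀, calibrationRate c κ (intensity v x) * (-2 * radialSlope v x) ≤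
      ∫ x in Iic x₀, energyDensity κ v x :=
    integral_mono hi.integrableOn hE.integrableOn fun x =>
      (le_abs_self _).trans (abs_calibrationRate_mul_le hκ hc v x)
  rw [integral_neg] at i1
  linarith

theorem nonvanishingSpace_norm_ge (hv : v ∈ nonvanishingSpace) : ∃ δ > 0, ∀ x, δ ≤ ‖v x‖ :=
  ⟨_, hv.2, fun x => ciInf_le ⟨0, by rintro _ ⟨y, rfl⟩; exact norm_nonneg _⟩ x⟩

theorem nonvanishingSpace_ne_zero (hv : v ∈ nonvanishingSpace) (x : ℝ) : v x ≠ 0 := by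
  obtain ⟨δ, hδ, h⟩ := nonvanishingSpace_norm_ge hv
  exact norm_pos_iff.1 (hδ.trans_le (h x))

theorem intensity_lt_one (hv : v ∈ nonvanishingSpace) (x : ℝ) : intensity v x < 1 := by
  have := norm_pos_iff.2 (nonvanishingSpace_ne_zero hv x)
  unfold intensity
  nlinarith

/-- If the intensity is positive somewhere then it has a positive maximum. -/
theorem exists_max_intensity (hv : v ∈ energySpace) {y : ℝ} (hy : 0 < intensity v y) :
    ∃ x₀, 0 < intensity v x₀ ∧ ∀ x, intensity v x ≤ intensity v x₀ := by
  have hc := continuous_intensity hv.1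
  obtain ⟨h1, h2⟩ := intensity_tendsto_zero hv
  have h3 : Tendsto (intensity v) (cocompact ℝ) (𝓝 0) := by
    rw [cocompact_eq_atBot_atTop]
    exact h2.sup h1
  obtain ⟨x₀, hx⟩ := hc.exists_forall_ge' (x₀ := y) ((h3.eventually (gt_mem_nhds hy)).mono
    fun x hx => hx.le)
  exact ⟨x₀, hy.trans_le (hx y), hx⟩

/-- The modulus tends to `1` at infinity, so either it has a positive minimum, attained where the
intensity is maximal, or it is at least `1` everywhere. -/
theorem mem_nonvanishingSpace (hv : v ∈ energySpace) (h : ∀ x, v x ≠ 0) :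
    v ∈ nonvanishingSpace := by
  refine ⟨hv, ?_⟩
  by_cases hpos : ∃ y, 0 < intensity v y
  · obtain ⟨y, hy⟩ := hpos
    obtain ⟨x₀, -, hx⟩ := exists_max_intensity hv hy
    refine (norm_pos_iff.2 (h x₀)).trans_le (le_ciInf fun x => ?_)
    have := hx x
    unfold intensity at this
    exact (sq_le_sq₀ (norm_nonneg _) (norm_nonneg _)).1 (by linarith)
  · push Not at hpos
    refine one_pos.trans_le (le_ciInf fun x => ?_)
    have := hpos x
    unfold intensity at this
    nlinarith [norm_nonneg (v x)]

theorem integrable_momentumDensity (hv : v ∈ nonvanishingSpace) :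
    Integrable (momentumDensity v) := by
  obtain ⟨δ, hδ, h⟩ := nonvanishingSpace_norm_ge hv
  have h1 : Integrable (fun x => angularSlope v x * intensity v x) :=
    (memLp_angularSlope hv.1).integrable_mul (energySpace_memLp_intensity hv.1)
  have hne := nonvanishingSpace_ne_zero hv
  have hm : AEStronglyMeasurable (momentumDensity v) volume := by
    refine AEStronglyMeasurable.const_mul
      ((aestronglyMeasurable_angularSlope hv.1).mul ?_) _
    have : Continuous fun x => 1 - 1 / ‖v x‖ ^ 2 :=
      continuous_const.sub (continuous_const.div (hv.1.1.norm.pow 2) fun x => by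
        simpa using hne x)
    exact this.aestronglyMeasurable
  refine (h1.norm.const_mul (1 / δ ^ 2)).mono' hm (Eventually.of_forall fun x => ?_)
  have hx : 0 < ‖v x‖ := norm_pos_iff.2 (hne x)
  have e : momentumDensity v x = -(1 / (2 * ‖v x‖ ^ 2)) * (angularSlope v x * intensity v x) := by
    rw [momentumDensity, intensity]; field_simp; ring
  rw [e, norm_mul]
  gcongr
  rw [norm_neg, Real.norm_of_nonneg (by positivity)]
  apply one_div_le_one_div_of_le (by positivity)
  have := h x
  nlinarith

/-- The density of the defect of the calibrated lower bound. -/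
noncomputable def defect (c κ x₀ : ℝ) (v : ℝ → ℂ) (x : ℝ) : ℝ :=
  (angularSlope v x + c / 2 * intensity v x) ^ 2 / (2 * ‖v x‖ ^ 2) +
  (2 * radialSlope v x * √(1 - 2 * κ * ‖v x‖ ^ 2) - (if x ≤ x₀ then -1 else 1) *
    (intensity v x * √(2 - c ^ 2 - 2 * intensity v x))) ^ 2 / (8 * ‖v x‖ ^ 2)

theorem defect_nonneg (c κ x₀ : ℝ) (v : ℝ → ℂ) (x : ℝ) : 0 ≤ defect c κ x₀ v x := by
  unfold defect; positivity

/-- Completion of two squares. The term `-c p` completes `β²` to `(β + cη/2)²`, the missing `c²η²/4`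
being taken from the potential. The remaining `4α²b² + η²t²` is the square of `2αb ∓ ηt` plus a
cross term, which is the derivative of the calibration along `η`. The sign flips at `x₀` so that
both half lines contribute positively. -/
theorem energyDensity_sub_momentumDensity {κ : ℝ} (hκ : κ ≤ 0) {c : ℝ} (x₀ : ℝ) {x : ℝ}
    (hne : v x ≠ 0) (hm : intensity v x ≤ 1 - c ^ 2 / 2) :
    energyDensity κ v x - c * momentumDensity v x = defect c κ x₀ v x +
      -(if x ≤ x₀ then -1 else 1) *
        (calibrationRate c κ (intensity v x) * (-2 * radialSlope v x)) := by
  have hx : 0 < ‖v x‖ ^ 2 := by have := norm_pos_iff.2 hne; positivity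
  rw [energyDensity_eq_of_ne_zero κ hne, calibrationRate, momentumDensity, defect]
  set η := intensity v x with hη
  set α := radialSlope v x
  set β := angularSlope v x
  have hr : ‖v x‖ ^ 2 = 1 - η := by rw [hη, intensity]; ring
  rw [hr] at hx ⊢
  set b := √(1 - 2 * κ * (1 - η)) with hb
  set t := √(2 - c ^ 2 - 2 * η) with ht
  have hb2 : b ^ 2 = 1 - 2 * κ * (1 - η) := Real.sq_sqrt (by nlinarith)
  have ht2 : t ^ 2 = 2 - c ^ 2 - 2 * η := Real.sq_sqrt (by linarith)
  have hs : ((if x ≤ x₀ then -1 else 1 : ℝ)) ^ 2 = 1 := by split_ifs <;> norm_num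
  set s : ℝ := if x ≤ x₀ then -1 else 1
  have e : (2 * α * b - s * (η * t)) ^ 2 =
      4 * α ^ 2 * (1 - 2 * κ * (1 - η)) - 4 * s * α * b * η * t
        + η ^ 2 * (2 - c ^ 2 - 2 * η) := by
    rw [← hb2, ← ht2]; linear_combination (η * t) ^ 2 * hs
  rw [e]
  field_simp
  ring

/-- The calibration identity. -/
theorem energy_sub_momentum_eq {κ : ℝ} (hκ : κ ≤ 0) {c : ℝ} (hc : 0 < c)
    (hv : v ∈ nonvanishingSpace) {x₀ : ℝ} (hmax : ∀ x, intensity v x ≤ 1 - c ^ 2 / 2)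
    (hx₀ : intensity v x₀ = 1 - c ^ 2 / 2) :
    Integrable (defect c κ x₀ v) ∧ energy κ v - c * momentum v =
      2 * calibration c κ (1 - c ^ 2 / 2) + ∫ x, defect c κ x₀ v x := by
  obtain ⟨hp, hi, h1, h2⟩ := calibration_intensity_facts hκ hc hv.1
  have hE := integrable_energyDensity κ hv.1
  have hM := integrable_momentumDensity hv
  set g := fun x => calibrationRate c κ (intensity v x) * (-2 * radialSlope v x) with hg
  have hsi : Integrable (fun x => -(if x ≤ x₀ then -1 else 1 : ℝ) * g x) := by
    refine hi.norm.mono' ?_ (Eventually.of_forall fun x => ?_)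
    · refine AEStronglyMeasurable.mul ?_ hi.1
      exact (Measurable.ite measurableSet_Iic measurable_const
        measurable_const).neg.aestronglyMeasurable
    · split_ifs <;> simp
  have hid : ∀ x, energyDensity κ v x - c * momentumDensity v x = defect c κ x₀ v x +
      -(if x ≤ x₀ then -1 else 1 : ℝ) * g x := fun x =>
    energyDensity_sub_momentumDensity hκ x₀ (nonvanishingSpace_ne_zero hv x) (hmax x)
  have hdi : Integrable (defect c κ x₀ v) := by
    refine ((hE.sub (hM.const_mul c)).sub hsi).congr (Eventually.of_forall fun x => ?_)
    have := hid x
    simp only [Pi.sub_apply]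
    linarith
  refine ⟨hdi, ?_⟩
  have e1 := hp.integral_Ioi hi h1 x₀
  have e2 := hp.integral_Iic hi h2 x₀
  -- Each half line contributes the total calibration: on the left `η` runs from `0` up to its
  -- maximum, on the right it runs back and the sign is reversed.
  have e3 : ∫ x, -(if x ≤ x₀ then -1 else 1 : ℝ) * g x = 2 * calibration c κ (1 - c ^ 2 / 2) := by
    rw [← intervalIntegral.integral_Iic_add_Ioi (b := x₀) hsi.integrableOn hsi.integrableOn]
    have a1 : ∫ x in Iic x₀, -(if x ≤ x₀ then -1 else 1 : ℝ) * g x = ∫ x in Iic x₀, g x :=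
      setIntegral_congr_fun measurableSet_Iic fun x hx => by
        simp only [mem_Iic] at hx
        simp [hx]
    have a2 : ∫ x in Ioi x₀, -(if x ≤ x₀ then -1 else 1 : ℝ) * g x = ∫ x in Ioi x₀, - g x :=
      setIntegral_congr_fun measurableSet_Ioi fun x hx => by
        simp only [mem_Ioi] at hx
        simp [not_le.2 hx]
    rw [a1, a2, integral_neg, e1, e2, hx₀]
    ring
  rw [energy_eq_integral κ hv.1, momentum_eq_integral, ← integral_const_mul,
    ← integral_sub hE (hM.const_mul c), integral_congr_ae (Eventually.of_forall hid),
    integral_add hdi hsi, e3, add_comm]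

/-- The limiting case `c = √2`, which needs no calibration: once the square `(β + √2 η / 2)²` is
completed, the potential leaves a positive multiple of `-η³`, nonnegative when the modulus is at
least `1`. -/
theorem sqrt_two_mul_momentum_le_energy {κ : ℝ} (hκ : κ ≤ 0) (hv : v ∈ nonvanishingSpace)
    (h : ∀ x, intensity v x ≤ 0) : √2 * momentum v ≤ energy κ v := by
  rw [energy_eq_integral κ hv.1, momentum_eq_integral, ← integral_const_mul]
  refine integral_mono ((integrable_momentumDensity hv).const_mul _)
    (integrable_energyDensity κ hv.1) fun x => ?_
  have h2 : √2 ^ 2 = (2 : ℝ) := Real.sq_sqrt (by norm_num)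
  have hne := nonvanishingSpace_ne_zero hv x
  have hd := energyDensity_eq_of_ne_zero κ hne
  have hη := h x
  have hr : ‖v x‖ ^ 2 = 1 - intensity v x := by rw [intensity]; ring
  rw [hr] at hd
  simp only [momentumDensity, hr, hd]
  set η := intensity v x
  set α := radialSlope v x
  set β := angularSlope v x
  have hpos : 0 < 1 - η := by linarith
  have hk : 0 ≤ -κ * α ^ 2 := mul_nonneg (by linarith) (sq_nonneg _)
  have e : (α ^ 2 + β ^ 2) / (2 * (1 - η)) + η ^ 2 / 4 - κ * α ^ 2
      - √2 * (1 / 2 * (β * (1 - 1 / (1 - η)))) =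
      -κ * α ^ 2 + (2 * α ^ 2 + 2 * (β + √2 / 2 * η) ^ 2 + η ^ 2 * (-η)) / (4 * (1 - η)) := by
    have : (β + √2 / 2 * η) ^ 2 = β ^ 2 + √2 * β * η + η ^ 2 / 2 := by
      linear_combination η ^ 2 / 4 * h2
    rw [this]
    field_simp
    ring
  have : 0 ≤ (2 * α ^ 2 + 2 * (β + √2 / 2 * η) ^ 2 + η ^ 2 * (-η)) / (4 * (1 - η)) := by
    have : 0 ≤ η ^ 2 * (-η) := mul_nonneg (sq_nonneg _) (by linarith)
    positivity
  linarith

end Bounds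

/-! ### The explicit soliton profile as the inverse of a travel time. -/

theorem hasDerivAt_artanh {x : ℝ} (hx : x ∈ Ioo (-1 : ℝ) 1) :
    HasDerivAt Real.artanh (1 / (1 - x ^ 2)) x := by
  have h1 : (0 : ℝ) < 1 + x := by linarith [hx.1]
  have h2 : (0 : ℝ) < 1 - x := by linarith [hx.2]
  have e : Real.artanh =ᶠ[𝓝 x] fun y => 1 / 2 * (Real.log (1 + y) - Real.log (1 - y)) := by
    filter_upwards [Ioo_mem_nhds hx.1 hx.2] with y hy
    have h1 : (0 : ℝ) < 1 + y := by linarith [hy.1]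
    have h2 : (0 : ℝ) < 1 - y := by linarith [hy.2]
    rw [Real.artanh_eq_half_log ⟨hy.1.le, hy.2.le⟩, Real.log_div h1.ne' h2.ne']
  have d : HasDerivAt (fun y : ℝ => 1 / 2 * (Real.log (1 + y) - Real.log (1 - y)))
      (1 / 2 * (1 / (1 + x) - (-1) / (1 - x))) x :=
    ((((hasDerivAt_id x).const_add 1).log h1.ne').sub
      (((hasDerivAt_id x).const_sub 1).log h2.ne')).const_mul _
  refine (d.congr_of_eventuallyEq e).congr_deriv ?_
  have : (1 : ℝ) - x ^ 2 = (1 + x) * (1 - x) := by ring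
  rw [this]
  field_simp
  ring

/-- The square root of `1 - 2κ|u|²` as a function of `t = √(2|u|² - c²)`. -/
noncomputable def weight (c κ t : ℝ) : ℝ := √(1 - κ * (c ^ 2 + t ^ 2))

/-- The depth parameter `√(2 - c²)` of the soliton of speed `c`. -/
noncomputable def depth (c : ℝ) : ℝ := √(2 - c ^ 2)

/-- The position `x ≥ 0` at which `√(2|u|² - c²) = t`, extended as an odd function. -/
noncomputable def travelTime (c κ t : ℝ) : ℝ :=
  -2 * √(-κ) * Real.artanh (√(-κ) * (t / weight c κ t)) +
    2 * (√(1 - 2 * κ) / depth c) * Real.artanh (√(1 - 2 * κ) / depth c * (t / weight c κ t))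

section

variable {c κ : ℝ}

theorem weight_sq (hκ : κ ≤ 0) (c t : ℝ) : weight c κ t ^ 2 = 1 - κ * (c ^ 2 + t ^ 2) :=
  Real.sq_sqrt (by nlinarith [sq_nonneg c, sq_nonneg t])

theorem one_le_weight (hκ : κ ≤ 0) (c t : ℝ) : 1 ≤ weight c κ t :=
  Real.one_le_sqrt.2 (by nlinarith [sq_nonneg c, sq_nonneg t])

theorem weight_pos (hκ : κ ≤ 0) (c t : ℝ) : 0 < weight c κ t :=
  one_pos.trans_le (one_le_weight hκ c t)

theorem weight_neg (c κ t : ℝ) : weight c κ (-t) = weight c κ t := by simp [weight]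

theorem continuous_weight (c κ : ℝ) : Continuous (weight c κ) := by
  unfold weight; fun_prop

theorem hasDerivAt_weight (hκ : κ ≤ 0) (c t : ℝ) :
    HasDerivAt (weight c κ) (-κ * t / weight c κ t) t := by
  have h : HasDerivAt (fun t : ℝ => 1 - κ * (c ^ 2 + t ^ 2)) (-(κ * (2 * t))) t := by
    have := (((hasDerivAt_pow 2 t).const_add (c ^ 2)).const_mul κ).const_sub 1
    simpa using this
  have hpos : 1 - κ * (c ^ 2 + t ^ 2) ≠ 0 := by
    rw [← weight_sq hκ]; exact (pow_pos (weight_pos hκ c t) 2).ne'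
  refine (h.sqrt hpos).congr_deriv ?_
  change _ / (2 * weight c κ t) = _
  have := weight_pos hκ c t
  field_simp

theorem depth_sq (hc : c ^ 2 < 2) : depth c ^ 2 = 2 - c ^ 2 := Real.sq_sqrt (by linarith)

theorem depth_pos (hc : c ^ 2 < 2) : 0 < depth c := Real.sqrt_pos.2 (by linarith)

theorem hasDerivAt_div_weight (hκ : κ ≤ 0) (c t : ℝ) :
    HasDerivAt (fun t => t / weight c κ t) ((1 - κ * c ^ 2) / weight c κ t ^ 3) t := by
  have hw := weight_pos hκ c t
  refine ((hasDerivAt_id t).div (hasDerivAt_weight hκ c t) hw.ne').congr_deriv ?_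
  simp only [id]
  field_simp
  rw [weight_sq hκ]
  ring

theorem sq_div_weight (hκ : κ ≤ 0) (c t : ℝ) :
    (t / weight c κ t) ^ 2 = t ^ 2 / (1 - κ * (c ^ 2 + t ^ 2)) := by
  rw [div_pow, weight_sq hκ]

theorem mem_Ioo_of_sq_lt_one {x : ℝ} (h : x ^ 2 < 1) : x ∈ Ioo (-1 : ℝ) 1 :=
  abs_lt.1 ((sq_lt_one_iff_abs_lt_one x).1 h)

theorem sq_lt_depth_sq (hc : c ^ 2 < 2) {t : ℝ} (ht : t ∈ Ioo (-depth c) (depth c)) :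
    t ^ 2 < 2 - c ^ 2 := by
  rw [← depth_sq hc]
  exact sq_lt_sq' ht.1 ht.2

/-- The profile equation for `t = √(2|u|² - c²)` on `x ≥ 0` is `t' = (depth² - t²) / (2 weight)`,
and the two `artanh` terms form a primitive of the reciprocal: the factor `1 - κc²` produced by
differentiating `t / weight` cancels in both. -/
theorem hasDerivAt_travelTime (hκ : κ ≤ 0) (hc : c ^ 2 < 2) {t : ℝ}
    (ht : t ∈ Ioo (-depth c) (depth c)) :
    HasDerivAt (travelTime c κ) (2 * weight c κ t / (depth c ^ 2 - t ^ 2)) t := by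
  have hw := weight_pos hκ c t
  have hw2 := weight_sq hκ c t
  have hd := depth_pos hc
  have hd2 := depth_sq hc
  have ht2 := sq_lt_depth_sq hc ht
  have hq : √(1 - 2 * κ) ^ 2 = 1 - 2 * κ := Real.sq_sqrt (by linarith)
  have hk : √(-κ) ^ 2 = -κ := Real.sq_sqrt (by linarith)
  have hB : 0 < 1 - κ * (c ^ 2 + t ^ 2) := by rw [← hw2]; positivity
  have hP : 0 < 1 - κ * c ^ 2 := by nlinarith [sq_nonneg c]
  have a1 : 1 - (√(-κ) * (t / weight c κ t)) ^ 2 = (1 - κ * c ^ 2) / weight c κ t ^ 2 := by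
    rw [mul_pow, hk, sq_div_weight hκ, hw2]; field_simp; ring
  have a2 : 1 - (√(1 - 2 * κ) / depth c * (t / weight c κ t)) ^ 2 =
      (1 - κ * c ^ 2) * (depth c ^ 2 - t ^ 2) / (depth c ^ 2 * weight c κ t ^ 2) := by
    rw [mul_pow, div_pow, hq, sq_div_weight hκ, hw2]
    have : depth c ^ 2 ≠ 0 := by positivity
    field_simp
    rw [hd2]; ring
  have b2 : 0 < depth c ^ 2 - t ^ 2 := by rw [hd2]; linarith
  have m1 : √(-κ) * (t / weight c κ t) ∈ Ioo (-1 : ℝ) 1 := by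
    apply mem_Ioo_of_sq_lt_one
    have : 0 < (1 - κ * c ^ 2) / weight c κ t ^ 2 := by positivity
    linarith
  have m2 : √(1 - 2 * κ) / depth c * (t / weight c κ t) ∈ Ioo (-1 : ℝ) 1 := by
    apply mem_Ioo_of_sq_lt_one
    have : 0 < (1 - κ * c ^ 2) * (depth c ^ 2 - t ^ 2) / (depth c ^ 2 * weight c κ t ^ 2) := by
      positivity
    linarith
  have d1 := ((hasDerivAt_artanh m1).comp t ((hasDerivAt_div_weight hκ c t).const_mul
    (√(-κ)))).const_mul (-2 * √(-κ))
  have d2 := ((hasDerivAt_artanh m2).comp t ((hasDerivAt_div_weight hκ c t).const_mul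
    (√(1 - 2 * κ) / depth c))).const_mul (2 * (√(1 - 2 * κ) / depth c))
  refine (d1.add d2).congr_deriv ?_
  rw [a1, a2]
  have e : -2 * √(-κ) * (1 / ((1 - κ * c ^ 2) / weight c κ t ^ 2) *
      (√(-κ) * ((1 - κ * c ^ 2) / weight c κ t ^ 3))) +
      2 * (√(1 - 2 * κ) / depth c) * (1 / ((1 - κ * c ^ 2) * (depth c ^ 2 - t ^ 2) /
      (depth c ^ 2 * weight c κ t ^ 2)) * (√(1 - 2 * κ) / depth c * ((1 - κ * c ^ 2) /
      weight c κ t ^ 3))) =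
      2 * (-(√(-κ) ^ 2) * (depth c ^ 2 - t ^ 2) + √(1 - 2 * κ) ^ 2) /
      (weight c κ t * (depth c ^ 2 - t ^ 2)) := by
    field_simp
  rw [e, hk, hq]
  rw [div_eq_div_iff (by positivity) (by positivity)]
  have : 2 * weight c κ t * (weight c κ t * (depth c ^ 2 - t ^ 2)) =
    2 * weight c κ t ^ 2 * (depth c ^ 2 - t ^ 2) := by ring
  rw [this, hw2, hd2]
  ring

theorem travelTime_zero (c κ : ℝ) : travelTime c κ 0 = 0 := by simp [travelTime]

theorem artanh_neg_eq {x : ℝ} (hx : x ∈ Ioo (-1 : ℝ) 1) : Real.artanh (-x) = - Real.artanh x := by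
  have h1 : (0 : ℝ) < 1 + x := by linarith [hx.1]
  have h2 : (0 : ℝ) < 1 - x := by linarith [hx.2]
  rw [Real.artanh_eq_half_log ⟨hx.1.le, hx.2.le⟩,
    Real.artanh_eq_half_log ⟨by linarith [hx.2], by linarith [hx.1]⟩, sub_neg_eq_add,
    ← sub_eq_add_neg, Real.log_div h1.ne' h2.ne', Real.log_div h2.ne' h1.ne']
  ring

theorem strictMonoOn_travelTime (hκ : κ ≤ 0) (hc : c ^ 2 < 2) :
    StrictMonoOn (travelTime c κ) (Ioo (-depth c) (depth c)) := by
  refine strictMonoOn_of_deriv_pos (convex_Ioo _ _) (fun t ht =>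
    (hasDerivAt_travelTime hκ hc ht).continuousAt.continuousWithinAt) fun t ht => ?_
  rw [interior_Ioo] at ht
  rw [(hasDerivAt_travelTime hκ hc ht).deriv]
  have := weight_pos hκ c t
  have := sq_lt_depth_sq hc ht
  rw [depth_sq hc]
  apply div_pos <;> linarith

theorem zero_mem_Ioo_depth (hc : c ^ 2 < 2) : (0 : ℝ) ∈ Ioo (-depth c) (depth c) :=
  ⟨by linarith [depth_pos hc], depth_pos hc⟩

theorem travelTime_neg (hκ : κ ≤ 0) (hc : c ^ 2 < 2) {t : ℝ}
    (ht : t ∈ Ioo (-depth c) (depth c)) : travelTime c κ (-t) = - travelTime c κ t := by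
  have hd2 := depth_sq hc
  have ht2 := sq_lt_depth_sq hc ht
  have hq : √(1 - 2 * κ) ^ 2 = 1 - 2 * κ := Real.sq_sqrt (by linarith)
  have hk : √(-κ) ^ 2 = -κ := Real.sq_sqrt (by linarith)
  have hB : 0 < 1 - κ * (c ^ 2 + t ^ 2) := by nlinarith [sq_nonneg c, sq_nonneg t]
  have hc2 := sq_nonneg c
  have m1 : √(-κ) * (t / weight c κ t) ∈ Ioo (-1 : ℝ) 1 := by
    apply mem_Ioo_of_sq_lt_one
    rw [mul_pow, hk, sq_div_weight hκ, mul_div, div_lt_one hB]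
    nlinarith
  have m2 : √(1 - 2 * κ) / depth c * (t / weight c κ t) ∈ Ioo (-1 : ℝ) 1 := by
    apply mem_Ioo_of_sq_lt_one
    rw [mul_pow, div_pow, hq, sq_div_weight hκ, hd2, div_mul_div_comm, div_lt_one
      (mul_pos (by linarith) hB)]
    nlinarith [mul_nonneg hc2 (neg_nonneg.2 hκ)]
  rw [travelTime, travelTime, weight_neg, neg_div, mul_neg, mul_neg, artanh_neg_eq m1,
    artanh_neg_eq m2]
  ring

/-- As the weight is at least `1`, the derivative dominates the one for `κ = 0`. The bound diverges
as `t` tends to `depth c`, whence surjectivity of the travel time. -/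
theorem le_travelTime (hκ : κ ≤ 0) (hc : c ^ 2 < 2) {t : ℝ} (ht0 : 0 ≤ t) (ht : t < depth c) :
    2 / depth c * Real.artanh (t / depth c) ≤ travelTime c κ t := by
  have hd := depth_pos hc
  have hsub : Icc 0 t ⊆ Ioo (-depth c) (depth c) := fun s hs =>
    ⟨by linarith [hs.1], hs.2.trans_lt ht⟩
  have hm : ∀ s ∈ Ioo (-depth c) (depth c), s / depth c ∈ Ioo (-1 : ℝ) 1 := fun s hs =>
    ⟨by rw [lt_div_iff₀ hd]; linarith [hs.1], by rw [div_lt_one hd]; exact hs.2⟩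
  have hder : ∀ s ∈ Ioo (-depth c) (depth c), HasDerivAt
      (fun s => travelTime c κ s - 2 / depth c * Real.artanh (s / depth c))
      (2 * weight c κ s / (depth c ^ 2 - s ^ 2) - 2 / (depth c ^ 2 - s ^ 2)) s := by
    intro s hs
    have hs2 := sq_lt_depth_sq hc hs
    rw [← depth_sq hc] at hs2
    have d := ((hasDerivAt_artanh (hm s hs)).comp s ((hasDerivAt_id s).div_const
      (depth c))).const_mul (2 / depth c)
    refine (hasDerivAt_travelTime hκ hc hs).sub (d.congr_deriv ?_)
    have h3 : depth c ^ 2 - s ^ 2 ≠ 0 := by linarith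
    have h4 : 1 - (s / depth c) ^ 2 = (depth c ^ 2 - s ^ 2) / depth c ^ 2 := by field_simp
    rw [h4]
    field_simp
  have hmono : MonotoneOn (fun s => travelTime c κ s - 2 / depth c * Real.artanh (s / depth c))
      (Icc 0 t) := by
    refine monotoneOn_of_deriv_nonneg (convex_Icc _ _) (fun s hs =>
      (hder s (hsub hs)).continuousAt.continuousWithinAt) (fun s hs =>
      (hder s (hsub (interior_subset hs))).differentiableAt.differentiableWithinAt) fun s hs => ?_
    have hs' := hsub (interior_subset hs)
    rw [(hder s hs').deriv, ← sub_div]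
    have hs2 := sq_lt_depth_sq hc hs'
    rw [← depth_sq hc] at hs2
    have := one_le_weight hκ c s
    exact div_nonneg (by linarith) (by linarith)
  have := hmono (left_mem_Icc.2 ht0) (right_mem_Icc.2 ht0) ht0
  beta_reduce at this
  rw [travelTime_zero, zero_div, Real.artanh_zero] at this
  linarith

theorem surjOn_travelTime (hκ : κ ≤ 0) (hc : c ^ 2 < 2) :
    SurjOn (travelTime c κ) (Ioo (-depth c) (depth c)) univ := by
  have hd := depth_pos hc
  have key : ∀ x, 0 ≤ x → ∃ t ∈ Ioo (-depth c) (depth c), travelTime c κ t = x := by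
    intro x hx
    -- `a * depth c` is the root for `κ = 0`: there the lower bound of `le_travelTime` equals `x`,
    -- and the intermediate value theorem applies on `[0, a * depth c]`.
    set a := Real.tanh (x * depth c / 2) with ha
    have ha' : a ∈ Ioo (-1 : ℝ) 1 := Real.tanh_bijOn.mapsTo (mem_univ _)
    have hart : Real.artanh a = x * depth c / 2 := Real.artanh_tanh _
    have ha0 : 0 ≤ a := by
      by_contra! h
      have := Real.artanh_neg ⟨ha'.1, h⟩
      rw [hart] at this
      have : 0 ≤ x * depth c / 2 := by positivity
      linarith
    have h1 := le_travelTime hκ hc (t := a * depth c) (by positivity) (by nlinarith [ha'.2])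
    rw [mul_div_cancel_right₀ _ hd.ne', hart] at h1
    have h2 : 2 / depth c * (x * depth c / 2) = x := by field_simp
    rw [h2] at h1
    have hsub : Icc 0 (a * depth c) ⊆ Ioo (-depth c) (depth c) := fun s hs =>
      ⟨by linarith [hs.1], by nlinarith [hs.2, ha'.2]⟩
    have hcont : ContinuousOn (travelTime c κ) (Icc 0 (a * depth c)) := fun s hs =>
      (hasDerivAt_travelTime hκ hc (hsub hs)).continuousAt.continuousWithinAt
    obtain ⟨t, ht, hxt⟩ := intermediate_value_Icc (by positivity) hcont
      (show x ∈ Icc _ _ from ⟨by rw [travelTime_zero]; exact hx, h1⟩)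
    exact ⟨t, hsub ht, hxt⟩
  intro x _
  rcases le_total 0 x with hx | hx
  · exact key x hx
  · obtain ⟨t, ht, h⟩ := key (-x) (by linarith)
    refine ⟨-t, ⟨by linarith [ht.2], by linarith [ht.1]⟩, ?_⟩
    rw [travelTime_neg hκ hc ht, h, neg_neg]

/-- The odd inverse of `travelTime`; the soliton satisfies `2|u|² = c² + T²`. -/
noncomputable def solitonRoot (c κ x : ℝ) : ℝ :=
  Function.invFunOn (travelTime c κ) (Ioo (-depth c) (depth c)) x

theorem solitonRoot_mem (hκ : κ ≤ 0) (hc : c ^ 2 < 2) (x : ℝ) :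
    solitonRoot c κ x ∈ Ioo (-depth c) (depth c) :=
  Function.invFunOn_mem (surjOn_travelTime hκ hc (mem_univ x))

theorem travelTime_solitonRoot (hκ : κ ≤ 0) (hc : c ^ 2 < 2) (x : ℝ) :
    travelTime c κ (solitonRoot c κ x) = x :=
  Function.invFunOn_eq (surjOn_travelTime hκ hc (mem_univ x))

theorem solitonRoot_travelTime (hκ : κ ≤ 0) (hc : c ^ 2 < 2) {t : ℝ}
    (ht : t ∈ Ioo (-depth c) (depth c)) : solitonRoot c κ (travelTime c κ t) = t :=
  (strictMonoOn_travelTime hκ hc).injOn (solitonRoot_mem hκ hc _) ht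
    (travelTime_solitonRoot hκ hc _)

theorem strictMono_solitonRoot (hκ : κ ≤ 0) (hc : c ^ 2 < 2) :
    StrictMono (solitonRoot c κ) := fun x y hxy =>
  ((strictMonoOn_travelTime hκ hc).lt_iff_lt (solitonRoot_mem hκ hc x)
    (solitonRoot_mem hκ hc y)).1 (by
      rwa [travelTime_solitonRoot hκ hc, travelTime_solitonRoot hκ hc])

theorem range_solitonRoot (hκ : κ ≤ 0) (hc : c ^ 2 < 2) :
    range (solitonRoot c κ) = Ioo (-depth c) (depth c) := by
  ext t
  constructor
  · rintro ⟨x, rfl⟩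
    exact solitonRoot_mem hκ hc x
  · exact fun ht => ⟨_, solitonRoot_travelTime hκ hc ht⟩

theorem continuous_solitonRoot (hκ : κ ≤ 0) (hc : c ^ 2 < 2) : Continuous (solitonRoot c κ) := by
  rw [continuous_iff_continuousAt]
  intro x
  refine continuousAt_of_monotoneOn_of_image_mem_nhds
    ((strictMono_solitonRoot hκ hc).monotone.monotoneOn univ) univ_mem ?_
  rw [image_univ, range_solitonRoot hκ hc]
  exact Ioo_mem_nhds (solitonRoot_mem hκ hc x).1 (solitonRoot_mem hκ hc x).2

theorem solitonRoot_sq_lt (hκ : κ ≤ 0) (hc : c ^ 2 < 2) (x : ℝ) :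
    solitonRoot c κ x ^ 2 < 2 - c ^ 2 := sq_lt_depth_sq hc (solitonRoot_mem hκ hc x)

theorem hasDerivAt_solitonRoot (hκ : κ ≤ 0) (hc : c ^ 2 < 2) (x : ℝ) :
    HasDerivAt (solitonRoot c κ) ((2 - c ^ 2 - solitonRoot c κ x ^ 2) /
      (2 * weight c κ (solitonRoot c κ x))) x := by
  have h1 := hasDerivAt_travelTime hκ hc (solitonRoot_mem hκ hc x)
  have h2 := solitonRoot_sq_lt hκ hc x
  have h3 := weight_pos hκ c (solitonRoot c κ x)
  rw [depth_sq hc] at h1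
  have := HasDerivAt.of_local_left_inverse (continuous_solitonRoot hκ hc).continuousAt h1
    (by apply ne_of_gt; apply div_pos <;> linarith)
    (Eventually.of_forall fun y => travelTime_solitonRoot hκ hc y)
  rwa [inv_div] at this

theorem solitonRoot_zero (hκ : κ ≤ 0) (hc : c ^ 2 < 2) : solitonRoot c κ 0 = 0 := by
  have := solitonRoot_travelTime hκ hc (zero_mem_Ioo_depth hc)
  rwa [travelTime_zero] at this

theorem solitonRoot_neg (hκ : κ ≤ 0) (hc : c ^ 2 < 2) (x : ℝ) :
    solitonRoot c κ (-x) = - solitonRoot c κ x := by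
  have hm := solitonRoot_mem hκ hc x
  have h1 := travelTime_neg hκ hc hm
  rw [travelTime_solitonRoot hκ hc] at h1
  rw [← h1, solitonRoot_travelTime hκ hc ⟨by linarith [hm.2], by linarith [hm.1]⟩]

theorem solitonRoot_abs_sq (hκ : κ ≤ 0) (hc : c ^ 2 < 2) (x : ℝ) :
    solitonRoot c κ |x| ^ 2 = solitonRoot c κ x ^ 2 := by
  rcases abs_choice x with h | h <;> rw [h]
  rw [solitonRoot_neg hκ hc, neg_sq]

theorem solitonRoot_nonneg (hκ : κ ≤ 0) (hc : c ^ 2 < 2) {x : ℝ} (hx : 0 ≤ x) :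
    0 ≤ solitonRoot c κ x := by
  rw [← solitonRoot_zero hκ hc]
  exact (strictMono_solitonRoot hκ hc).monotone hx

theorem tendsto_solitonRoot_atTop (hκ : κ ≤ 0) (hc : c ^ 2 < 2) :
    Tendsto (solitonRoot c κ) atTop (𝓝 (depth c)) := by
  refine tendsto_atTop_isLUB (strictMono_solitonRoot hκ hc).monotone ?_
  rw [range_solitonRoot hκ hc]
  exact isLUB_Ioo (by linarith [depth_pos hc])

theorem tendsto_solitonRoot_atBot (hκ : κ ≤ 0) (hc : c ^ 2 < 2) :
    Tendsto (solitonRoot c κ) atBot (𝓝 (-depth c)) := by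
  refine tendsto_atBot_isGLB (strictMono_solitonRoot hκ hc).monotone ?_
  rw [range_solitonRoot hκ hc]
  exact isGLB_Ioo (by linarith [depth_pos hc])

/-- The substitution `t = √(2 - c² - 2y)` turns `1 - 2κ + 2κy` into the squared weight. In the
variable `t` the square-root singularity at the center of the soliton disappears, since `t`
continues as an odd differentiable function of the position. -/
theorem implicitProfile_eq_travelTime (hκ : κ ≤ 0) (hc : c ^ 2 < 2) {y : ℝ}
    (hy : y ∈ Ioc 0 (1 - c ^ 2 / 2)) :
    implicitProfile c κ y = travelTime c κ √(2 - c ^ 2 - 2 * y) := by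
  have h0 : 0 ≤ 2 - c ^ 2 - 2 * y := by linarith [hy.2]
  have hB : 1 - 2 * κ + 2 * κ * y = 1 - κ * (c ^ 2 + √(2 - c ^ 2 - 2 * y) ^ 2) := by
    rw [Real.sq_sqrt h0]; ring
  have hBpos : 0 ≤ 1 - κ * (c ^ 2 + √(2 - c ^ 2 - 2 * y) ^ 2) := by
    nlinarith [sq_nonneg c, sq_nonneg √(2 - c ^ 2 - 2 * y)]
  rw [implicitProfile, travelTime, hB]
  have e1 : √((2 - c ^ 2 - 2 * y) / (1 - κ * (c ^ 2 + √(2 - c ^ 2 - 2 * y) ^ 2))) =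
      √(2 - c ^ 2 - 2 * y) / weight c κ √(2 - c ^ 2 - 2 * y) := Real.sqrt_div h0 _
  have e2 : √((1 - 2 * κ) * (2 - c ^ 2 - 2 * y) /
      ((2 - c ^ 2) * (1 - κ * (c ^ 2 + √(2 - c ^ 2 - 2 * y) ^ 2)))) =
      √(1 - 2 * κ) / depth c * (√(2 - c ^ 2 - 2 * y) / weight c κ √(2 - c ^ 2 - 2 * y)) := by
    rw [← div_mul_div_comm, Real.sqrt_mul (div_nonneg (by linarith) (by linarith)), e1,
      Real.sqrt_div (by linarith)]
    rfl
  rw [e1, e2, Real.sqrt_div (by linarith : (0 : ℝ) ≤ 1 - 2 * κ)]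
  rfl

theorem intensityProfile_eq (hκ : κ ≤ 0) (hc : c ^ 2 < 2) (x : ℝ) :
    intensityProfile c κ x = (2 - c ^ 2 - solitonRoot c κ x ^ 2) / 2 := by
  set S := Ioc 0 (1 - c ^ 2 / 2) with hS
  have hroot : ∀ y ∈ S, √(2 - c ^ 2 - 2 * y) ∈ Ioo (-depth c) (depth c) := by
    intro y hy
    have h1 := Real.sqrt_nonneg (2 - c ^ 2 - 2 * y)
    refine ⟨by linarith [depth_pos hc], ?_⟩
    exact Real.sqrt_lt_sqrt (by linarith [hy.2]) (by linarith [hy.1])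
  have hinj : InjOn (implicitProfile c κ) S := by
    intro y hy z hz hyz
    rw [implicitProfile_eq_travelTime hκ hc hy, implicitProfile_eq_travelTime hκ hc hz] at hyz
    have := (strictMonoOn_travelTime hκ hc).injOn (hroot y hy) (hroot z hz) hyz
    rw [Real.sqrt_inj (by linarith [hy.2]) (by linarith [hz.2])] at this
    linarith
  have hlt := solitonRoot_sq_lt hκ hc x
  have hmem : (2 - c ^ 2 - solitonRoot c κ x ^ 2) / 2 ∈ S :=
    ⟨by linarith, by nlinarith [sq_nonneg (solitonRoot c κ x)]⟩
  have hval : implicitProfile c κ ((2 - c ^ 2 - solitonRoot c κ x ^ 2) / 2) = |x| := by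
    rw [implicitProfile_eq_travelTime hκ hc hmem]
    have : 2 - c ^ 2 - 2 * ((2 - c ^ 2 - solitonRoot c κ x ^ 2) / 2) = solitonRoot c κ |x| ^ 2 := by
      rw [solitonRoot_abs_sq hκ hc]; ring
    rw [this, Real.sqrt_sq (solitonRoot_nonneg hκ hc (abs_nonneg x)), travelTime_solitonRoot hκ hc]
  rw [intensityProfile, ← hval]
  exact hinj.leftInvOn_invFunOn hmem

end

/-! ### One-variable analysis of a branch of speeds with `E' = c p'`. -/

section Branch

/-- Energy and momentum along a branch of speeds `[0, b)` obeying the Hamilton group relation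
`E' = c p'`, with the momentum first increasing (possibly not at all) and then decreasing to `0`. -/
structure SolitonBranch (E p D : ℝ → ℝ) (b c₀ : ℝ) : Prop where
  nonneg : 0 ≤ c₀
  lt : c₀ < b
  deriv_p : ∀ c, 0 ≤ c → c < b → HasDerivAt p (D c) c
  deriv_E : ∀ c, 0 ≤ c → c < b → HasDerivAt E (c * D c) c
  pos : ∀ c, 0 < c → c < c₀ → 0 < D c
  neg : ∀ c, c₀ < c → c < b → D c < 0
  tendsto_p : Tendsto p (𝓝[<] b) (𝓝 0)
  tendsto_E : Tendsto E (𝓝[<] b) (𝓝 0)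
  pos_E : 0 < E 0

variable {E p D : ℝ → ℝ} {b c₀ : ℝ}

theorem StrictAntiOn.lt_of_tendsto_left {f : ℝ → ℝ} {a b l c : ℝ} (hf : StrictAntiOn f (Ico a b))
    (ht : Tendsto f (𝓝[<] b) (𝓝 l)) (hc : c ∈ Ico a b) : l < f c := by
  obtain ⟨d, hd⟩ := exists_between hc.2
  have hd' : d ∈ Ico a b := ⟨hc.1.trans hd.1.le, hd.2⟩
  refine lt_of_le_of_lt (le_of_tendsto ht ?_) (hf hc hd' hd.1)
  filter_upwards [Ioo_mem_nhdsLT hd.2] with x hx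
  exact (hf hd' ⟨hd'.1.trans hx.1.le, hx.2⟩ hx.1).le

theorem StrictMonoOn.lt_of_tendsto_left {f : ℝ → ℝ} {a b l c : ℝ} (hf : StrictMonoOn f (Ico a b))
    (ht : Tendsto f (𝓝[<] b) (𝓝 l)) (hc : c ∈ Ico a b) : f c < l := by
  have := StrictAntiOn.lt_of_tendsto_left (f := fun x => - f x) hf.neg ht.neg hc
  linarith

namespace SolitonBranch

theorem cont_p (h : SolitonBranch E p D b c₀) : ContinuousOn p (Ico 0 b) := fun c hc =>
  (h.deriv_p c hc.1 hc.2).continuousAt.continuousWithinAt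

theorem cont_E (h : SolitonBranch E p D b c₀) : ContinuousOn E (Ico 0 b) := fun c hc =>
  (h.deriv_E c hc.1 hc.2).continuousAt.continuousWithinAt

theorem sub_right (h : SolitonBranch E p D b c₀) : Ico c₀ b ⊆ Ico 0 b :=
  Ico_subset_Ico_left h.nonneg

theorem sub_left (h : SolitonBranch E p D b c₀) : Icc 0 c₀ ⊆ Ico 0 b := fun _ hc =>
  ⟨hc.1, hc.2.trans_lt h.lt⟩

theorem anti_p (h : SolitonBranch E p D b c₀) : StrictAntiOn p (Ico c₀ b) := by
  refine strictAntiOn_of_deriv_neg (convex_Ico _ _) (h.cont_p.mono h.sub_right) fun c hc => ?_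
  rw [interior_Ico] at hc
  rw [(h.deriv_p c (h.nonneg.trans hc.1.le) hc.2).deriv]
  exact h.neg c hc.1 hc.2

theorem anti_E (h : SolitonBranch E p D b c₀) : StrictAntiOn E (Ico c₀ b) := by
  refine strictAntiOn_of_deriv_neg (convex_Ico _ _) (h.cont_E.mono h.sub_right) fun c hc => ?_
  rw [interior_Ico] at hc
  rw [(h.deriv_E c (h.nonneg.trans hc.1.le) hc.2).deriv]
  exact mul_neg_of_pos_of_neg (h.nonneg.trans_lt hc.1) (h.neg c hc.1 hc.2)

theorem mono_p (h : SolitonBranch E p D b c₀) : StrictMonoOn p (Icc 0 c₀) := by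
  refine strictMonoOn_of_deriv_pos (convex_Icc _ _) (h.cont_p.mono h.sub_left) fun c hc => ?_
  rw [interior_Icc] at hc
  rw [(h.deriv_p c hc.1.le (hc.2.trans h.lt)).deriv]
  exact h.pos c hc.1 hc.2

theorem mono_E (h : SolitonBranch E p D b c₀) : StrictMonoOn E (Icc 0 c₀) := by
  refine strictMonoOn_of_deriv_pos (convex_Icc _ _) (h.cont_E.mono h.sub_left) fun c hc => ?_
  rw [interior_Icc] at hc
  rw [(h.deriv_E c hc.1.le (hc.2.trans h.lt)).deriv]
  exact mul_pos hc.1 (h.pos c hc.1 hc.2)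

/-- In the plane of momentum and energy, `E c + c (q - p c)` is the height at `q` of the tangent to
the soliton curve at speed `c`. The relation `E' = c p'` leaves only `q - p c` in the derivative. -/
theorem hasDerivAt_tangent (h : SolitonBranch E p D b c₀) (q : ℝ) {c : ℝ} (h0 : 0 ≤ c)
    (hb : c < b) : HasDerivAt (fun c => E c - c * p c + c * q) (q - p c) c := by
  have := ((h.deriv_E c h0 hb).sub ((hasDerivAt_id c).mul (h.deriv_p c h0 hb))).add
    ((hasDerivAt_id c).mul_const q)
  exact this.congr_deriv (by simp; ring)

theorem tendsto_tangent (h : SolitonBranch E p D b c₀) (q : ℝ) :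
    Tendsto (fun c => E c - c * p c + c * q) (𝓝[<] b) (𝓝 (b * q)) := by
  have hid : Tendsto (fun c : ℝ => c) (𝓝[<] b) (𝓝 b) := tendsto_id.mono_left nhdsWithin_le_nhds
  have := (h.tendsto_E.sub (hid.mul h.tendsto_p)).add (hid.mul_const q)
  simpa using this

/-- On the decreasing branch the tangent function at momentum `p c₁` is minimal at `c₁`. -/
theorem tangent_lt_right (h : SolitonBranch E p D b c₀) {c₁ : ℝ} (hc₁ : c₁ ∈ Ico c₀ b) :
    (∀ c ∈ Ico c₀ b, c ≠ c₁ → E c₁ < E c - c * p c + c * p c₁) ∧ E c₁ < b * p c₁ := by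
  have hval : E c₁ = E c₁ - c₁ * p c₁ + c₁ * p c₁ := by ring
  have hd := fun c (hc : c ∈ Ico c₀ b) =>
    h.hasDerivAt_tangent (p c₁) (h.nonneg.trans hc.1) hc.2
  have hm : StrictMonoOn (fun c => E c - c * p c + c * p c₁) (Ico c₁ b) := by
    refine strictMonoOn_of_deriv_pos (convex_Ico _ _) (fun c hc =>
      (hd c ⟨hc₁.1.trans hc.1, hc.2⟩).continuousAt.continuousWithinAt) fun c hc => ?_
    rw [interior_Ico] at hc
    have hc' : c ∈ Ico c₀ b := ⟨hc₁.1.trans hc.1.le, hc.2⟩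
    rw [(hd c hc').deriv]
    linarith [h.anti_p hc₁ hc' hc.1]
  have ha : StrictAntiOn (fun c => E c - c * p c + c * p c₁) (Icc c₀ c₁) := by
    refine strictAntiOn_of_deriv_neg (convex_Icc _ _) (fun c hc =>
      (hd c ⟨hc.1, hc.2.trans_lt hc₁.2⟩).continuousAt.continuousWithinAt) fun c hc => ?_
    rw [interior_Icc] at hc
    have hc' : c ∈ Ico c₀ b := ⟨hc.1.le, hc.2.trans hc₁.2⟩
    rw [(hd c hc').deriv]
    linarith [h.anti_p hc' hc₁ hc.2]
  refine ⟨fun c hc hne => ?_, ?_⟩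
  · rw [hval]
    rcases lt_or_gt_of_ne hne with hlt | hlt
    · exact ha ⟨hc.1, hlt.le⟩ ⟨hc₁.1, le_rfl⟩ hlt
    · exact hm ⟨le_rfl, hc₁.2⟩ ⟨hlt.le, hc.2⟩ hlt
  · have := StrictMonoOn.lt_of_tendsto_left hm (h.tendsto_tangent _) ⟨le_rfl, hc₁.2⟩
    linarith

/-- The momentum increases on `[0, c₀]`, so the derivative `q - p c` decreases: the function is
concave and minimal at an endpoint. -/
theorem min_le_tangent_left (h : SolitonBranch E p D b c₀) (q : ℝ) {c : ℝ} (hc : c ∈ Icc 0 c₀) :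
    min (E 0) (E c₀ - c₀ * p c₀ + c₀ * q) ≤ E c - c * p c + c * q := by
  have hconc : ConcaveOn ℝ (Icc 0 c₀) (fun c => E c - c * p c + c * q) := by
    refine AntitoneOn.concaveOn_of_deriv (convex_Icc _ _) (fun c hc =>
      (h.hasDerivAt_tangent q (h.sub_left hc).1 (h.sub_left hc).2).continuousAt.continuousWithinAt)
      (fun c hc => (h.hasDerivAt_tangent q (h.sub_left (interior_subset hc)).1
        (h.sub_left (interior_subset hc)).2).differentiableAt.differentiableWithinAt) ?_
    intro x hx y hy hxy
    have hx' := interior_subset hx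
    have hy' := interior_subset hy
    rw [(h.hasDerivAt_tangent q (h.sub_left hx').1 (h.sub_left hx').2).deriv,
      (h.hasDerivAt_tangent q (h.sub_left hy').1 (h.sub_left hy').2).deriv]
    linarith [h.mono_p.monotoneOn hx' hy' hxy]
  have := hconc.min_le_of_mem_Icc (left_mem_Icc.2 h.nonneg) (right_mem_Icc.2 h.nonneg) hc
  simpa using this

/-- If the energy at `c₁` is below the energy at `0` then the tangent function is minimal
at `c₁`. -/
theorem tangent_lt (h : SolitonBranch E p D b c₀) {c₁ : ℝ} (hc₁ : c₁ ∈ Ioo c₀ b)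
    (hE : E c₁ < E 0) {c : ℝ} (hc : c ∈ Ico 0 b) (hne : c ≠ c₁) :
    E c₁ < E c - c * p c + c * p c₁ := by
  have hr := (h.tangent_lt_right ⟨hc₁.1.le, hc₁.2⟩).1
  rcases le_total c c₀ with hcc | hcc
  · exact (lt_min hE (hr c₀ ⟨le_rfl, h.lt⟩ hc₁.1.ne)).trans_le
      (h.min_le_tangent_left (p c₁) ⟨hc.1, hcc⟩)
  · exact hr c ⟨hcc, hc.2⟩ hne

theorem le_tangent (h : SolitonBranch E p D b c₀) {c₁ : ℝ} (hc₁ : c₁ ∈ Ico c₀ b)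
    (hE : E c₁ ≤ E 0) {c : ℝ} (hc : c ∈ Ico 0 b) :
    E c₁ ≤ E c - c * p c + c * p c₁ := by
  have hr : ∀ c ∈ Ico c₀ b, E c₁ ≤ E c - c * p c + c * p c₁ := by
    intro c hc
    by_cases hne : c = c₁
    · subst hne; linarith
    · exact ((h.tangent_lt_right hc₁).1 c hc hne).le
  rcases le_total c c₀ with hcc | hcc
  · exact (le_min hE (hr c₀ ⟨le_rfl, h.lt⟩)).trans (h.min_le_tangent_left (p c₁) ⟨hc.1, hcc⟩)
  · exact hr c ⟨hcc, hc.2⟩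

/-- The critical speed of a branch. -/
theorem exists_critical (h : SolitonBranch E p D b c₀) :
    ∃ cs ∈ Ico c₀ b, E cs = E 0 ∧ (c₀ = 0 → cs = 0) ∧ (0 < c₀ → c₀ < cs) := by
  rcases h.nonneg.eq_or_lt with h0 | h0
  · exact ⟨0, ⟨h0.symm.le, h0 ▸ h.lt⟩, rfl, fun _ => rfl, fun h' => absurd h' (by simp [← h0])⟩
  -- The energy rises up to `c₀` and then falls towards `0 < E 0`, so it takes the value `E 0` again
  -- beyond `c₀`.
  · have h1 : E 0 < E c₀ := h.mono_E (left_mem_Icc.2 h.nonneg) (right_mem_Icc.2 h.nonneg) h0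
    obtain ⟨d, hd1, hd2⟩ : ∃ d ∈ Ioo c₀ b, E d < E 0 := by
      have := (h.tendsto_E.eventually (gt_mem_nhds h.pos_E)).and (Ioo_mem_nhdsLT h.lt)
      obtain ⟨d, hd⟩ := this.exists
      exact ⟨d, hd.2, hd.1⟩
    obtain ⟨cs, hcs, hcsE⟩ := intermediate_value_Icc' hd1.1.le (h.cont_E.mono fun x hx =>
      ⟨h.nonneg.trans hx.1, hx.2.trans_lt hd1.2⟩) (show E 0 ∈ Icc _ _ from ⟨hd2.le, h1.le⟩)
    refine ⟨cs, ⟨hcs.1, hcs.2.trans_lt hd1.2⟩, hcsE, fun h' => absurd h' h0.ne', fun _ => ?_⟩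
    exact lt_of_le_of_ne hcs.1 fun he => by rw [← he] at hcsE; linarith

/-- The properties of the critical speed `cs`: the largest speed of energy `E 0`. -/
structure IsCritical (E p : ℝ → ℝ) (b cs : ℝ) : Prop where
  nonneg : 0 ≤ cs
  lt : cs < b
  energy_eq : E cs = E 0
  energy_lt : ∀ c, cs < c → c < b → E c < E 0
  bijOn : BijOn p (Ioo cs b) (Ioo 0 (p cs))
  tangent_lt : ∀ c₁ ∈ Ioo cs b, ∀ c ∈ Ico 0 b, c ≠ c₁ → E c₁ < E c - c * p c + c * p c₁
  energy_lt_mul : ∀ c₁ ∈ Ico cs b, E c₁ < b * p c₁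
  le_tangent : ∀ c ∈ Ico 0 b, E 0 ≤ E c - c * p c + c * p cs
  exists_small : ∀ ε > 0, ∃ c, 0 < c ∧ c < ε ∧ c < b ∧ p c ≤ p cs

/-- At momentum `p cs` the tangent function has its minimum `E 0` both at speed `0` and at `cs`.
Slow speeds of momentum at most `p cs` are provided because inserting a plateau into a soliton can
only raise its momentum. -/
theorem exists_isCritical (h : SolitonBranch E p D b c₀) : ∃ cs, IsCritical E p b cs := by
  obtain ⟨cs, hcs, hE, h0, h1⟩ := h.exists_critical
  have hcs0 : 0 ≤ cs := h.nonneg.trans hcs.1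
  have hsub : Ioo cs b ⊆ Ioo c₀ b := Ioo_subset_Ioo_left hcs.1
  have hlt : ∀ c, cs < c → c < b → E c < E 0 := fun c hc hb => by
    rw [← hE]; exact h.anti_E hcs ⟨hcs.1.trans hc.le, hb⟩ hc
  refine ⟨cs, hcs0, hcs.2, hE, hlt, ⟨?_, ?_, ?_⟩, ?_, ?_, ?_, ?_⟩
  · intro c hc
    have hc' : c ∈ Ico c₀ b := ⟨hcs.1.trans hc.1.le, hc.2⟩
    exact ⟨StrictAntiOn.lt_of_tendsto_left h.anti_p h.tendsto_p hc', h.anti_p hcs hc' hc.1⟩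
  · exact h.anti_p.injOn.mono (show Ioo cs b ⊆ Ico c₀ b from fun c hc => ⟨hcs.1.trans hc.1.le, hc.2⟩)
  · intro q hq
    obtain ⟨d, hd1, hd2⟩ : ∃ d ∈ Ioo cs b, p d < q := by
      have := (h.tendsto_p.eventually (gt_mem_nhds hq.1)).and (Ioo_mem_nhdsLT hcs.2)
      obtain ⟨d, hd⟩ := this.exists
      exact ⟨d, hd.2, hd.1⟩
    obtain ⟨c, hc, hcq⟩ := intermediate_value_Icc' hd1.1.le (h.cont_p.mono fun x hx =>
      ⟨hcs0.trans hx.1, hx.2.trans_lt hd1.2⟩) (show q ∈ Icc _ _ from ⟨hd2.le, hq.2.le⟩)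
    refine ⟨c, ⟨lt_of_le_of_ne hc.1 ?_, hc.2.trans_lt hd1.2⟩, hcq⟩
    rintro rfl
    exact hq.2.ne hcq.symm
  · intro c₁ hc₁ c hc hne
    exact h.tangent_lt (hsub hc₁) (hlt c₁ hc₁.1 hc₁.2) hc hne
  · intro c₁ hc₁
    exact (h.tangent_lt_right ⟨hcs.1.trans hc₁.1, hc₁.2⟩).2
  · intro c hc
    rw [← hE]
    exact h.le_tangent hcs hE.le hc
  · intro ε hε
    rcases h.nonneg.eq_or_lt with hz | hz
    · have hcz := h0 hz.symm
      obtain ⟨c, hc⟩ := exists_between (lt_min hε (hcs0.trans_lt hcs.2))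
      refine ⟨c, hc.1, hc.2.trans_le (min_le_left _ _), hc.2.trans_le (min_le_right _ _), ?_⟩
      exact (h.anti_p hcs ⟨hz.symm.le.trans hc.1.le, hc.2.trans_le (min_le_right _ _)⟩
        (by rw [hcz]; exact hc.1)).le
    · have hcs1 := h1 hz
      -- Otherwise `p` exceeds `p cs` on `(0, cs)`, and the tangent function at momentum `p cs`
      -- would decrease strictly from `E 0` to `E cs`, which are equal.
      have hp : p 0 < p cs := by
        by_contra! hle
        have hanti : StrictAntiOn (fun c => E c - c * p c + c * p cs) (Icc 0 cs) := by
          refine strictAntiOn_of_deriv_neg (convex_Icc _ _) (fun c hc => (h.hasDerivAt_tangent _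
            hc.1 (hc.2.trans_lt hcs.2)).continuousAt.continuousWithinAt) fun c hc => ?_
          rw [interior_Icc] at hc
          rw [(h.hasDerivAt_tangent _ hc.1.le (hc.2.trans hcs.2)).deriv]
          rcases le_total c c₀ with hcc | hcc
          · linarith [h.mono_p (left_mem_Icc.2 h.nonneg) (show c ∈ Icc 0 c₀ from ⟨hc.1.le, hcc⟩) hc.1]
          · linarith [h.anti_p (show c ∈ Ico c₀ b from ⟨hcc, hc.2.trans hcs.2⟩) hcs hc.2]
        have := hanti (left_mem_Icc.2 hcs0) (right_mem_Icc.2 hcs0) (hz.trans hcs1)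
        simp only [zero_mul, sub_zero, add_zero] at this
        linarith
      have hcont := (h.deriv_p 0 le_rfl (hcs0.trans_lt hcs.2)).continuousAt
      have hev := (hcont.eventually (gt_mem_nhds hp)).filter_mono
        (nhdsWithin_le_nhds (s := Ioi 0))
      obtain ⟨c, hc, hc'⟩ := (hev.and (Ioo_mem_nhdsGT (lt_min hε (hcs0.trans_lt hcs.2)))).exists
      exact ⟨c, hc'.1, hc'.2.trans_le (min_le_left _ _), hc'.2.trans_le (min_le_right _ _), hc.le⟩

end SolitonBranch
end Branch

/-! ### Energy and momentum of solitons as explicit functions of the speed. -/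

/-- The energy of the soliton of speed `c`. -/
noncomputable def profileEnergy (κ c : ℝ) : ℝ :=
  1 / 2 * ∫ t in (0 : ℝ)..depth c, (2 - c ^ 2 - t ^ 2) * weight c κ t

/-- The integral of the reciprocal of the weight. -/
noncomputable def inverseWeightIntegral (c κ t : ℝ) : ℝ :=
  ∫ s in (0 : ℝ)..t, 1 / weight c κ s

/-- A primitive of `c / 2 * (2 - c² - t²) / (c² + t²) * weight c κ t`. -/
noncomputable def momentumPrimitive (c κ t : ℝ) : ℝ :=
  Real.arctan (t / (c * weight c κ t)) +
    c * (-κ - (1 - κ * c ^ 2) / 4) * inverseWeightIntegral c κ t - c / 4 * (t * weight c κ t)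

/-- The momentum of the soliton of speed `c`. -/
noncomputable def profileMomentum (κ c : ℝ) : ℝ :=
  Real.pi / 2 - Real.arctan (c * √(1 - 2 * κ) / depth c) +
    c * (-κ - (1 - κ * c ^ 2) / 4) * inverseWeightIntegral c κ (depth c) -
    c / 4 * (depth c * √(1 - 2 * κ))

/-- The derivative of `profileMomentum κ`. -/
noncomputable def profileSlope (κ c : ℝ) : ℝ :=
  (-κ + 1 / 2 - 3 / 4 * (1 - κ * c ^ 2)) * inverseWeightIntegral c κ (depth c) -
    3 / 4 * (√(1 - 2 * κ) * depth c)

section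

variable {κ c : ℝ}

theorem weight_depth (hc : c ^ 2 < 2) : weight c κ (depth c) = √(1 - 2 * κ) := by
  rw [weight, depth_sq hc]; congr 1; ring

theorem continuous_inv_weight (hκ : κ ≤ 0) (c : ℝ) : Continuous fun t => 1 / weight c κ t :=
  continuous_const.div (continuous_weight c κ) fun t => (weight_pos hκ c t).ne'

theorem hasDerivAt_inverseWeightIntegral (hκ : κ ≤ 0) (c t : ℝ) :
    HasDerivAt (inverseWeightIntegral c κ) (1 / weight c κ t) t :=
  intervalIntegral.integral_hasDerivAt_right ((continuous_inv_weight hκ c).intervalIntegrable _ _)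
    ((continuous_inv_weight hκ c).stronglyMeasurableAtFilter _ _)
    (continuous_inv_weight hκ c).continuousAt

theorem hasDerivAt_momentumPrimitive (hκ : κ ≤ 0) (hc : 0 < c) (t : ℝ) :
    HasDerivAt (momentumPrimitive c κ)
      (c / 2 * (2 - c ^ 2 - t ^ 2) * weight c κ t / (c ^ 2 + t ^ 2)) t := by
  have hw := weight_pos hκ c t
  have hw2 := weight_sq hκ c t
  have hr : 0 < c ^ 2 + t ^ 2 := by positivity
  have hP : 0 < 1 - κ * c ^ 2 := by nlinarith [sq_nonneg c]
  have d1 : HasDerivAt (fun t => t / (c * weight c κ t))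
      ((1 - κ * c ^ 2) / weight c κ t ^ 3 / c) t := by
    have := (hasDerivAt_div_weight hκ c t).div_const c
    refine this.congr_of_eventuallyEq (Eventually.of_forall fun s => ?_)
    have := weight_pos hκ c s
    field_simp
  have d2 := d1.arctan
  have d3 := (hasDerivAt_inverseWeightIntegral hκ c t).const_mul
    (c * (-κ - (1 - κ * c ^ 2) / 4))
  have d4 := ((hasDerivAt_id t).mul (hasDerivAt_weight hκ c t)).const_mul (c / 4)
  refine ((d2.add d3).sub d4).congr_deriv ?_
  have e1 : 1 + (t / (c * weight c κ t)) ^ 2 =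
      (c ^ 2 + t ^ 2) * (1 - κ * c ^ 2) / (c ^ 2 * weight c κ t ^ 2) := by
    rw [div_pow, mul_pow]
    field_simp
    rw [hw2]; ring
  have e2 : 1 / (1 + (t / (c * weight c κ t)) ^ 2) * ((1 - κ * c ^ 2) / weight c κ t ^ 3 / c) =
      c / (weight c κ t * (c ^ 2 + t ^ 2)) := by
    rw [e1]
    generalize 1 - κ * c ^ 2 = P at hP ⊢
    field_simp
  rw [e2]
  simp only [id]
  field_simp
  rw [hw2]
  ring

/-- The arctangent is traded for `π / 2` minus that of the reciprocal, which gives a formula still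
differentiable at `c = 0`. Its value `π / 2` there is the critical momentum when the critical speed
is zero. -/
theorem momentumPrimitive_depth (hc0 : 0 < c) (hc : c ^ 2 < 2) (hκ : κ ≤ 0) :
    momentumPrimitive c κ (depth c) = profileMomentum κ c := by
  have hd := depth_pos hc
  have hq : 0 < √(1 - 2 * κ) := Real.sqrt_pos.2 (by linarith)
  rw [momentumPrimitive, profileMomentum, weight_depth hc,
    ← Real.arctan_inv_of_pos (by positivity), inv_div]

theorem inverseWeightIntegral_neg (c κ t : ℝ) :
    inverseWeightIntegral c κ (-t) = - inverseWeightIntegral c κ t := by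
  have h := intervalIntegral.integral_comp_neg (a := 0) (b := t) fun s => 1 / weight c κ s
  simp only [weight_neg, neg_zero] at h
  rw [inverseWeightIntegral, inverseWeightIntegral, intervalIntegral.integral_symm, h]

theorem momentumPrimitive_neg (c κ t : ℝ) :
    momentumPrimitive c κ (-t) = - momentumPrimitive c κ t := by
  rw [momentumPrimitive, momentumPrimitive, inverseWeightIntegral_neg, weight_neg, neg_div,
    Real.arctan_neg]
  ring

theorem hasDerivAt_depth (hc : c ^ 2 < 2) : HasDerivAt depth (-c / depth c) c := by
  have h : HasDerivAt (fun c : ℝ => 2 - c ^ 2) (-(2 * c)) c := by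
    simpa using (hasDerivAt_pow 2 c).const_sub 2
  refine (h.sqrt (by linarith)).congr_deriv ?_
  change _ / (2 * depth c) = _
  have := depth_pos hc
  field_simp

/-- Integration of the derivative of `s * weight`; the next identity uses `s * weight³`. Together
they express the energy by `inverseWeightIntegral`. -/
theorem integral_weight_eq (hκ : κ ≤ 0) (c t : ℝ) :
    2 * ∫ s in (0 : ℝ)..t, weight c κ s =
      t * weight c κ t + (1 - κ * c ^ 2) * inverseWeightIntegral c κ t := by
  have hd : ∀ s, HasDerivAt (fun s => s * weight c κ s)
      (2 * weight c κ s - (1 - κ * c ^ 2) * (1 / weight c κ s)) s := by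
    intro s
    have hw := weight_pos hκ c s
    refine ((hasDerivAt_id s).mul (hasDerivAt_weight hκ c s)).congr_deriv ?_
    simp only [id]
    field_simp
    rw [weight_sq hκ]; ring
  have hi := intervalIntegral.integral_eq_sub_of_hasDerivAt (a := 0) (b := t)
    (fun s _ => hd s) (((continuous_weight c κ).const_mul 2 |>.sub
      ((continuous_inv_weight hκ c).const_mul _)).intervalIntegrable _ _)
  rw [intervalIntegral.integral_sub ((continuous_weight c κ).const_mul 2 |>.intervalIntegrable _ _)
    ((continuous_inv_weight hκ c).const_mul _ |>.intervalIntegrable _ _),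
    intervalIntegral.integral_const_mul, intervalIntegral.integral_const_mul] at hi
  rw [inverseWeightIntegral]
  linarith

theorem integral_sq_mul_weight_eq (hκ : κ ≤ 0) (c t : ℝ) :
    -(4 * κ) * (∫ s in (0 : ℝ)..t, s ^ 2 * weight c κ s) =
      t * weight c κ t ^ 3 - (1 - κ * c ^ 2) * ∫ s in (0 : ℝ)..t, weight c κ s := by
  have hcs : Continuous fun s => s ^ 2 * weight c κ s :=
    (continuous_pow 2).mul (continuous_weight c κ)
  have hd : ∀ s, HasDerivAt (fun s => s * weight c κ s ^ 3)
      ((1 - κ * c ^ 2) * weight c κ s + -(4 * κ) * (s ^ 2 * weight c κ s)) s := by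
    intro s
    have hw := weight_pos hκ c s
    refine ((hasDerivAt_id s).mul ((hasDerivAt_weight hκ c s).pow 3)).congr_deriv ?_
    simp only [id, Nat.cast_ofNat, Nat.add_one_sub_one]
    have e : weight c κ s ^ 3 = (1 - κ * (c ^ 2 + s ^ 2)) * weight c κ s := by
      rw [← weight_sq hκ]; ring
    simp only [Pi.pow_apply]
    rw [e]
    field_simp
    ring
  have hi := intervalIntegral.integral_eq_sub_of_hasDerivAt (a := 0) (b := t)
    (fun s _ => hd s) ((((continuous_weight c κ).const_mul _).add
      (hcs.const_mul _)).intervalIntegrable _ _)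
  rw [intervalIntegral.integral_add ((continuous_weight c κ).const_mul _ |>.intervalIntegrable _ _)
    (hcs.const_mul _ |>.intervalIntegrable _ _),
    intervalIntegral.integral_const_mul, intervalIntegral.integral_const_mul] at hi
  linarith

theorem profileEnergy_eq (κ c : ℝ) :
    profileEnergy κ c = 1 / 2 * ((2 - c ^ 2) * (∫ t in (0 : ℝ)..depth c, weight c κ t) -
      ∫ t in (0 : ℝ)..depth c, t ^ 2 * weight c κ t) := by
  have hi := ((continuous_weight c κ).const_mul (2 - c ^ 2)).intervalIntegrable
    (μ := volume) 0 (depth c)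
  have hi2 : IntervalIntegrable (fun t => t ^ 2 * weight c κ t) volume 0 (depth c) :=
    ((continuous_pow 2).mul (continuous_weight c κ)).intervalIntegrable _ _
  rw [profileEnergy, ← intervalIntegral.integral_const_mul (2 - c ^ 2),
    ← intervalIntegral.integral_sub hi hi2]
  congr 1
  refine intervalIntegral.integral_congr fun t _ => ?_
  ring

theorem weight_zero_right (c t : ℝ) : weight c 0 t = 1 := by simp [weight]

/-- The closed form can be differentiated in `c` without differentiating under the integral sign; it
divides by `√(-κ)`, hence `κ = 0` is treated apart. -/
theorem inverseWeightIntegral_eq_arsinh (hκ : κ < 0) (c t : ℝ) :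
    inverseWeightIntegral c κ t =
      1 / √(-κ) * Real.arsinh (√(-κ) * t / √(1 - κ * c ^ 2)) := by
  have hk : 0 < √(-κ) := Real.sqrt_pos.2 (by linarith)
  have hk2 : √(-κ) ^ 2 = -κ := Real.sq_sqrt (by linarith)
  have hP : 0 < 1 - κ * c ^ 2 := by nlinarith [sq_nonneg c]
  have hP0 : 0 < √(1 - κ * c ^ 2) := Real.sqrt_pos.2 hP
  have hP2 : √(1 - κ * c ^ 2) ^ 2 = 1 - κ * c ^ 2 := Real.sq_sqrt hP.le
  have hd : ∀ s, HasDerivAt (fun s => 1 / √(-κ) * Real.arsinh (√(-κ) * s / √(1 - κ * c ^ 2)))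
      (1 / weight c κ s) s := by
    intro s
    have h1 : HasDerivAt (fun s => √(-κ) * s / √(1 - κ * c ^ 2))
        (√(-κ) * 1 / √(1 - κ * c ^ 2)) s := ((hasDerivAt_id s).const_mul _).div_const _
    have h2 := (h1.arsinh).const_mul (1 / √(-κ))
    refine h2.congr_deriv ?_
    have e : √(1 + (√(-κ) * s / √(1 - κ * c ^ 2)) ^ 2) = weight c κ s / √(1 - κ * c ^ 2) := by
      rw [weight, ← Real.sqrt_div' _ hP.le, div_pow, mul_pow, hk2, hP2]
      congr 1
      field_simp
      ring
    rw [e, smul_eq_mul]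
    have := weight_pos hκ.le c s
    field_simp
  have hi := intervalIntegral.integral_eq_sub_of_hasDerivAt (a := 0) (b := t)
    (fun s _ => hd s) ((continuous_inv_weight hκ.le c).intervalIntegrable _ _)
  rw [inverseWeightIntegral, hi]
  simp

theorem hasDerivAt_inverseWeightIntegral_depth (hκ : κ ≤ 0) (hc : c ^ 2 < 2) :
    HasDerivAt (fun c => inverseWeightIntegral c κ (depth c))
      (-c * √(1 - 2 * κ) / (depth c * (1 - κ * c ^ 2))) c := by
  have hd := depth_pos hc
  rcases hκ.eq_or_lt with rfl | hκ
  · have e : (fun c => inverseWeightIntegral c 0 (depth c)) = depth := by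
      funext c
      simp [inverseWeightIntegral, weight_zero_right]
    rw [e]
    simpa using hasDerivAt_depth hc
  · have e : (fun c => inverseWeightIntegral c κ (depth c)) =
        fun c => 1 / √(-κ) * Real.arsinh (√(-κ) * depth c / √(1 - κ * c ^ 2)) :=
      funext fun c => inverseWeightIntegral_eq_arsinh hκ c _
    rw [e]
    have hk : 0 < √(-κ) := Real.sqrt_pos.2 (by linarith)
    have hk2 : √(-κ) ^ 2 = -κ := Real.sq_sqrt (by linarith)
    have hP : 0 < 1 - κ * c ^ 2 := by nlinarith [sq_nonneg c]
    have hP0 : 0 < √(1 - κ * c ^ 2) := Real.sqrt_pos.2 hP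
    have hP2 : √(1 - κ * c ^ 2) ^ 2 = 1 - κ * c ^ 2 := Real.sq_sqrt hP.le
    have hq : 0 < √(1 - 2 * κ) := Real.sqrt_pos.2 (by linarith)
    have hq2 : √(1 - 2 * κ) ^ 2 = 1 - 2 * κ := Real.sq_sqrt (by linarith)
    have h1 : HasDerivAt (fun c : ℝ => 1 - κ * c ^ 2) (-(κ * (2 * c))) c := by
      simpa using ((hasDerivAt_pow 2 c).const_mul κ).const_sub 1
    have h2 := (((hasDerivAt_depth hc).const_mul √(-κ)).div (h1.sqrt hP.ne') hP0.ne').arsinh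
    refine (h2.const_mul (1 / √(-κ))).congr_deriv ?_
    have e2 : √(1 + (√(-κ) * depth c / √(1 - κ * c ^ 2)) ^ 2) =
        √(1 - 2 * κ) / √(1 - κ * c ^ 2) := by
      rw [← Real.sqrt_div' _ hP.le, div_pow, mul_pow, hk2, hP2, depth_sq hc]
      congr 1
      field_simp
      ring
    simp only [Pi.div_apply]
    rw [e2, smul_eq_mul]
    set P := √(1 - κ * c ^ 2) with hPd
    rw [← hP2]
    generalize √(1 - 2 * κ) = q at hq hq2 ⊢
    field_simp
    rw [hP2, depth_sq hc, hq2]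
    ring

theorem hasDerivAt_profileMomentum (hκ : κ ≤ 0) (hc : c ^ 2 < 2) :
    HasDerivAt (profileMomentum κ) (profileSlope κ c) c := by
  have hd := depth_pos hc
  have hd2 := depth_sq hc
  have hP : 0 < 1 - κ * c ^ 2 := by nlinarith [sq_nonneg c]
  have hq : 0 < √(1 - 2 * κ) := Real.sqrt_pos.2 (by linarith)
  have hq2 : √(1 - 2 * κ) ^ 2 = 1 - 2 * κ := Real.sq_sqrt (by linarith)
  have hD := hasDerivAt_depth hc
  have hL := hasDerivAt_inverseWeightIntegral_depth hκ hc
  have d1 := (((hasDerivAt_id c).mul_const √(1 - 2 * κ)).div hD hd.ne').arctan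
  have d2 : HasDerivAt (fun c => c * (-κ - (1 - κ * c ^ 2) / 4))
      (-κ - (1 - κ * c ^ 2) / 4 + κ * c ^ 2 / 2) c := by
    have h1 : HasDerivAt (fun c : ℝ => -κ - (1 - κ * c ^ 2) / 4) (κ * c / 2) c := by
      have := (((hasDerivAt_pow 2 c).const_mul κ).const_sub 1).div_const 4 |>.const_sub (-κ)
      refine this.congr_deriv ?_
      simp; ring
    refine ((hasDerivAt_id c).mul h1).congr_deriv ?_
    simp only [id]; ring
  have d3 := d2.mul hL
  have d4 := ((hasDerivAt_id c).div_const 4).mul (hD.mul_const √(1 - 2 * κ))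
  refine (((d1.const_sub (Real.pi / 2)).add d3).sub d4).congr_deriv ?_
  rw [profileSlope]
  set L := inverseWeightIntegral c κ (depth c)
  have e1 : 1 + (c * √(1 - 2 * κ) / depth c) ^ 2 = 2 * (1 - κ * c ^ 2) / depth c ^ 2 := by
    rw [div_pow, mul_pow, hq2]
    field_simp
    rw [hd2]; ring
  simp only [id, Pi.div_apply]
  rw [e1]
  set q := √(1 - 2 * κ)
  field_simp
  ring_nf
  simp only [hd2]
  ring_nf

end

section

variable {κ c : ℝ}

/-- The Hamilton group relation `E' = c p'`, verified on closed forms. Extracting the second moment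
of the weight divides by `κ`, so for `κ = 0` the energy is computed directly as `depth³ / 3`. -/
theorem hasDerivAt_profileEnergy (hκ : κ ≤ 0) (hc : c ^ 2 < 2) :
    HasDerivAt (profileEnergy κ) (c * profileSlope κ c) c := by
  have hd := depth_pos hc
  have hd2 := depth_sq hc
  have hP : 0 < 1 - κ * c ^ 2 := by nlinarith [sq_nonneg c]
  have hD := hasDerivAt_depth hc
  have hL := hasDerivAt_inverseWeightIntegral_depth hκ hc
  have hev : ∀ᶠ a in 𝓝 c, a ^ 2 < 2 :=
    (continuous_pow 2).continuousAt.eventually (gt_mem_nhds hc)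
  rcases hκ.eq_or_lt with rfl | hκ'
  · have e : profileEnergy 0 =ᶠ[𝓝 c] fun a => depth a ^ 3 / 3 := by
      filter_upwards [hev] with a ha
      rw [profileEnergy_eq, ← depth_sq ha]
      simp [weight_zero_right]
      ring
    refine (((hD.pow 3).div_const 3).congr_of_eventuallyEq e).congr_deriv ?_
    simp only [profileSlope, inverseWeightIntegral, weight_zero_right]
    simp
    field_simp
    ring
  · set q := √(1 - 2 * κ) with hq
    have hq2 : q ^ 2 = 1 - 2 * κ := Real.sq_sqrt (by linarith)
    have hκ0 : κ ≠ 0 := hκ'.ne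
    set L : ℝ → ℝ := fun a => inverseWeightIntegral a κ (depth a) with hLdef
    have e : profileEnergy κ =ᶠ[𝓝 c] fun a => 1 / 2 * ((2 - a ^ 2) *
        ((depth a * q + (1 - κ * a ^ 2) * L a) / 2) -
        (depth a * q ^ 3 - (1 - κ * a ^ 2) * ((depth a * q + (1 - κ * a ^ 2) * L a) / 2)) /
          (-(4 * κ))) := by
      filter_upwards [hev] with a ha
      have h1 := integral_weight_eq hκ a (depth a)
      have h2 := integral_sq_mul_weight_eq hκ a (depth a)
      rw [weight_depth ha, ← hq] at h1 h2
      have h3 : ∫ s in (0 : ℝ)..depth a, weight a κ s =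
          (depth a * q + (1 - κ * a ^ 2) * L a) / 2 := by
        rw [hLdef]; linarith
      rw [profileEnergy_eq, ← h3, ← h2]
      field_simp
    have h1 : HasDerivAt (fun a : ℝ => 1 - κ * a ^ 2) (-(κ * (2 * c))) c := by
      simpa using ((hasDerivAt_pow 2 c).const_mul κ).const_sub 1
    have h0 : HasDerivAt (fun a : ℝ => 2 - a ^ 2) (-(2 * c)) c := by
      simpa using (hasDerivAt_pow 2 c).const_sub 2
    have hM : HasDerivAt (fun a => (depth a * q + (1 - κ * a ^ 2) * L a) / 2)
        (-c * q / depth c - κ * c * L c) c := by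
      refine (((hD.mul_const q).add (h1.mul hL)).div_const 2).congr_deriv ?_
      change _ = -c * q / depth c - κ * c * inverseWeightIntegral c κ (depth c)
      generalize 1 - κ * c ^ 2 = P at hP ⊢
      field_simp
      ring
    have hN := ((hD.mul_const (q ^ 3)).sub (h1.mul hM)).div_const (-(4 * κ))
    have hE := ((h0.mul hM).sub hN).const_mul (1 / 2)
    refine (hE.congr_of_eventuallyEq e).congr_deriv ?_
    rw [profileSlope, ← hq]
    change _ = c * ((-κ + 1 / 2 - 3 / 4 * (1 - κ * c ^ 2)) * L c - 3 / 4 * (q * depth c))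
    have hq3 : q ^ 3 = (1 - 2 * κ) * q := by rw [← hq2]; ring
    have hP' : 1 - κ * c ^ 2 = 1 - 2 * κ + κ * depth c ^ 2 := by rw [hd2]; ring
    rw [hq3, hP', ← hd2]
    field_simp
    ring

theorem profileSlope_eq (hκ : κ ≤ 0) (hc : c ^ 2 < 2) :
    profileSlope κ c = 1 / 2 * ∫ t in (0 : ℝ)..depth c,
      ((1 - 2 * κ) * (1 / weight c κ t) - 3 * weight c κ t) := by
  rw [intervalIntegral.integral_sub
    ((continuous_inv_weight hκ c).const_mul _ |>.intervalIntegrable _ _)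
    ((continuous_weight c κ).const_mul _ |>.intervalIntegrable _ _),
    intervalIntegral.integral_const_mul, intervalIntegral.integral_const_mul, profileSlope]
  have h1 := integral_weight_eq hκ c (depth c)
  rw [weight_depth hc] at h1
  change _ = 1 / 2 * ((1 - 2 * κ) * inverseWeightIntegral c κ (depth c) - _)
  linarith

/-- Scaling by the depth puts the slopes at different speeds over the same interval, where their
integrands can be compared. -/
theorem profileSlope_eq_scaled (hκ : κ ≤ 0) (hc : c ^ 2 < 2) :
    profileSlope κ c = depth c / 2 * ∫ x in (0 : ℝ)..1,
      ((1 - 2 * κ) * (1 / weight c κ (depth c * x)) - 3 * weight c κ (depth c * x)) := by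
  have := intervalIntegral.mul_integral_comp_mul_left (a := 0) (b := 1) (c := depth c)
    (f := fun t => (1 - 2 * κ) * (1 / weight c κ t) - 3 * weight c κ t)
  rw [mul_zero, mul_one] at this
  rw [profileSlope_eq hκ hc, ← this]
  ring

/-- For `c ≥ 1` one has `3 weight² ≥ 3 - 3κ > 1 - 2κ`, so the integrand of `profileSlope_eq` is
negative. This keeps the turning point of the momentum away from `√2`. -/
theorem profileSlope_neg_of_one_le (hκ : κ ≤ 0) (hc1 : 1 ≤ c) (hc : c ^ 2 < 2) :
    profileSlope κ c < 0 := by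
  have hcont : Continuous fun t => 3 * weight c κ t - (1 - 2 * κ) * (1 / weight c κ t) :=
    ((continuous_weight c κ).const_mul _).sub ((continuous_inv_weight hκ c).const_mul _)
  have hpos : 0 < ∫ t in (0 : ℝ)..depth c,
      (3 * weight c κ t - (1 - 2 * κ) * (1 / weight c κ t)) := by
    refine intervalIntegral.intervalIntegral_pos_of_pos_on (hcont.intervalIntegrable _ _)
      (fun t _ => ?_) (depth_pos hc)
    have hw := weight_pos hκ c t
    have hw2 := weight_sq hκ c t
    rw [sub_pos, mul_one_div, div_lt_iff₀ hw]
    nlinarith [sq_nonneg t, mul_nonneg (neg_nonneg.2 hκ) (sq_nonneg t),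
      mul_nonneg (neg_nonneg.2 hκ) (by nlinarith : (0 : ℝ) ≤ c ^ 2 - 1)]
  have hneg : ∫ t in (0 : ℝ)..depth c, ((1 - 2 * κ) * (1 / weight c κ t) - 3 * weight c κ t) =
      - ∫ t in (0 : ℝ)..depth c, (3 * weight c κ t - (1 - 2 * κ) * (1 / weight c κ t)) := by
    rw [← intervalIntegral.integral_neg]
    exact intervalIntegral.integral_congr fun t _ => by simp
  rw [profileSlope_eq hκ hc, hneg]
  linarith

/-- The momentum slope changes sign at most once, from positive to negative. -/
theorem profileSlope_neg_of_nonpos (hκ : κ ≤ 0) {c₁ c₂ : ℝ} (h0 : 0 ≤ c₁) (h12 : c₁ < c₂)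
    (hc₂ : c₂ ^ 2 < 2) (h : profileSlope κ c₁ ≤ 0) : profileSlope κ c₂ < 0 := by
  have hc12 : c₁ ^ 2 < c₂ ^ 2 := by nlinarith
  have hc₁ : c₁ ^ 2 < 2 := hc12.trans hc₂
  rcases hκ.eq_or_lt with rfl | hκ'
  · have hd := depth_pos hc₂
    simp only [profileSlope, inverseWeightIntegral, weight_zero_right]
    simp
    linarith
  have hcont : ∀ c, Continuous fun x =>
      (1 - 2 * κ) * (1 / weight c κ (depth c * x)) - 3 * weight c κ (depth c * x) := fun c =>
    (((continuous_inv_weight hκ c).const_mul (1 - 2 * κ)).sub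
      ((continuous_weight c κ).const_mul 3)).comp (continuous_const_mul (depth c))
  -- The squared weight is `1 - κ(c² + (2 - c²)x²)`, nondecreasing in `c` for `0 ≤ x ≤ 1`, and the
  -- integrand decreases in the weight. Hence the integral decreases in `c`, strictly because of `x
  -- = 0`, while the prefactor stays positive.
  have hw : ∀ x ∈ Icc (0 : ℝ) 1, weight c₁ κ (depth c₁ * x) ≤ weight c₂ κ (depth c₂ * x) := by
    intro x hx
    apply Real.sqrt_le_sqrt
    rw [mul_pow, mul_pow, depth_sq hc₁, depth_sq hc₂]
    have : 0 ≤ (c₂ ^ 2 - c₁ ^ 2) * (1 - x ^ 2) :=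
      mul_nonneg (by linarith) (by nlinarith [hx.1, hx.2])
    nlinarith
  have hmono : ∀ x ∈ Icc (0 : ℝ) 1, ∀ w₁ w₂ : ℝ, 0 < w₁ → w₁ ≤ w₂ →
      (1 - 2 * κ) * (1 / w₂) - 3 * w₂ ≤ (1 - 2 * κ) * (1 / w₁) - 3 * w₁ := by
    intro x _ w₁ w₂ hw₁ hw
    have : 1 / w₂ ≤ 1 / w₁ := one_div_le_one_div_of_le hw₁ hw
    nlinarith
  have hlt : ∫ x in (0 : ℝ)..1,
      ((1 - 2 * κ) * (1 / weight c₂ κ (depth c₂ * x)) - 3 * weight c₂ κ (depth c₂ * x)) <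
      ∫ x in (0 : ℝ)..1,
      ((1 - 2 * κ) * (1 / weight c₁ κ (depth c₁ * x)) - 3 * weight c₁ κ (depth c₁ * x)) := by
    refine intervalIntegral.integral_lt_integral_of_continuousOn_of_le_of_exists_lt one_pos
      (hcont c₂).continuousOn (hcont c₁).continuousOn (fun x hx =>
      hmono x ⟨hx.1.le, hx.2⟩ _ _ (weight_pos hκ _ _) (hw x ⟨hx.1.le, hx.2⟩))
      ⟨0, by simp, ?_⟩
    have hw0 : weight c₁ κ (depth c₁ * 0) < weight c₂ κ (depth c₂ * 0) := by
      have h1 := weight_pos hκ c₂ (depth c₂ * 0)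
      refine Real.sqrt_lt_sqrt (by nlinarith [sq_nonneg c₁]) ?_
      simp only [mul_zero]
      nlinarith
    have h1 := weight_pos hκ c₁ (depth c₁ * 0)
    have : 1 / weight c₂ κ (depth c₂ * 0) < 1 / weight c₁ κ (depth c₁ * 0) :=
      one_div_lt_one_div_of_lt h1 hw0
    nlinarith
  rw [profileSlope_eq_scaled hκ hc₁] at h
  rw [profileSlope_eq_scaled hκ hc₂]
  have hd1 := depth_pos hc₁
  have hd2 := depth_pos hc₂
  have hJ : ∫ x in (0 : ℝ)..1, ((1 - 2 * κ) * (1 / weight c₁ κ (depth c₁ * x)) -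
      3 * weight c₁ κ (depth c₁ * x)) ≤ 0 := by
    by_contra! hp
    have : 0 < depth c₁ / 2 * ∫ x in (0 : ℝ)..1, ((1 - 2 * κ) *
      (1 / weight c₁ κ (depth c₁ * x)) - 3 * weight c₁ κ (depth c₁ * x)) := by positivity
    linarith
  exact mul_neg_of_pos_of_neg (by positivity) (by linarith)

theorem sq_lt_two_of_lt (h0 : 0 ≤ c) (hc : c < √2) : c ^ 2 < 2 := by
  rwa [← Real.lt_sqrt h0]

theorem tendsto_depth : Tendsto depth (𝓝[<] √2) (𝓝 0) := by
  have hcont : Continuous depth := by unfold depth; fun_prop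
  have := (hcont.tendsto √2).mono_left (nhdsWithin_le_nhds (s := Iio √2))
  simpa [depth] using this

theorem eventually_sq_lt_two : ∀ᶠ c in 𝓝[<] √2, 0 < c ∧ c ^ 2 < 2 := by
  filter_upwards [Ioo_mem_nhdsLT (show (0 : ℝ) < √2 by positivity)] with c hc
  exact ⟨hc.1, sq_lt_two_of_lt hc.1.le hc.2⟩

theorem tendsto_profileMomentum (hκ : κ ≤ 0) :
    Tendsto (profileMomentum κ) (𝓝[<] √2) (𝓝 0) := by
  have hq : 0 < √(1 - 2 * κ) := Real.sqrt_pos.2 (by linarith)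
  have hid : Tendsto (fun c : ℝ => c) (𝓝[<] √2) (𝓝 √2) :=
    tendsto_id.mono_left nhdsWithin_le_nhds
  have hd : Tendsto depth (𝓝[<] √2) (𝓝[>] 0) :=
    tendsto_nhdsWithin_iff.2 ⟨tendsto_depth, eventually_sq_lt_two.mono fun c hc => depth_pos hc.2⟩
  have h1 : Tendsto (fun c => c * √(1 - 2 * κ) / depth c) (𝓝[<] √2) atTop := by
    simp only [div_eq_mul_inv]
    exact (hid.mul_const √(1 - 2 * κ)).pos_mul_atTop (by positivity) hd.inv_tendsto_nhdsGT_zero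
  have h2 := (Real.tendsto_arctan_atTop.mono_right nhdsWithin_le_nhds).comp h1
  have hL : Tendsto (fun c => inverseWeightIntegral c κ (depth c)) (𝓝[<] √2) (𝓝 0) := by
    refine squeeze_zero_norm' ?_ tendsto_depth
    filter_upwards [eventually_sq_lt_two] with c hc
    have := intervalIntegral.norm_integral_le_of_norm_le_const (a := 0) (b := depth c) (C := 1)
      (f := fun s => 1 / weight c κ s) fun s _ => by
        have h1 := one_le_weight hκ c s
        rw [Real.norm_of_nonneg (by positivity), div_le_one (by linarith)]
        exact h1
    rwa [one_mul, sub_zero, abs_of_pos (depth_pos hc.2)] at this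
  have hpoly : Tendsto (fun c : ℝ => c * (-κ - (1 - κ * c ^ 2) / 4)) (𝓝[<] √2)
      (𝓝 (√2 * (-κ - (1 - κ * √2 ^ 2) / 4))) :=
    ((by fun_prop : Continuous fun c : ℝ => c * (-κ - (1 - κ * c ^ 2) / 4)).tendsto √2).mono_left
      nhdsWithin_le_nhds
  have := ((h2.const_sub (Real.pi / 2)).add (hpoly.mul hL)).sub
    ((hid.div_const 4).mul (tendsto_depth.mul_const √(1 - 2 * κ)))
  rw [sub_self, mul_zero, zero_mul, mul_zero, add_zero, sub_zero] at this
  exact this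

theorem weight_le (hκ : κ ≤ 0) (hc : c ^ 2 < 2) {t : ℝ} (h0 : 0 ≤ t) (ht : t ≤ depth c) :
    weight c κ t ≤ √(1 - 2 * κ) := by
  rw [← weight_depth hc]
  apply Real.sqrt_le_sqrt
  have : t ^ 2 ≤ depth c ^ 2 := by gcongr
  nlinarith

theorem tendsto_profileEnergy (hκ : κ ≤ 0) :
    Tendsto (profileEnergy κ) (𝓝[<] √2) (𝓝 0) := by
  have hlim : Tendsto (fun c => 1 / 2 * (2 * √(1 - 2 * κ) * depth c)) (𝓝[<] √2) (𝓝 0) := by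
    have := (tendsto_depth.const_mul (2 * √(1 - 2 * κ))).const_mul (1 / 2)
    rwa [mul_zero, mul_zero] at this
  refine squeeze_zero_norm' ?_ hlim
  filter_upwards [eventually_sq_lt_two] with c hc
  have hd := depth_pos hc.2
  rw [profileEnergy, norm_mul, Real.norm_of_nonneg (by norm_num : (0 : ℝ) ≤ 1 / 2)]
  gcongr
  have := intervalIntegral.norm_integral_le_of_norm_le_const (a := 0) (b := depth c)
    (C := 2 * √(1 - 2 * κ)) (f := fun t => (2 - c ^ 2 - t ^ 2) * weight c κ t) fun t ht => by
      rw [uIoc_of_le hd.le] at ht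
      have h1 := weight_le hκ hc.2 ht.1.le ht.2
      have h2 : t ^ 2 ≤ depth c ^ 2 := by gcongr; exacts [ht.1.le, ht.2]
      rw [depth_sq hc.2] at h2
      rw [norm_mul, Real.norm_of_nonneg (by linarith), Real.norm_of_nonneg (weight_pos hκ c t).le]
      have := weight_pos hκ c t
      gcongr
      nlinarith [sq_nonneg c, sq_nonneg t]
  rwa [sub_zero, abs_of_pos hd] at this

theorem profileEnergy_pos (hκ : κ ≤ 0) (hc : c ^ 2 < 2) : 0 < profileEnergy κ c := by
  refine mul_pos (by norm_num) (intervalIntegral.intervalIntegral_pos_of_pos_on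
    (Continuous.intervalIntegrable ?_ _ _) (fun t ht => ?_) (depth_pos hc))
  · exact (by fun_prop : Continuous fun t : ℝ => 2 - c ^ 2 - t ^ 2).mul (continuous_weight c κ)
  · have h2 : t ^ 2 < depth c ^ 2 := by
      have := ht.2; gcongr; exact ht.1.le
    rw [depth_sq hc] at h2
    exact mul_pos (by linarith) (weight_pos hκ c t)

theorem profileMomentum_zero (κ : ℝ) : profileMomentum κ 0 = Real.pi / 2 := by
  simp [profileMomentum]

theorem exists_solitonBranch (hκ : κ ≤ 0) :
    ∃ c₀, SolitonBranch (profileEnergy κ) (profileMomentum κ) (profileSlope κ) √2 c₀ := by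
  have h1 : (1 : ℝ) < √2 := by
    rw [Real.lt_sqrt (by norm_num)]; norm_num
  -- Inserting `0` keeps the set nonempty and yields `c₀ = 0` when the momentum decreases from the
  -- start.
  set S : Set ℝ := insert 0 {c | 0 ≤ c ∧ c < √2 ∧ 0 ≤ profileSlope κ c} with hS
  have hub : ∀ c ∈ S, c ≤ 1 := by
    rintro c (rfl | ⟨h0, hlt, hs⟩)
    · norm_num
    · by_contra! hc
      exact absurd hs (not_le.2 (profileSlope_neg_of_one_le hκ hc.le (sq_lt_two_of_lt h0 hlt)))
  have hbdd : BddAbove S := ⟨1, hub⟩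
  have h0S : (0 : ℝ) ∈ S := mem_insert _ _
  refine ⟨sSup S, le_csSup hbdd h0S, (csSup_le ⟨0, h0S⟩ hub).trans_lt h1, fun c h0 hc =>
    hasDerivAt_profileMomentum hκ (sq_lt_two_of_lt h0 hc), fun c h0 hc =>
    hasDerivAt_profileEnergy hκ (sq_lt_two_of_lt h0 hc), fun c h0 hc => ?_, fun c hc hlt => ?_,
    tendsto_profileMomentum hκ, tendsto_profileEnergy hκ, profileEnergy_pos hκ (by norm_num)⟩
  · obtain ⟨c', hc', hlt⟩ := exists_lt_of_lt_csSup ⟨0, h0S⟩ hc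
    rcases hc' with rfl | ⟨h0', hlt', hs⟩
    · exact absurd hlt (not_lt.2 h0.le)
    · by_contra! hneg
      exact absurd hs (not_le.2 (profileSlope_neg_of_nonpos hκ h0.le hlt
        (sq_lt_two_of_lt h0' hlt') hneg))
  · by_contra! hs
    have hc0 : 0 ≤ c := (le_csSup hbdd h0S).trans hc.le
    exact absurd (le_csSup hbdd (mem_insert_of_mem _ ⟨hc0, hlt, hs⟩)) (not_le.2 hc)

end

/-! ### Solitons and plateau solitons: regularity, energy and momentum. -/

theorem integral_of_hasDerivAt_of_nonneg {F f : ℝ → ℝ} (hd : ∀ x, HasDerivAt F (f x) x)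
    (hf : Continuous f) (h0 : ∀ x, 0 ≤ f x) {m n : ℝ} (hbot : Tendsto F atBot (𝓝 m))
    (htop : Tendsto F atTop (𝓝 n)) : Integrable f ∧ ∫ x, f x = n - m := by
  have hi : Integrable f := by
    refine integrable_of_intervalIntegral_norm_tendsto (n - m) (l := atTop)
      (a := fun r : ℝ => -r) (b := fun r => r) (fun r => ?_) tendsto_neg_atTop_atBot tendsto_id ?_
    · exact hf.integrableOn_Ioc
    · have : ∀ r : ℝ, F r - F (-r) = ∫ x in (-r)..r, ‖f x‖ := fun r => by
        rw [← intervalIntegral.integral_eq_sub_of_hasDerivAt (fun x _ => hd x)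
          (hf.intervalIntegrable _ _)]
        exact intervalIntegral.integral_congr fun x _ => (Real.norm_of_nonneg (h0 x)).symm
      exact (htop.sub (hbot.comp tendsto_neg_atTop_atBot)).congr this
  exact ⟨hi, integral_of_hasDerivAt_of_tendsto hd hi hbot htop⟩

/-- The signed distance to the interval `[-ℓ, ℓ]`. -/
def overshoot (ℓ x : ℝ) : ℝ := x - max (-ℓ) (min ℓ x)

section Overshoot

variable {ℓ x : ℝ}

theorem overshoot_zero (x : ℝ) : overshoot 0 x = x := by
  unfold overshoot
  rcases le_total x 0 with h | h <;> simp [h]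

theorem overshoot_of_mem (h1 : -ℓ ≤ x) (h2 : x ≤ ℓ) : overshoot ℓ x = 0 := by
  simp [overshoot, h1, h2]

theorem overshoot_of_ge (hℓ : 0 ≤ ℓ) (h : ℓ ≤ x) : overshoot ℓ x = x - ℓ := by
  rw [overshoot, min_eq_left h, max_eq_right (by linarith)]

theorem overshoot_of_le (hℓ : 0 ≤ ℓ) (h : x ≤ -ℓ) : overshoot ℓ x = x + ℓ := by
  rw [overshoot, min_eq_right (by linarith), max_eq_left h, sub_neg_eq_add]

theorem continuous_overshoot (ℓ : ℝ) : Continuous (overshoot ℓ) := by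
  unfold overshoot; fun_prop

theorem overshoot_nonneg (hℓ : 0 ≤ ℓ) (h : 0 ≤ x) : 0 ≤ overshoot ℓ x := by
  rcases le_total x ℓ with h' | h'
  · rw [overshoot_of_mem (by linarith) h']
  · rw [overshoot_of_ge hℓ h']; linarith

theorem overshoot_nonpos (hℓ : 0 ≤ ℓ) (h : x ≤ 0) : overshoot ℓ x ≤ 0 := by
  rcases le_total (-ℓ) x with h' | h'
  · rw [overshoot_of_mem h' (by linarith)]
  · rw [overshoot_of_le hℓ h']; linarith

theorem abs_overshoot_sub_le (ℓ x y : ℝ) : |overshoot ℓ x - overshoot ℓ y| ≤ |x - y| := by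
  unfold overshoot
  grind

/-- The kinks of `overshoot` at `±ℓ` are harmless: `f' 0 = 0` makes the increment of `f` at `0` of
smaller order, and `overshoot` is 1-Lipschitz. -/
theorem hasDerivAt_comp_overshoot {f f' : ℝ → ℝ} (hℓ : 0 ≤ ℓ) (hf : ∀ y, HasDerivAt f (f' y) y)
    (h0 : f' 0 = 0) (x : ℝ) :
    HasDerivAt (fun y => f (overshoot ℓ y)) (f' (overshoot ℓ x)) x := by
  by_cases h1 : x < -ℓ
  · have e : (fun y => f (overshoot ℓ y)) =ᶠ[𝓝 x] fun y => f (y + ℓ) := by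
      filter_upwards [gt_mem_nhds h1] with y hy
      rw [overshoot_of_le hℓ (le_of_lt hy)]
    rw [overshoot_of_le hℓ h1.le]
    exact ((hf (x + ℓ)).comp_add_const x ℓ).congr_of_eventuallyEq e
  by_cases h2 : ℓ < x
  · have e : (fun y => f (overshoot ℓ y)) =ᶠ[𝓝 x] fun y => f (y - ℓ) := by
      filter_upwards [lt_mem_nhds h2] with y hy
      rw [overshoot_of_ge hℓ (le_of_lt hy)]
    rw [overshoot_of_ge hℓ h2.le]
    exact ((hf (x - ℓ)).comp_sub_const x ℓ).congr_of_eventuallyEq e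
  have hx : overshoot ℓ x = 0 := overshoot_of_mem (not_lt.1 h1) (not_lt.1 h2)
  have hd := hf 0
  rw [h0, hasDerivAt_iff_isLittleO] at hd
  rw [hx, h0, hasDerivAt_iff_isLittleO]
  simp only [sub_zero, smul_zero] at hd ⊢
  have ht : Tendsto (overshoot ℓ) (𝓝 x) (𝓝 0) := by
    rw [← hx]; exact (continuous_overshoot ℓ).tendsto x
  rw [hx]
  refine (hd.comp_tendsto ht).trans_isBigO (Asymptotics.IsBigO.of_bound 1 ?_)
  refine Eventually.of_forall fun y => ?_
  have := abs_overshoot_sub_le ℓ y x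
  rw [hx, sub_zero] at this
  simpa using this

theorem integral_comp_overshoot {f : ℝ → ℝ} (hℓ : 0 ≤ ℓ) (hf : Integrable f) :
    Integrable (fun x => f (overshoot ℓ x)) ∧
      ∫ x, f (overshoot ℓ x) = (∫ x, f x) + 2 * ℓ * f 0 := by
  have e1 : ∀ x ∈ Iic (-ℓ), f (overshoot ℓ x) = f (x + ℓ) := fun x hx => by
    rw [overshoot_of_le hℓ hx]
  have e2 : ∀ x ∈ Ioi ℓ, f (overshoot ℓ x) = f (x - ℓ) := fun x hx => by
    rw [overshoot_of_ge hℓ (le_of_lt hx)]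
  have e3 : ∀ x ∈ Ioc (-ℓ) ℓ, f (overshoot ℓ x) = f 0 := fun x hx => by
    rw [overshoot_of_mem hx.1.le hx.2]
  have i1 : IntegrableOn (fun x => f (overshoot ℓ x)) (Iic (-ℓ)) :=
    ((hf.comp_add_right ℓ).integrableOn).congr_fun (fun x hx => (e1 x hx).symm) measurableSet_Iic
  have i2 : IntegrableOn (fun x => f (overshoot ℓ x)) (Ioi ℓ) :=
    ((hf.comp_sub_right ℓ).integrableOn).congr_fun (fun x hx => (e2 x hx).symm) measurableSet_Ioi
  have i3 : IntegrableOn (fun x => f (overshoot ℓ x)) (Ioc (-ℓ) ℓ) :=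
    (integrableOn_const (by simp)).congr_fun (fun x hx => (e3 x hx).symm) measurableSet_Ioc
  have i4 : IntegrableOn (fun x => f (overshoot ℓ x)) (Ioi (-ℓ)) := by
    rw [← Ioc_union_Ioi_eq_Ioi (by linarith : -ℓ ≤ ℓ)]
    exact i3.union i2
  have hdis : Disjoint (Ioc (-ℓ) ℓ) (Ioi ℓ) :=
    Set.disjoint_left.2 fun x hx hx' => not_lt.2 hx.2 hx'
  refine ⟨by rw [← integrableOn_univ, ← Iic_union_Ioi (a := -ℓ)]; exact i1.union i4, ?_⟩
  rw [← intervalIntegral.integral_Iic_add_Ioi i1 i4,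
    ← Ioc_union_Ioi_eq_Ioi (by linarith : -ℓ ≤ ℓ),
    setIntegral_union hdis measurableSet_Ioi i3 i2,
    setIntegral_congr_fun measurableSet_Iic e1, setIntegral_congr_fun measurableSet_Ioi e2,
    setIntegral_congr_fun measurableSet_Ioc e3]
  have a1 : ∫ x in Iic (-ℓ), f (x + ℓ) = ∫ x in Iic 0, f x := by
    rw [← integral_indicator measurableSet_Iic, ← integral_indicator measurableSet_Iic,
      ← integral_add_right_eq_self ((Iic (0 : ℝ)).indicator f) ℓ]
    refine integral_congr_ae (Eventually.of_forall fun x => ?_)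
    simp [indicator, le_neg_iff_add_nonpos_right]
  have a2 : ∫ x in Ioi ℓ, f (x - ℓ) = ∫ x in Ioi 0, f x := by
    rw [← integral_indicator measurableSet_Ioi, ← integral_indicator measurableSet_Ioi,
      ← integral_sub_right_eq_self ((Ioi (0 : ℝ)).indicator f) ℓ]
    refine integral_congr_ae (Eventually.of_forall fun x => ?_)
    simp [indicator]
  rw [a1, a2, ← intervalIntegral.integral_Iic_add_Ioi (b := 0) hf.integrableOn hf.integrableOn]
  simp
  rw [max_eq_left (by linarith)]
  ring

end Overshoot

section Profile

variable {c κ : ℝ}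

theorem hasDerivAt_intensityProfile (hκ : κ ≤ 0) (hc : c ^ 2 < 2) (x : ℝ) :
    HasDerivAt (intensityProfile c κ) (-(solitonRoot c κ x * intensityProfile c κ x /
      weight c κ (solitonRoot c κ x))) x := by
  have e : intensityProfile c κ = fun x => (2 - c ^ 2 - solitonRoot c κ x ^ 2) / 2 :=
    funext fun x => intensityProfile_eq hκ hc x
  have hw := weight_pos hκ c (solitonRoot c κ x)
  have h := (((hasDerivAt_solitonRoot hκ hc x).pow 2).const_sub (2 - c ^ 2)).div_const 2
  rw [e]
  refine h.congr_deriv ?_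
  simp
  field_simp

theorem intensityProfile_pos (hκ : κ ≤ 0) (hc : c ^ 2 < 2) (x : ℝ) :
    0 < intensityProfile c κ x := by
  rw [intensityProfile_eq hκ hc]
  linarith [solitonRoot_sq_lt hκ hc x]

theorem two_mul_one_sub_intensityProfile (hκ : κ ≤ 0) (hc : c ^ 2 < 2) (x : ℝ) :
    2 * (1 - intensityProfile c κ x) = c ^ 2 + solitonRoot c κ x ^ 2 := by
  rw [intensityProfile_eq hκ hc]; ring

theorem intensityProfile_lt_one (hκ : κ ≤ 0) (hc0 : 0 < c) (hc : c ^ 2 < 2) (x : ℝ) :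
    intensityProfile c κ x < 1 := by
  have := two_mul_one_sub_intensityProfile hκ hc x
  nlinarith [sq_nonneg (solitonRoot c κ x)]

theorem intensityProfile_zero (hκ : κ ≤ 0) (hc : c ^ 2 < 2) :
    intensityProfile c κ 0 = 1 - c ^ 2 / 2 := by
  rw [intensityProfile_eq hκ hc, solitonRoot_zero hκ hc]; ring

theorem continuous_intensityProfile (hκ : κ ≤ 0) (hc : c ^ 2 < 2) :
    Continuous (intensityProfile c κ) :=
  continuous_iff_continuousAt.2 fun x => (hasDerivAt_intensityProfile hκ hc x).continuousAt

/-- Change of variable `t = solitonRoot c κ x`, whose derivative is intensity over weight; `t` runs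
from `-depth c` to `depth c`, and oddness doubles the value at `depth c`. -/
theorem integral_comp_solitonRoot (hκ : κ ≤ 0) (hc : c ^ 2 < 2) {H h : ℝ → ℝ}
    (hH : ∀ t, HasDerivAt H (h t) t) (hh : Continuous h) (hodd : ∀ t, H (-t) = - H t)
    (hpos : ∀ x, 0 ≤ h (solitonRoot c κ x)) :
    Integrable (fun x => h (solitonRoot c κ x) * (intensityProfile c κ x /
      weight c κ (solitonRoot c κ x))) ∧
    ∫ x, h (solitonRoot c κ x) * (intensityProfile c κ x /
      weight c κ (solitonRoot c κ x)) = 2 * H (depth c) := by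
  have hT := continuous_solitonRoot hκ hc
  have hHc : Continuous H := continuous_iff_continuousAt.2 fun t => (hH t).continuousAt
  have key := integral_of_hasDerivAt_of_nonneg (F := fun x => H (solitonRoot c κ x))
    (f := fun x => h (solitonRoot c κ x) * (intensityProfile c κ x /
      weight c κ (solitonRoot c κ x))) (fun x => ?_) ?_ (fun x => ?_)
    ((hHc.tendsto _).comp (tendsto_solitonRoot_atBot hκ hc))
    ((hHc.tendsto _).comp (tendsto_solitonRoot_atTop hκ hc))
  · rw [hodd] at key
    refine ⟨key.1, key.2.trans (by ring)⟩
  · refine ((hH _).comp x (hasDerivAt_solitonRoot hκ hc x)).congr_deriv ?_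
    rw [intensityProfile_eq hκ hc, div_div]
  · exact (hh.comp hT).mul ((continuous_intensityProfile hκ hc).div
      ((continuous_weight c κ).comp hT) fun x => (weight_pos hκ c _).ne')
  · exact mul_nonneg (hpos x) (div_nonneg (intensityProfile_pos hκ hc x).le
      (weight_pos hκ c _).le)

theorem integral_sq_intensityProfile (hκ : κ ≤ 0) (hc : c ^ 2 < 2) :
    Integrable (fun x => intensityProfile c κ x ^ 2) ∧
      ∫ x, intensityProfile c κ x ^ 2 = 2 * profileEnergy κ c := by
  have hcont : Continuous fun t => 1 / 2 * ((2 - c ^ 2 - t ^ 2) * weight c κ t) :=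
    ((by fun_prop : Continuous fun t : ℝ => 2 - c ^ 2 - t ^ 2).mul
      (continuous_weight c κ)).const_mul _
  have key := integral_comp_solitonRoot hκ hc
    (H := fun t => ∫ s in (0 : ℝ)..t, 1 / 2 * ((2 - c ^ 2 - s ^ 2) * weight c κ s))
    (h := fun t => 1 / 2 * ((2 - c ^ 2 - t ^ 2) * weight c κ t))
    (fun t => intervalIntegral.integral_hasDerivAt_right (hcont.intervalIntegrable _ _)
      (hcont.stronglyMeasurableAtFilter _ _) hcont.continuousAt) hcont ?_ (fun x => ?_)
  · have e : (fun x => 1 / 2 * ((2 - c ^ 2 - solitonRoot c κ x ^ 2) *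
        weight c κ (solitonRoot c κ x)) * (intensityProfile c κ x /
        weight c κ (solitonRoot c κ x))) = fun x => intensityProfile c κ x ^ 2 := by
      funext x
      have hw := weight_pos hκ c (solitonRoot c κ x)
      have h1 := intensityProfile_eq hκ hc x
      have h2 : 2 - c ^ 2 - solitonRoot c κ x ^ 2 = 2 * intensityProfile c κ x := by
        rw [h1]; ring
      rw [h2]
      field_simp
    rw [e] at key
    refine ⟨key.1, key.2.trans ?_⟩
    rw [intervalIntegral.integral_const_mul, profileEnergy]
  · intro t
    have h := intervalIntegral.integral_comp_neg (a := 0) (b := t)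
      fun s => 1 / 2 * ((2 - c ^ 2 - s ^ 2) * weight c κ s)
    simp only [weight_neg, neg_zero, neg_sq] at h
    rw [intervalIntegral.integral_symm, h]
  · have h1 := solitonRoot_sq_lt hκ hc x
    have h2 := weight_pos hκ c (solitonRoot c κ x)
    have : 0 < 2 - c ^ 2 - solitonRoot c κ x ^ 2 := by linarith
    positivity

theorem integral_sq_div_intensityProfile (hκ : κ ≤ 0) (hc0 : 0 < c) (hc : c ^ 2 < 2) :
    Integrable (fun x => c / 4 * (intensityProfile c κ x ^ 2 / (1 - intensityProfile c κ x))) ∧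
      ∫ x, c / 4 * (intensityProfile c κ x ^ 2 / (1 - intensityProfile c κ x)) =
        profileMomentum κ c := by
  have hr : ∀ t : ℝ, 0 < c ^ 2 + t ^ 2 := fun t => by positivity
  have hcont : Continuous fun t => 1 / 2 * (c / 2 * (2 - c ^ 2 - t ^ 2) * weight c κ t /
      (c ^ 2 + t ^ 2)) :=
    (((by fun_prop : Continuous fun t : ℝ => c / 2 * (2 - c ^ 2 - t ^ 2)).mul
      (continuous_weight c κ)).div (by fun_prop) fun t => (hr t).ne').const_mul _
  have key := integral_comp_solitonRoot hκ hc (H := fun t => 1 / 2 * momentumPrimitive c κ t)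
    (h := fun t => 1 / 2 * (c / 2 * (2 - c ^ 2 - t ^ 2) * weight c κ t / (c ^ 2 + t ^ 2)))
    (fun t => (hasDerivAt_momentumPrimitive hκ hc0 t).const_mul _) hcont
    (fun t => by rw [momentumPrimitive_neg]; ring) (fun x => ?_)
  · have e : (fun x => 1 / 2 * (c / 2 * (2 - c ^ 2 - solitonRoot c κ x ^ 2) *
        weight c κ (solitonRoot c κ x) / (c ^ 2 + solitonRoot c κ x ^ 2)) *
        (intensityProfile c κ x / weight c κ (solitonRoot c κ x))) =
        fun x => c / 4 * (intensityProfile c κ x ^ 2 / (1 - intensityProfile c κ x)) := by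
      funext x
      have hw := weight_pos hκ c (solitonRoot c κ x)
      have h2 : 2 - c ^ 2 - solitonRoot c κ x ^ 2 = 2 * intensityProfile c κ x := by
        rw [intensityProfile_eq hκ hc x]; ring
      have h3 : 0 < 1 - intensityProfile c κ x := by
        linarith [intensityProfile_lt_one hκ hc0 hc x]
      rw [h2, ← two_mul_one_sub_intensityProfile hκ hc x]
      field_simp
      ring
    rw [e] at key
    refine ⟨key.1, key.2.trans ?_⟩
    rw [← momentumPrimitive_depth hc0 hc hκ]
    ring
  · have h1 := solitonRoot_sq_lt hκ hc x
    have h2 := weight_pos hκ c (solitonRoot c κ x)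
    have : 0 < 2 - c ^ 2 - solitonRoot c κ x ^ 2 := by linarith
    positivity

end Profile

theorem mem_energySpace_of_hasDerivAt {u du : ℝ → ℂ} (h : ∀ x, HasDerivAt u (du x) x)
    (hc : Continuous du) (h2 : MemLp du 2 volume) (h3 : MemLp (intensity u) 2 volume) :
    u ∈ energySpace ∧ weakDeriv u =ᵐ[volume] du := by
  have hp := isPrimitive_of_hasDerivAt h hc
  exact ⟨⟨hp.continuous, ⟨du, hp.hasWeakDeriv, h2⟩, h3⟩, weakDeriv_ae_eq hp.hasWeakDeriv⟩

/-- A dark soliton cut at its center, with a plane wave of length `2ℓ` inserted. -/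
noncomputable def plateauSoliton (c κ ℓ x : ℝ) : ℂ :=
  ((√(1 - intensityProfile c κ (overshoot ℓ x)) : ℝ) : ℂ) *
    Complex.exp (Complex.I * ((c / 2 * (∫ y in (0 : ℝ)..x, intensityProfile c κ (overshoot ℓ y) /
      (1 - intensityProfile c κ (overshoot ℓ y))) : ℝ) : ℂ))

/-- The logarithmic derivative of the soliton. -/
noncomputable def solitonLogDeriv (c κ x : ℝ) : ℂ :=
  ⟨solitonRoot c κ x * intensityProfile c κ x / weight c κ (solitonRoot c κ x) /
    (2 * (1 - intensityProfile c κ x)), c * intensityProfile c κ x /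
    (2 * (1 - intensityProfile c κ x))⟩

theorem inner_mul_self_eq (w z : ℂ) : inner ℝ (w * z) z = w.re * ‖z‖ ^ 2 := by
  simp only [Complex.sq_norm, Complex.normSq_apply, Complex.inner, Complex.mul_re, Complex.conj_re,
    Complex.conj_im, Complex.mul_im]
  ring

theorem inner_I_mul_mul_self_eq (w z : ℂ) :
    inner ℝ (Complex.I * (w * z)) z = - w.im * ‖z‖ ^ 2 := by
  rw [← mul_assoc, inner_mul_self_eq]; simp

section Soliton

variable {c κ ℓ : ℝ}

/-- The soliton is the plateau of length zero, so its properties are read off from those of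
plateaus. -/
theorem darkSoliton_eq_plateauSoliton (hc : c ≠ 0) (κ : ℝ) :
    darkSoliton c κ = plateauSoliton c κ 0 := by
  funext x
  simp [darkSoliton, hc, plateauSoliton, solitonPhase, overshoot_zero]

theorem norm_plateauSoliton_sq (hκ : κ ≤ 0) (hc0 : 0 < c) (hc : c ^ 2 < 2) (ℓ x : ℝ) :
    ‖plateauSoliton c κ ℓ x‖ ^ 2 = 1 - intensityProfile c κ (overshoot ℓ x) := by
  have := intensityProfile_lt_one hκ hc0 hc (overshoot ℓ x)
  rw [plateauSoliton, norm_mul, mul_comm Complex.I, Complex.norm_exp_ofReal_mul_I, mul_one,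
    Complex.norm_real, Real.norm_of_nonneg (Real.sqrt_nonneg _), Real.sq_sqrt (by linarith)]

theorem intensity_plateauSoliton (hκ : κ ≤ 0) (hc0 : 0 < c) (hc : c ^ 2 < 2) (ℓ x : ℝ) :
    intensity (plateauSoliton c κ ℓ) x = intensityProfile c κ (overshoot ℓ x) := by
  rw [intensity, norm_plateauSoliton_sq hκ hc0 hc]; ring

theorem continuous_solitonLogDeriv (hκ : κ ≤ 0) (hc0 : 0 < c) (hc : c ^ 2 < 2) :
    Continuous (solitonLogDeriv c κ) := by
  have h1 := continuous_intensityProfile hκ hc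
  have h2 := continuous_solitonRoot hκ hc
  have hne : ∀ x, 2 * (1 - intensityProfile c κ x) ≠ 0 := fun x => by
    have := intensityProfile_lt_one hκ hc0 hc x
    nlinarith
  have e : solitonLogDeriv c κ = fun x => ((solitonRoot c κ x * intensityProfile c κ x /
      weight c κ (solitonRoot c κ x) / (2 * (1 - intensityProfile c κ x)) : ℝ) : ℂ) +
      ((c * intensityProfile c κ x / (2 * (1 - intensityProfile c κ x)) : ℝ) : ℂ) * Complex.I := by
    funext x
    rw [solitonLogDeriv, Complex.mk_eq_add_mul_I]
  rw [e]
  refine (Complex.continuous_ofReal.comp (((h2.mul h1).div ((continuous_weight c κ).comp h2)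
    fun x => (weight_pos hκ c _).ne').div (by fun_prop) hne)).add
    ((Complex.continuous_ofReal.comp ((h1.const_mul c).div (by fun_prop) hne)).mul
      continuous_const)

theorem hasDerivAt_plateauSoliton (hκ : κ ≤ 0) (hc0 : 0 < c) (hc : c ^ 2 < 2) (hℓ : 0 ≤ ℓ)
    (x : ℝ) : HasDerivAt (plateauSoliton c κ ℓ)
      (solitonLogDeriv c κ (overshoot ℓ x) * plateauSoliton c κ ℓ x) x := by
  set y := overshoot ℓ x with hy
  have hN : 0 < 1 - intensityProfile c κ y := by
    linarith [intensityProfile_lt_one hκ hc0 hc y]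
  -- The profile is flat at its center, so cutting it there and inserting a constant keeps it
  -- differentiable.
  have h1 := hasDerivAt_comp_overshoot hℓ (fun x => hasDerivAt_intensityProfile hκ hc x)
    (by simp [solitonRoot_zero hκ hc]) x
  rw [← hy] at h1
  have h2 := (h1.const_sub 1).sqrt hN.ne'
  have hcont : Continuous fun y => intensityProfile c κ (overshoot ℓ y) /
      (1 - intensityProfile c κ (overshoot ℓ y)) := by
    have := (continuous_intensityProfile hκ hc).comp (continuous_overshoot ℓ)
    refine this.div (continuous_const.sub this) fun y => ?_
    have := intensityProfile_lt_one hκ hc0 hc (overshoot ℓ y)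
    exact sub_ne_zero.2 this.ne'
  have h3 := (intervalIntegral.integral_hasDerivAt_right (hcont.intervalIntegrable 0 x)
    (hcont.stronglyMeasurableAtFilter _ _) hcont.continuousAt).const_mul (c / 2)
  have h4 := (h3.ofReal_comp.const_mul Complex.I).cexp
  have h5 := h2.ofReal_comp.mul h4
  refine h5.congr_deriv ?_
  have hs := Real.sq_sqrt hN.le
  have hs0 : √(1 - intensityProfile c κ y) ≠ 0 := (Real.sqrt_pos.2 hN).ne'
  have e : (solitonLogDeriv c κ y) = ((solitonRoot c κ y * intensityProfile c κ y /
      weight c κ (solitonRoot c κ y) / (2 * (1 - intensityProfile c κ y)) : ℝ) : ℂ) +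
      ((c * intensityProfile c κ y / (2 * (1 - intensityProfile c κ y)) : ℝ) : ℂ) * Complex.I := by
    rw [solitonLogDeriv, Complex.mk_eq_add_mul_I]
  rw [e, plateauSoliton, ← hy]
  set s := √(1 - intensityProfile c κ y) with hsdef
  have e1 : - -(solitonRoot c κ y * intensityProfile c κ y / weight c κ (solitonRoot c κ y)) /
      (2 * s) = solitonRoot c κ y * intensityProfile c κ y /
      weight c κ (solitonRoot c κ y) / (2 * (1 - intensityProfile c κ y)) * s := by
    rw [← hs]; field_simp
  rw [e1]
  have e2 : c * intensityProfile c κ y / (2 * (1 - intensityProfile c κ y)) =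
    c / 2 * (intensityProfile c κ y / (1 - intensityProfile c κ y)) := by field_simp
  rw [e2]
  push_cast
  ring

theorem sq_norm_solitonLogDeriv_mul (hκ : κ ≤ 0) (hc0 : 0 < c) (hc : c ^ 2 < 2) (x : ℝ) :
    ‖solitonLogDeriv c κ x‖ ^ 2 * (1 - intensityProfile c κ x) =
      intensityProfile c κ x ^ 2 / 4 * ((solitonRoot c κ x / weight c κ (solitonRoot c κ x)) ^ 2
        + c ^ 2) / (1 - intensityProfile c κ x) := by
  have hN : 0 < 1 - intensityProfile c κ x := by
    linarith [intensityProfile_lt_one hκ hc0 hc x]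
  have hw := weight_pos hκ c (solitonRoot c κ x)
  rw [solitonLogDeriv, Complex.sq_norm, Complex.normSq_mk]
  field_simp
  ring

theorem sq_norm_solitonLogDeriv_mul_le (hκ : κ ≤ 0) (hc0 : 0 < c) (hc : c ^ 2 < 2) (x : ℝ) :
    ‖solitonLogDeriv c κ x‖ ^ 2 * (1 - intensityProfile c κ x) ≤
      intensityProfile c κ x ^ 2 / 2 := by
  have hN : 0 < 1 - intensityProfile c κ x := by
    linarith [intensityProfile_lt_one hκ hc0 hc x]
  have hw := one_le_weight hκ c (solitonRoot c κ x)
  have h2 := two_mul_one_sub_intensityProfile hκ hc x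
  rw [sq_norm_solitonLogDeriv_mul hκ hc0 hc, div_le_iff₀ hN]
  have h3 : (solitonRoot c κ x / weight c κ (solitonRoot c κ x)) ^ 2 ≤ solitonRoot c κ x ^ 2 := by
    rw [div_pow]
    exact div_le_self (sq_nonneg _) (one_le_pow₀ hw)
  calc _ ≤ intensityProfile c κ x ^ 2 / 4 * (solitonRoot c κ x ^ 2 + c ^ 2) := by gcongr
    _ = _ := by rw [add_comm, ← h2]; ring

theorem memLp_comp_overshoot_intensityProfile (hκ : κ ≤ 0) (hc : c ^ 2 < 2) (hℓ : 0 ≤ ℓ) :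
    MemLp (fun x => intensityProfile c κ (overshoot ℓ x)) 2 volume := by
  refine (memLp_two_iff_integrable_sq
    ((continuous_intensityProfile hκ hc).comp (continuous_overshoot ℓ)).aestronglyMeasurable).2 ?_
  exact (integral_comp_overshoot hℓ (integral_sq_intensityProfile hκ hc).1).1

theorem plateauSoliton_facts (hκ : κ ≤ 0) (hc0 : 0 < c) (hc : c ^ 2 < 2) (hℓ : 0 ≤ ℓ) :
    plateauSoliton c κ ℓ ∈ energySpace ∧ weakDeriv (plateauSoliton c κ ℓ) =ᵐ[volume]
      fun x => solitonLogDeriv c κ (overshoot ℓ x) * plateauSoliton c κ ℓ x := by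
  have hm := memLp_comp_overshoot_intensityProfile hκ hc hℓ
  have hd := hasDerivAt_plateauSoliton hκ hc0 hc hℓ
  have hcont : Continuous fun x => solitonLogDeriv c κ (overshoot ℓ x) *
      plateauSoliton c κ ℓ x :=
    ((continuous_solitonLogDeriv hκ hc0 hc).comp (continuous_overshoot ℓ)).mul
      (continuous_iff_continuousAt.2 fun x => (hd x).continuousAt)
  refine mem_energySpace_of_hasDerivAt hd hcont ?_ ?_
  · refine hm.of_le hcont.aestronglyMeasurable (Eventually.of_forall fun x => ?_)
    rw [← sq_le_sq₀ (norm_nonneg _) (norm_nonneg _), norm_mul, mul_pow,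
      norm_plateauSoliton_sq hκ hc0 hc, Real.norm_eq_abs, sq_abs]
    have := sq_norm_solitonLogDeriv_mul_le hκ hc0 hc (overshoot ℓ x)
    nlinarith [sq_nonneg (intensityProfile c κ (overshoot ℓ x))]
  · have e : intensity (plateauSoliton c κ ℓ) = fun x => intensityProfile c κ (overshoot ℓ x) :=
      funext (intensity_plateauSoliton hκ hc0 hc ℓ)
    rw [e]
    exact hm

theorem plateauSoliton_mem (hκ : κ ≤ 0) (hc0 : 0 < c) (hc : c ^ 2 < 2) (hℓ : 0 ≤ ℓ) :
    plateauSoliton c κ ℓ ∈ nonvanishingSpace := by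
  refine mem_nonvanishingSpace (plateauSoliton_facts hκ hc0 hc hℓ).1 fun x h0 => ?_
  have := norm_plateauSoliton_sq hκ hc0 hc ℓ x
  rw [h0] at this
  have := intensityProfile_lt_one hκ hc0 hc (overshoot ℓ x)
  simp at *
  linarith

theorem slopes_plateauSoliton (hκ : κ ≤ 0) (hc0 : 0 < c) (hc : c ^ 2 < 2) (hℓ : 0 ≤ ℓ) :
    ∀ᵐ x, radialSlope (plateauSoliton c κ ℓ) x = solitonRoot c κ (overshoot ℓ x) *
        intensityProfile c κ (overshoot ℓ x) / (2 * weight c κ (solitonRoot c κ (overshoot ℓ x))) ∧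
      angularSlope (plateauSoliton c κ ℓ) x = -(c * intensityProfile c κ (overshoot ℓ x) / 2) := by
  filter_upwards [(plateauSoliton_facts hκ hc0 hc hℓ).2] with x hx
  have hN : 0 < 1 - intensityProfile c κ (overshoot ℓ x) := by
    linarith [intensityProfile_lt_one hκ hc0 hc (overshoot ℓ x)]
  have hw := weight_pos hκ c (solitonRoot c κ (overshoot ℓ x))
  rw [radialSlope, angularSlope, hx, inner_mul_self_eq, inner_I_mul_mul_self_eq,
    norm_plateauSoliton_sq hκ hc0 hc, solitonLogDeriv]
  constructor <;> field_simp

/-- The momentum density is `c / 4 * η² / (1 - η)`, and the plateau adds `2ℓ` times its central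
value. This value is positive, so every momentum above that of the soliton is reached. -/
theorem momentum_plateauSoliton (hκ : κ ≤ 0) (hc0 : 0 < c) (hc : c ^ 2 < 2) (hℓ : 0 ≤ ℓ) :
    momentum (plateauSoliton c κ ℓ) = profileMomentum κ c +
      2 * ℓ * (c / 4 * ((1 - c ^ 2 / 2) ^ 2 / (c ^ 2 / 2))) := by
  obtain ⟨h1, h2⟩ := integral_sq_div_intensityProfile hκ hc0 hc
  have h3 := (integral_comp_overshoot hℓ h1).2
  rw [h2, intensityProfile_zero hκ hc, sub_sub_cancel] at h3
  rw [← h3, momentum_eq_integral]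
  refine integral_congr_ae ((slopes_plateauSoliton hκ hc0 hc hℓ).mono fun x hx => ?_)
  simp only [momentumDensity, hx.2, norm_plateauSoliton_sq hκ hc0 hc]
  have hN : 0 < 1 - intensityProfile c κ (overshoot ℓ x) := by
    linarith [intensityProfile_lt_one hκ hc0 hc (overshoot ℓ x)]
  field_simp
  ring

/-- Both squares of the defect vanish, on the plateau as well: there `η = 1 - c² / 2`, so the radial
slope and `√(2 - c² - 2η)` are zero. The calibrated bound is therefore an equality for every length.
-/
theorem energy_sub_plateauSoliton (hκ : κ ≤ 0) (hc0 : 0 < c) (hc : c ^ 2 < 2) (hℓ : 0 ≤ ℓ) :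
    energy κ (plateauSoliton c κ ℓ) - c * momentum (plateauSoliton c κ ℓ) =
      2 * calibration c κ (1 - c ^ 2 / 2) := by
  have hi := intensity_plateauSoliton hκ hc0 hc ℓ
  have hmax : ∀ x, intensity (plateauSoliton c κ ℓ) x ≤ 1 - c ^ 2 / 2 := fun x => by
    rw [hi, intensityProfile_eq hκ hc]
    nlinarith [sq_nonneg (solitonRoot c κ (overshoot ℓ x))]
  rw [(energy_sub_momentum_eq hκ hc0 (plateauSoliton_mem hκ hc0 hc hℓ) (x₀ := 0) hmax
    ?_).2, add_eq_left]
  · refine integral_eq_zero_of_ae ((slopes_plateauSoliton hκ hc0 hc hℓ).mono fun x hx => ?_)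
    have hw := weight_pos hκ c (solitonRoot c κ (overshoot ℓ x))
    have h2 := two_mul_one_sub_intensityProfile hκ hc (overshoot ℓ x)
    simp only [defect, Pi.zero_apply, hx.1, hx.2, hi, norm_plateauSoliton_sq hκ hc0 hc]
    have e1 : √(1 - 2 * κ * (1 - intensityProfile c κ (overshoot ℓ x))) =
        weight c κ (solitonRoot c κ (overshoot ℓ x)) := by
      rw [weight, ← h2]; ring_nf
    have e2 : √(2 - c ^ 2 - 2 * intensityProfile c κ (overshoot ℓ x)) =
        |solitonRoot c κ (overshoot ℓ x)| := by
      rw [← Real.sqrt_sq_eq_abs]; congr 1; linarith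
    have e3 : (if x ≤ 0 then -1 else 1) * |solitonRoot c κ (overshoot ℓ x)| =
        solitonRoot c κ (overshoot ℓ x) := by
      split_ifs with h
      · have := solitonRoot_nonneg hκ hc (neg_nonneg.2 (overshoot_nonpos hℓ h))
        rw [solitonRoot_neg hκ hc] at this
        rw [abs_of_nonpos (by linarith)]; ring
      · rw [abs_of_nonneg (solitonRoot_nonneg hκ hc (overshoot_nonneg hℓ (not_le.1 h).le)), one_mul]
    rw [e1, e2, mul_left_comm (ite _ _ _), e3]
    field_simp
    ring
  · rw [hi, overshoot_of_mem (by linarith) hℓ, intensityProfile_zero hκ hc]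

theorem momentum_darkSoliton (hκ : κ ≤ 0) (hc0 : 0 < c) (hc : c ^ 2 < 2) :
    momentum (darkSoliton c κ) = profileMomentum κ c := by
  rw [darkSoliton_eq_plateauSoliton hc0.ne', momentum_plateauSoliton hκ hc0 hc le_rfl]
  ring

/-- Equipartition: the dark and the black solitons both have energy density `η² / 2`, which reduces
their energies to one integral. -/
theorem energy_eq_half_integral {u : ℝ → ℂ} (hu : u ∈ energySpace)
    (h : ∀ᵐ x, energyDensity κ u x = 1 / 2 * intensityProfile c κ x ^ 2)
    (hκ : κ ≤ 0) (hc : c ^ 2 < 2) : energy κ u = profileEnergy κ c := by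
  rw [energy_eq_integral κ hu, integral_congr_ae h, integral_const_mul,
    (integral_sq_intensityProfile hκ hc).2]
  ring

theorem energy_darkSoliton_of_pos (hκ : κ ≤ 0) (hc0 : 0 < c) (hc : c ^ 2 < 2) :
    energy κ (darkSoliton c κ) = profileEnergy κ c := by
  rw [darkSoliton_eq_plateauSoliton hc0.ne']
  obtain ⟨h1, h2⟩ := plateauSoliton_facts hκ hc0 hc le_rfl
  refine energy_eq_half_integral h1 ?_ hκ hc
  filter_upwards [h2, slopes_plateauSoliton hκ hc0 hc le_rfl] with x hx hs
  rw [energyDensity, hs.1, hx, norm_mul, mul_pow, norm_plateauSoliton_sq hκ hc0 hc,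
    intensity_plateauSoliton hκ hc0 hc, overshoot_zero, sq_norm_solitonLogDeriv_mul hκ hc0 hc]
  have hN : 0 < 1 - intensityProfile c κ x := by
    linarith [intensityProfile_lt_one hκ hc0 hc x]
  have hw := weight_pos hκ c (solitonRoot c κ x)
  have hw2 := weight_sq hκ c (solitonRoot c κ x)
  have hr := two_mul_one_sub_intensityProfile hκ hc x
  set N := intensityProfile c κ x
  set W := weight c κ (solitonRoot c κ x)
  set T := solitonRoot c κ x
  have e1 : T ^ 2 = 2 * (1 - N) - c ^ 2 := by linarith
  have e2 : W ^ 2 = 1 - κ * (2 * (1 - N)) := by rw [hw2, hr]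
  field_simp
  rw [e1, e2]
  ring

theorem blackSoliton_eq (hκ : κ ≤ 0) (x : ℝ) :
    blackSoliton κ x = ((solitonRoot 0 κ x / √2 : ℝ) : ℂ) := by
  have hc : (0 : ℝ) ^ 2 < 2 := by norm_num
  have h2 := two_mul_one_sub_intensityProfile hκ hc x
  have e : √(1 - intensityProfile 0 κ x) = |solitonRoot 0 κ x| / √2 := by
    rw [← Real.sqrt_sq_eq_abs, ← Real.sqrt_div (sq_nonneg _)]
    congr 1; linarith
  rw [blackSoliton, e]
  congr 1
  rcases lt_trichotomy x 0 with h | h | h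
  · have := solitonRoot_nonneg hκ hc (neg_nonneg.2 h.le)
    rw [solitonRoot_neg hκ hc] at this
    rw [Real.sign_of_neg h, abs_of_nonpos (by linarith)]; ring
  · rw [h, solitonRoot_zero hκ hc]; simp
  · rw [Real.sign_of_pos h, abs_of_nonneg (solitonRoot_nonneg hκ hc h.le)]; ring

theorem blackSoliton_facts (hκ : κ ≤ 0) :
    blackSoliton κ ∈ energySpace ∧ energy κ (blackSoliton κ) = profileEnergy κ 0 := by
  have hc : (0 : ℝ) ^ 2 < 2 := by norm_num
  have hN : ∀ x, 2 * intensityProfile 0 κ x = 2 - solitonRoot 0 κ x ^ 2 := fun x => by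
    rw [intensityProfile_eq hκ hc]; ring
  have h2 : √2 ^ 2 = (2 : ℝ) := Real.sq_sqrt (by norm_num)
  have h20 : (0 : ℝ) < √2 := by positivity
  have hi : ∀ x, intensity (blackSoliton κ) x = intensityProfile 0 κ x := fun x => by
    rw [intensity, blackSoliton_eq hκ, Complex.norm_real, Real.norm_eq_abs, sq_abs, div_pow, h2]
    linarith [hN x]
  have hd : ∀ x, HasDerivAt (blackSoliton κ) ((intensityProfile 0 κ x /
      (√2 * weight 0 κ (solitonRoot 0 κ x)) : ℝ) : ℂ) x := fun x => by
    have h := ((hasDerivAt_solitonRoot hκ hc x).div_const √2).ofReal_comp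
    rw [show blackSoliton κ = fun x => ((solitonRoot 0 κ x / √2 : ℝ) : ℂ) from
      funext (blackSoliton_eq hκ)]
    refine h.congr_deriv ?_
    congr 1
    have hw := weight_pos hκ 0 (solitonRoot 0 κ x)
    have := hN x
    rw [show (2 : ℝ) - 0 ^ 2 - solitonRoot 0 κ x ^ 2 = 2 * intensityProfile 0 κ x by
      rw [this]; ring]
    field_simp
  have hT := continuous_solitonRoot hκ hc
  have hcont : Continuous fun x => ((intensityProfile 0 κ x /
      (√2 * weight 0 κ (solitonRoot 0 κ x)) : ℝ) : ℂ) := by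
    refine Complex.continuous_ofReal.comp ((continuous_intensityProfile hκ hc).div
      (((continuous_weight 0 κ).comp hT).const_mul _) fun x => ?_)
    have := weight_pos hκ 0 (solitonRoot 0 κ x)
    exact (by positivity : √2 * weight 0 κ (solitonRoot 0 κ x) ≠ 0)
  have hm : MemLp (intensityProfile 0 κ) 2 volume := by
    rw [memLp_two_iff_integrable_sq (continuous_intensityProfile hκ hc).aestronglyMeasurable]
    exact (integral_sq_intensityProfile hκ hc).1
  obtain ⟨k1, k2⟩ := mem_energySpace_of_hasDerivAt hd hcont (hm.of_le hcont.aestronglyMeasurable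
    (Eventually.of_forall fun x => by
      rw [Complex.norm_real, norm_div]
      have hw := one_le_weight hκ 0 (solitonRoot 0 κ x)
      have : 1 ≤ ‖√2 * weight 0 κ (solitonRoot 0 κ x)‖ := by
        have h1 : (1 : ℝ) ≤ √2 := Real.one_le_sqrt.2 (by norm_num)
        rw [Real.norm_of_nonneg (by positivity)]
        nlinarith
      exact div_le_self (norm_nonneg _) this)) (by rwa [show intensity (blackSoliton κ) = _ from
        funext hi])
  refine ⟨k1, energy_eq_half_integral k1 (k2.mono fun x hx => ?_) hκ hc⟩
  have hw := weight_pos hκ 0 (solitonRoot 0 κ x)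
  have hw2 := weight_sq hκ 0 (solitonRoot 0 κ x)
  have hr := hN x
  rw [energyDensity, radialSlope, hx, hi, blackSoliton_eq hκ, Complex.norm_real,
    Real.norm_eq_abs, sq_abs, Complex.inner, Complex.conj_ofReal, ← Complex.ofReal_mul,
    Complex.ofReal_re]
  set N := intensityProfile 0 κ x
  set W := weight 0 κ (solitonRoot 0 κ x)
  set T := solitonRoot 0 κ x
  have e1 : T ^ 2 = 2 - 2 * N := by linarith
  have e2 : W ^ 2 = 1 - κ * (2 - 2 * N) := by rw [hw2, e1]; ring
  field_simp
  have h4 : √2 ^ 4 = (4 : ℝ) := by rw [show 4 = 2 * 2 from rfl, pow_mul, h2]; norm_num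
  rw [e1, h2, e2]
  ring_nf
  rw [h4]
  ring

theorem darkSoliton_zero (κ : ℝ) : darkSoliton 0 κ = blackSoliton κ := by
  funext x; simp [darkSoliton]

theorem energy_darkSoliton (hκ : κ ≤ 0) (hc0 : 0 ≤ c) (hc : c ^ 2 < 2) :
    energy κ (darkSoliton c κ) = profileEnergy κ c := by
  rcases hc0.eq_or_lt with rfl | h
  · rw [darkSoliton_zero]; exact (blackSoliton_facts hκ).2
  · exact energy_darkSoliton_of_pos hκ h hc

/-- The soliton itself, as an equality case, evaluates the total calibration without computing its
integral. -/
theorem two_mul_calibration_eq (hκ : κ ≤ 0) (hc0 : 0 < c) (hc : c ^ 2 < 2) :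
    2 * calibration c κ (1 - c ^ 2 / 2) = profileEnergy κ c - c * profileMomentum κ c := by
  rw [← energy_sub_plateauSoliton hκ hc0 hc le_rfl, ← darkSoliton_eq_plateauSoliton hc0.ne',
    momentum_darkSoliton hκ hc0 hc, energy_darkSoliton hκ hc0.le hc]

end Soliton

/-! ### Lower bounds by the tangents to the soliton curve. -/

section Bounds

variable {κ : ℝ} {u v : ℝ → ℂ}

/-- The speed is `√2` times the modulus at `x₀`, in applications the minimal modulus. -/
theorem exists_speed_of_max (hu : u ∈ nonvanishingSpace) {x₀ : ℝ} (h0 : 0 < intensity u x₀) :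
    ∃ c, 0 < c ∧ c < √2 ∧ intensity u x₀ = 1 - c ^ 2 / 2 := by
  have h1 := intensity_lt_one hu x₀
  refine ⟨√(2 - 2 * intensity u x₀), Real.sqrt_pos.2 (by linarith),
    Real.sqrt_lt_sqrt (by linarith) (by linarith), ?_⟩
  rw [Real.sq_sqrt (by linarith)]
  ring

/-- The calibration identity without its nonnegative defect: the energy of `u` lies above the
tangent to the soliton curve at the speed attached to `u`. -/
theorem tangent_le_energy (hκ : κ ≤ 0) (hu : u ∈ nonvanishingSpace) {c : ℝ} (hc0 : 0 < c)
    (hc : c < √2) {x₀ : ℝ} (hx₀ : intensity u x₀ = 1 - c ^ 2 / 2)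
    (hmax : ∀ x, intensity u x ≤ intensity u x₀) :
    profileEnergy κ c - c * profileMomentum κ c + c * momentum u ≤ energy κ u := by
  have h := (energy_sub_momentum_eq hκ hc0 hu (fun x => (hmax x).trans hx₀.le) hx₀).2
  rw [two_mul_calibration_eq hκ hc0 (sq_lt_two_of_lt hc0.le hc)] at h
  have : 0 ≤ ∫ x, defect c κ x₀ u x := integral_nonneg (defect_nonneg c κ x₀ u)
  linarith

theorem sqrt_two_mul_le_or_exists_tangent (hκ : κ ≤ 0) (hu : u ∈ nonvanishingSpace) :
    √2 * momentum u ≤ energy κ u ∨ ∃ c, 0 < c ∧ c < √2 ∧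
      profileEnergy κ c - c * profileMomentum κ c + c * momentum u ≤ energy κ u := by
  by_cases h : ∃ y, 0 < intensity u y
  · obtain ⟨y, hy⟩ := h
    obtain ⟨x₀, h0, hmax⟩ := exists_max_intensity hu.1 hy
    obtain ⟨c, hc0, hc, hx₀⟩ := exists_speed_of_max hu h0
    exact Or.inr ⟨c, hc0, hc, tangent_le_energy hκ hu hc0 hc hx₀ hmax⟩
  · push Not at h
    exact Or.inl (sqrt_two_mul_momentum_le_energy hκ hu h)

theorem tendsto_tangent_zero (hκ : κ ≤ 0) (q : ℝ) :
    Tendsto (fun c => profileEnergy κ c - c * profileMomentum κ c + c * q) (𝓝[>] 0)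
      (𝓝 (profileEnergy κ 0)) := by
  obtain ⟨c₀, hb⟩ := exists_solitonBranch hκ
  have := (hb.hasDerivAt_tangent q le_rfl (by positivity)).continuousAt.tendsto
  simp only [zero_mul, sub_zero, add_zero] at this
  exact this.mono_left nhdsWithin_le_nhds

/-- At a zero the intensity is `1`, above the level `1 - c² / 2` of every speed. The total
calibrations thus bound the energy from below, and they converge to the energy of the black soliton
as `c → 0`. -/
theorem profileEnergy_zero_le_of_eq_zero (hκ : κ ≤ 0) (hv : v ∈ energySpace) {x₀ : ℝ}
    (h0 : v x₀ = 0) : profileEnergy κ 0 ≤ energy κ v := by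
  refine le_of_tendsto (tendsto_tangent_zero hκ 0) ?_
  filter_upwards [Ioo_mem_nhdsGT (show (0 : ℝ) < √2 by positivity)] with c hc
  rw [mul_zero, add_zero, ← two_mul_calibration_eq hκ hc.1 (sq_lt_two_of_lt hc.1.le hc.2)]
  refine two_mul_calibration_le_energy hκ hc.1 hv (x₀ := x₀) ?_
  rw [intensity, h0]
  simp
  positivity

theorem iInf_norm_pos_of_energy_lt (hκ : κ ≤ 0) (hv : v ∈ energySpace)
    (h : energy κ v < profileEnergy κ 0) : 0 < ⨅ x, ‖v x‖ :=
  (mem_nonvanishingSpace hv fun _ h0 =>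
    h.not_ge (profileEnergy_zero_le_of_eq_zero hκ hv h0)).2

theorem not_iInf_norm_blackSoliton_pos (hκ : κ ≤ 0) : ¬ 0 < ⨅ x, ‖blackSoliton κ x‖ := by
  intro h
  refine nonvanishingSpace_ne_zero ⟨(blackSoliton_facts hκ).1, h⟩ 0 ?_
  simp [blackSoliton]

theorem bddBelow_energy (hκ : κ ≤ 0) (q : ℝ) : BddBelow (energy κ '' admissible q) :=
  ⟨0, by rintro _ ⟨u, hu, rfl⟩; exact energy_nonneg hκ hu.1.1⟩

end Bounds

/-! ### The minimization curve, the critical speed and the critical momentum. -/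

section Minimum

variable {κ cs : ℝ}

theorem le_energy_of_momentum_eq (hκ : κ ≤ 0)
    (hcs : SolitonBranch.IsCritical (profileEnergy κ) (profileMomentum κ) √2 cs) {c : ℝ} (hc : c ∈ Ioo cs √2)
    {u : ℝ → ℂ} (hu : u ∈ admissible (profileMomentum κ c)) : profileEnergy κ c ≤ energy κ u := by
  rcases sqrt_two_mul_le_or_exists_tangent hκ hu.1 with h | ⟨d, hd0, hd, h⟩
  · rw [hu.2] at h
    exact (hcs.energy_lt_mul c ⟨hc.1.le, hc.2⟩).le.trans h
  · rw [hu.2] at h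
    rcases eq_or_ne d c with rfl | hne
    · linarith
    · exact (hcs.tangent_lt c hc d ⟨hd0.le, hd⟩ hne).le.trans h

theorem darkSoliton_mem_admissible (hκ : κ ≤ 0) {c : ℝ} (hc0 : 0 < c) (hc : c < √2) :
    darkSoliton c κ ∈ admissible (profileMomentum κ c) := by
  have h2 := sq_lt_two_of_lt hc0.le hc
  refine ⟨?_, momentum_darkSoliton hκ hc0 h2⟩
  rw [darkSoliton_eq_plateauSoliton hc0.ne']
  exact plateauSoliton_mem hκ hc0 h2 le_rfl

theorem minEnergy_profileMomentum (hκ : κ ≤ 0)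
    (hcs : SolitonBranch.IsCritical (profileEnergy κ) (profileMomentum κ) √2 cs) {c : ℝ} (hc : c ∈ Ioo cs √2) :
    minEnergy κ (profileMomentum κ c) = profileEnergy κ c := by
  have hc0 : 0 < c := hcs.nonneg.trans_lt hc.1
  have hm := darkSoliton_mem_admissible hκ hc0 hc.2
  refine le_antisymm ?_ (le_csInf ⟨_, _, hm, rfl⟩ ?_)
  · rw [← energy_darkSoliton hκ hc0.le (sq_lt_two_of_lt hc0.le hc.2)]
    exact csInf_le (bddBelow_energy hκ _) ⟨_, hm, rfl⟩
  · rintro _ ⟨u, hu, rfl⟩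
    exact le_energy_of_momentum_eq hκ hcs hc hu

/-- At momentum `p cs` all tangents have height at least `E 0`, and their slopes `d` are positive,
so beyond it they lie strictly above `E 0`. The alternative bound is strict by `energy_lt_mul`. -/
theorem le_energy_of_le_momentum (hκ : κ ≤ 0)
    (hcs : SolitonBranch.IsCritical (profileEnergy κ) (profileMomentum κ) √2 cs)
    {u : ℝ → ℂ} (hu : u ∈ nonvanishingSpace) (hq : profileMomentum κ cs ≤ momentum u) :
    profileEnergy κ 0 ≤ energy κ u ∧
      (profileMomentum κ cs < momentum u → profileEnergy κ 0 < energy κ u) := by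
  rcases sqrt_two_mul_le_or_exists_tangent hκ hu with h | ⟨d, hd0, hd, h⟩
  · have h1 := hcs.energy_lt_mul cs ⟨le_rfl, hcs.lt⟩
    rw [hcs.energy_eq] at h1
    have : √2 * profileMomentum κ cs ≤ √2 * momentum u := by gcongr
    exact ⟨by linarith, fun _ => by linarith⟩
  · have h1 := hcs.le_tangent d ⟨hd0.le, hd⟩
    refine ⟨by nlinarith, fun hlt => by nlinarith⟩

/-- The infimum is approached by plateau solitons of speed `c → 0` with momentum `q`: having no
defect, their energy is the tangent function at `c`, which tends to `E 0`. -/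
theorem minEnergy_of_le (hκ : κ ≤ 0)
    (hcs : SolitonBranch.IsCritical (profileEnergy κ) (profileMomentum κ) √2 cs) {q : ℝ}
    (hq : profileMomentum κ cs ≤ q) : minEnergy κ q = profileEnergy κ 0 := by
  have key : ∀ ε > 0, ∃ u ∈ admissible q, energy κ u < profileEnergy κ 0 + ε := by
    intro ε hε
    have h := (tendsto_tangent_zero hκ q).eventually
      (gt_mem_nhds (lt_add_of_pos_right (profileEnergy κ 0) hε))
    obtain ⟨δ, hδ, hδ'⟩ := mem_nhdsGT_iff_exists_Ioo_subset.1 h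
    obtain ⟨c, hc0, hcδ, hc, hp⟩ := hcs.exists_small δ hδ
    have h2 := sq_lt_two_of_lt hc0.le hc
    have hpos : 0 < c / 4 * ((1 - c ^ 2 / 2) ^ 2 / (c ^ 2 / 2)) := by
      have : 0 < 1 - c ^ 2 / 2 := by linarith
      positivity
    set k := c / 4 * ((1 - c ^ 2 / 2) ^ 2 / (c ^ 2 / 2)) with hk
    -- The half-length that raises the momentum from `p c` to `q`; it is nonnegative because `p c ≤
    -- p cs ≤ q`.
    have hℓ : 0 ≤ (q - profileMomentum κ c) / (2 * k) :=
      div_nonneg (by linarith) (by linarith)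
    have hm : momentum (plateauSoliton c κ ((q - profileMomentum κ c) / (2 * k))) = q := by
      rw [momentum_plateauSoliton hκ hc0 h2 hℓ, ← hk]
      field_simp
      ring
    refine ⟨_, ⟨plateauSoliton_mem hκ hc0 h2 hℓ, hm⟩, ?_⟩
    have he := energy_sub_plateauSoliton hκ hc0 h2 hℓ
    rw [hm, two_mul_calibration_eq hκ hc0 h2] at he
    have := hδ' (show c ∈ Ioo 0 δ from ⟨hc0, hcδ⟩)
    simp only [mem_ofPred_eq] at this
    linarith
  -- Only the existence of a competitor matters here: the infimum of an empty set would be the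
  -- default value `0`.
  obtain ⟨u, hu, -⟩ := key 1 one_pos
  refine le_antisymm (le_of_forall_pos_lt_add fun ε hε => ?_) (le_csInf ⟨_, u, hu, rfl⟩ ?_)
  · obtain ⟨w, hw, hlt⟩ := key ε hε
    exact (csInf_le (bddBelow_energy hκ _) ⟨w, hw, rfl⟩).trans_lt hlt
  · rintro _ ⟨w, hw, rfl⟩
    exact (le_energy_of_le_momentum hκ hcs hw.1 (by rwa [hw.2])).1

theorem minimizers_eq_empty (hκ : κ ≤ 0)
    (hcs : SolitonBranch.IsCritical (profileEnergy κ) (profileMomentum κ) √2 cs) {q : ℝ}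
    (hq : profileMomentum κ cs < q) : minimizers κ q = ∅ := by
  refine eq_empty_iff_forall_notMem.2 fun u hu => ?_
  have h1 := hu.2
  rw [minEnergy_of_le hκ hcs hq.le] at h1
  have := (le_energy_of_le_momentum hκ hcs hu.1.1 (by rw [hu.1.2]; exact hq.le)).2
    (by rwa [hu.1.2])
  linarith

theorem profileMomentum_pos (hκ : κ ≤ 0)
    (hcs : SolitonBranch.IsCritical (profileEnergy κ) (profileMomentum κ) √2 cs) :
    0 < profileMomentum κ cs := by
  have h1 := hcs.energy_lt_mul cs ⟨le_rfl, hcs.lt⟩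
  have h2 := profileEnergy_pos hκ (sq_lt_two_of_lt hcs.nonneg hcs.lt)
  have h3 : 0 < √2 * profileMomentum κ cs := h2.trans h1
  exact (pos_iff_pos_of_mul_pos h3).1 (by positivity)

theorem minEnergy_lt (hκ : κ ≤ 0)
    (hcs : SolitonBranch.IsCritical (profileEnergy κ) (profileMomentum κ) √2 cs) {q : ℝ}
    (hq0 : 0 < q) (hq : q < profileMomentum κ cs) : minEnergy κ q < profileEnergy κ 0 := by
  obtain ⟨c, hc, rfl⟩ := hcs.bijOn.surjOn ⟨hq0, hq⟩
  rw [minEnergy_profileMomentum hκ hcs hc]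
  exact hcs.energy_lt c hc.1 hc.2

/-- From `p cs` on, the black soliton has energy `minEnergy κ q` and a zero, so the defining
condition fails. Below, `minEnergy κ q` is less than the energy of any map with a zero. -/
theorem criticalMomentum_eq (hκ : κ ≤ 0)
    (hcs : SolitonBranch.IsCritical (profileEnergy κ) (profileMomentum κ) √2 cs) :
    criticalMomentum κ = profileMomentum κ cs := by
  have : {q : ℝ | 0 < q ∧ ∀ v ∈ energySpace, energy κ v ≤ minEnergy κ q → 0 < ⨅ x, ‖v x‖} =
      Ioo 0 (profileMomentum κ cs) := by
    ext q
    refine ⟨fun hq => ⟨hq.1, ?_⟩, fun hq => ⟨hq.1, fun v hv hE => ?_⟩⟩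
    · by_contra! hle
      obtain ⟨h1, h2⟩ := blackSoliton_facts hκ
      exact not_iInf_norm_blackSoliton_pos hκ
        (hq.2 _ h1 (by rw [h2, minEnergy_of_le hκ hcs hle]))
    · exact iInf_norm_pos_of_energy_lt hκ hv (hE.trans_lt (minEnergy_lt hκ hcs hq.1 hq.2))
  rw [criticalMomentum, this, csSup_Ioo (profileMomentum_pos hκ hcs)]

theorem isGreatest_blackEnergySpeeds (hκ : κ ≤ 0)
    (hcs : SolitonBranch.IsCritical (profileEnergy κ) (profileMomentum κ) √2 cs) :
    IsGreatest (blackEnergySpeeds κ) cs := by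
  have h0 : energy κ (darkSoliton 0 κ) = profileEnergy κ 0 :=
    energy_darkSoliton hκ le_rfl (by norm_num)
  constructor
  · refine ⟨hcs.nonneg, hcs.lt, ?_⟩
    rw [energy_darkSoliton hκ hcs.nonneg (sq_lt_two_of_lt hcs.nonneg hcs.lt), h0, hcs.energy_eq]
  · rintro c ⟨hc0, hc, hE⟩
    rw [energy_darkSoliton hκ hc0 (sq_lt_two_of_lt hc0 hc), h0] at hE
    by_contra! hlt
    exact (hcs.energy_lt c hlt hc).ne hE

theorem criticalSpeed_eq (hκ : κ ≤ 0)
    (hcs : SolitonBranch.IsCritical (profileEnergy κ) (profileMomentum κ) √2 cs) : criticalSpeed κ = cs :=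
  (isGreatest_blackEnergySpeeds hκ hcs).csSup_eq

theorem eqOn_solitonMomentum (hκ : κ ≤ 0)
    (hcs : SolitonBranch.IsCritical (profileEnergy κ) (profileMomentum κ) √2 cs) :
    EqOn (profileMomentum κ) (solitonMomentum κ) (Ioo cs √2) := fun c hc => by
  have hc0 : 0 < c := hcs.nonneg.trans_lt hc.1
  exact (momentum_darkSoliton hκ hc0 (sq_lt_two_of_lt hc0.le hc.2)).symm

theorem speedOfMomentum_spec (hκ : κ ≤ 0)
    (hcs : SolitonBranch.IsCritical (profileEnergy κ) (profileMomentum κ) √2 cs) {q : ℝ}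
    (hq : q ∈ Ioo 0 (profileMomentum κ cs)) :
    speedOfMomentum κ q ∈ Ioo cs √2 ∧ profileMomentum κ (speedOfMomentum κ q) = q := by
  have h : ∃ c ∈ Ioo (criticalSpeed κ) √2, solitonMomentum κ c = q := by
    rw [criticalSpeed_eq hκ hcs]
    exact (hcs.bijOn.congr (eqOn_solitonMomentum hκ hcs)).surjOn hq
  have h1 := Function.invFunOn_mem h
  have h2 := Function.invFunOn_eq h
  rw [criticalSpeed_eq hκ hcs] at h1
  have h3 : speedOfMomentum κ q ∈ Ioo cs √2 := by
    unfold speedOfMomentum; rw [criticalSpeed_eq hκ hcs] at *; exact h1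
  refine ⟨h3, ?_⟩
  rw [eqOn_solitonMomentum hκ hcs h3]
  exact h2

/-- The strict tangent inequality gives `E c < E d - d (p d - p c)`, and the subtracted term is
positive when `p c < p d`. -/
theorem strictMonoOn_minEnergy (hκ : κ ≤ 0)
    (hcs : SolitonBranch.IsCritical (profileEnergy κ) (profileMomentum κ) √2 cs) :
    StrictMonoOn (minEnergy κ) (Ioo 0 (profileMomentum κ cs)) := by
  intro q hq r hr hqr
  obtain ⟨c, hc, rfl⟩ := hcs.bijOn.surjOn hq
  obtain ⟨d, hd, rfl⟩ := hcs.bijOn.surjOn hr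
  rw [minEnergy_profileMomentum hκ hcs hc, minEnergy_profileMomentum hκ hcs hd]
  have hd0 : 0 < d := hcs.nonneg.trans_lt hd.1
  have := hcs.tangent_lt c hc d ⟨hd0.le, hd.2⟩ (by rintro rfl; exact hqr.ne rfl)
  nlinarith

end Minimum

/-! ### Convergence tools: Fatou, dominated convergence, Arzelà–Ascoli. -/

section Analysis

theorem sq_integral_mul_le {f g : ℝ → ℝ} (hf : MemLp f 2 volume) (hg : MemLp g 2 volume) :
    (∫ x, f x * g x) ^ 2 ≤ (∫ x, f x ^ 2) * ∫ x, g x ^ 2 := by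
  have hfg : Integrable (fun x => f x * g x) := hf.integrable_mul hg
  have h : ∀ t : ℝ, 0 ≤ (∫ x, g x ^ 2) * (t * t) + (2 * ∫ x, f x * g x) * t + ∫ x, f x ^ 2 := by
    intro t
    have h0 : 0 ≤ ∫ x, (f x + t * g x) ^ 2 := integral_nonneg fun x => sq_nonneg _
    have e : ∀ x, (f x + t * g x) ^ 2 = f x ^ 2 + 2 * t * (f x * g x) + t ^ 2 * g x ^ 2 :=
      fun x => by ring
    simp only [e] at h0
    have i1 : Integrable (fun x => f x ^ 2 + 2 * t * (f x * g x)) :=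
      hf.integrable_sq.add (hfg.const_mul _)
    rw [integral_add i1 (hg.integrable_sq.const_mul _),
      integral_add hf.integrable_sq (hfg.const_mul _), integral_const_mul,
      integral_const_mul] at h0
    linarith
  have := discrim_le_zero h
  rw [discrim] at this
  linarith

theorem lintegral_le_liminf_of_tendsto {f : ℕ → ℝ → ℝ} {g : ℝ → ℝ} (h0 : ∀ n x, 0 ≤ f n x)
    (hi : ∀ n, Integrable (f n)) (ht : ∀ x, Tendsto (fun n => f n x) atTop (𝓝 (g x))) :
    ∫⁻ x, ENNReal.ofReal (g x) ≤ liminf (fun n => ENNReal.ofReal (∫ x, f n x)) atTop := by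
  have e : ∀ x, ENNReal.ofReal (g x) = liminf (fun n => ENNReal.ofReal (f n x)) atTop := fun x =>
    ((ENNReal.continuous_ofReal.tendsto _).comp (ht x)).liminf_eq.symm
  simp only [e]
  refine (lintegral_liminf_le' fun n => (hi n).1.aemeasurable.ennreal_ofReal).trans ?_
  refine le_of_eq (congrArg (fun a => liminf a atTop) (funext fun n => ?_))
  rw [ofReal_integral_eq_lintegral_ofReal (hi n) (Eventually.of_forall (h0 n))]

/-- Dominated convergence with a convergent sequence of dominating functions. -/
theorem tendsto_integral_zero_of_le {f g : ℕ → ℝ → ℝ} {G : ℝ → ℝ} (h0 : ∀ n x, 0 ≤ f n x)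
    (hle : ∀ n x, f n x ≤ g n x) (hf : ∀ n, Integrable (f n)) (hg : ∀ n, Integrable (g n))
    (hG : Integrable G) (htf : ∀ x, Tendsto (fun n => f n x) atTop (𝓝 0))
    (htg : ∀ x, Tendsto (fun n => g n x) atTop (𝓝 (G x)))
    (hint : Tendsto (fun n => ∫ x, g n x) atTop (𝓝 (∫ x, G x))) :
    Tendsto (fun n => ∫ x, f n x) atTop (𝓝 0) := by
  have hG0 : ∀ x, 0 ≤ G x := fun x =>
    ge_of_tendsto' (htg x) fun n => (h0 n x).trans (hle n x)
  -- Fatou's lemma for `g n - f n`, whose pointwise limit is `G`: since `∫ g n` tends to `∫ G`, no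
  -- mass remains for `f n`.
  have h1 := lintegral_le_liminf_of_tendsto (f := fun n x => g n x - f n x) (g := G)
    (fun n x => sub_nonneg.2 (hle n x)) (fun n => (hg n).sub (hf n))
    (fun x => by simpa using (htg x).sub (htf x))
  rw [← ofReal_integral_eq_lintegral_ofReal hG (Eventually.of_forall hG0)] at h1
  have hpos : ∀ n, 0 ≤ ∫ x, (g n x - f n x) := fun n =>
    integral_nonneg fun x => sub_nonneg.2 (hle n x)
  have key : ∀ ε > 0, ∀ᶠ n in atTop, (∫ x, G x) - ε < ∫ x, (g n x - f n x) := by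
    intro ε hε
    by_cases hs : 0 < ∫ x, G x
    · have h2 : ENNReal.ofReal ((∫ x, G x) - ε) < ENNReal.ofReal (∫ x, G x) :=
        (ENNReal.ofReal_lt_ofReal_iff hs).2 (by linarith)
      filter_upwards [eventually_lt_of_lt_liminf (h2.trans_le h1)] with n hn
      exact (ENNReal.ofReal_lt_ofReal_iff'.1 hn).1
    · filter_upwards with n
      linarith [hpos n]
  rw [Metric.tendsto_atTop']
  intro ε hε
  have h3 := (key (ε / 2) (by linarith)).and (hint.eventually (gt_mem_nhds
    (show ∫ x, G x < (∫ x, G x) + ε / 2 by linarith)))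
  obtain ⟨N, hN⟩ := eventually_atTop.1 h3
  refine ⟨N, fun n hn => ?_⟩
  obtain ⟨h4, h5⟩ := hN n hn.le
  rw [integral_sub (hg n) (hf n)] at h4
  rw [Real.dist_0_eq_abs, abs_of_nonneg (integral_nonneg (h0 n))]
  linarith

/-- Fatou's lemma gives `∫ g ≤ lim ∫ f n = ∫ G`, and `G ≤ g` then forces equality. It serves to
exclude plateaus in the limit. -/
theorem eq_of_le_of_tendsto_integral {f : ℕ → ℝ → ℝ} {g G : ℝ → ℝ} (h0 : ∀ n x, 0 ≤ f n x)
    (hi : ∀ n, Integrable (f n)) (ht : ∀ x, Tendsto (fun n => f n x) atTop (𝓝 (g x)))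
    (hG : Integrable G) (hle : ∀ x, G x ≤ g x) (hG0 : ∀ x, 0 ≤ G x)
    (hint : Tendsto (fun n => ∫ x, f n x) atTop (𝓝 (∫ x, G x))) (hgc : Continuous g)
    (hGc : Continuous G) : G = g := by
  have h1 := lintegral_le_liminf_of_tendsto h0 hi ht
  rw [show liminf (fun n => ENNReal.ofReal (∫ x, f n x)) atTop = _ from
      ((ENNReal.continuous_ofReal.tendsto _).comp hint).liminf_eq,
    ofReal_integral_eq_lintegral_ofReal hG (Eventually.of_forall hG0)] at h1
  have h2 : ∫⁻ x, ENNReal.ofReal (G x) ≠ ⊤ := by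
    rw [← ofReal_integral_eq_lintegral_ofReal hG (Eventually.of_forall hG0)]
    exact ENNReal.ofReal_ne_top
  have h3 := ae_eq_of_ae_le_of_lintegral_le (μ := volume)
    (Eventually.of_forall fun x => ENNReal.ofReal_le_ofReal (hle x)) h2
    hgc.measurable.ennreal_ofReal.aemeasurable h1
  have h4 : G =ᵐ[volume] g := h3.mono fun x hx =>
    (ENNReal.ofReal_eq_ofReal_iff (hG0 x) ((hG0 x).trans (hle x))).1 hx
  exact (hGc.ae_eq_iff_eq volume hgc).1 h4

theorem tendsto_eLpNorm_zero {F : Type*} [NormedAddCommGroup F] {f : ℕ → ℝ → F}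
    (hf : ∀ n, MemLp (f n) 2 volume) (h : Tendsto (fun n => ∫ x, ‖f n x‖ ^ 2) atTop (𝓝 0)) :
    Tendsto (fun n => eLpNorm (f n) 2 volume) atTop (𝓝 0) := by
  have e : ∀ n, eLpNorm (f n) 2 volume = ENNReal.ofReal √(∫ x, ‖f n x‖ ^ 2) := fun n => by
    rw [(hf n).eLpNorm_eq_integral_rpow_norm (by norm_num) (by norm_num), Real.sqrt_eq_rpow]
    simp
  simp only [e]
  have := (ENNReal.continuous_ofReal.comp Real.continuous_sqrt).tendsto 0
  simp only [Function.comp, Real.sqrt_zero, ENNReal.ofReal_zero] at this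
  exact this.comp h

/-- Uniformly bounded and uniformly Hölder continuous functions converge locally uniformly along
a subsequence. -/
theorem exists_subseq_tendstoLocallyUniformly {u : ℕ → ℝ → ℂ} {C A : ℝ}
    (hC : ∀ n x, ‖u n x‖ ≤ C) (hA : ∀ n x y, ‖u n x - u n y‖ ^ 2 ≤ |x - y| * A) :
    ∃ (σ : ℕ → ℕ) (v : ℝ → ℂ), StrictMono σ ∧ Continuous v ∧
      TendstoLocallyUniformly (fun n => u (σ n)) v atTop := by
  have hcont : ∀ f : ℝ → ℂ, (∀ x y, ‖f x - f y‖ ^ 2 ≤ |x - y| * A) → Continuous f := by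
    intro f hf
    rw [continuous_iff_continuousAt]
    intro x
    rw [ContinuousAt, tendsto_iff_norm_sub_tendsto_zero]
    have h1 : Tendsto (fun y => √(|y - x| * A)) (𝓝 x) (𝓝 0) := by
      have : Continuous fun y => √(|y - x| * A) := by fun_prop
      simpa using this.tendsto x
    exact squeeze_zero (fun y => norm_nonneg _) (fun y => Real.le_sqrt_of_sq_le (hf y x)) h1
  set S : Set C(ℝ, ℂ) := {f | (∀ x, ‖f x‖ ≤ C) ∧ ∀ x y, ‖f x - f y‖ ^ 2 ≤ |x - y| * A} with hS
  -- Arzelà–Ascoli asks for compactness in the topology of pointwise convergence: the set is a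
  -- product of closed balls cut by a closed condition, which already implies continuity.
  have himg : ContinuousMap.toFun '' S = (univ.pi fun _ => Metric.closedBall (0 : ℂ) C) ∩
      {f | ∀ x y, ‖f x - f y‖ ^ 2 ≤ |x - y| * A} := by
    ext f
    constructor
    · rintro ⟨g, hg, rfl⟩
      exact ⟨fun x _ => by simpa using hg.1 x, hg.2⟩
    · rintro ⟨h1, h2⟩
      exact ⟨⟨f, hcont f h2⟩, ⟨fun x => by simpa using h1 x (mem_univ x), h2⟩, rfl⟩
  have hcl : IsClosed {f : ℝ → ℂ | ∀ x y, ‖f x - f y‖ ^ 2 ≤ |x - y| * A} := by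
    simp only [ofPred_forall]
    refine isClosed_iInter fun x => isClosed_iInter fun y => ?_
    exact isClosed_le (by fun_prop) continuous_const
  have hcomp : IsCompact S := by
    refine ArzelaAscoli.isCompact_of_equicontinuous S ?_ ?_
    · rw [himg]
      exact (isCompact_univ_pi fun _ => isCompact_closedBall _ _).inter_right hcl
    · intro x
      rw [Metric.equicontinuousAt_iff_right]
      intro ε hε
      have h1 : Tendsto (fun y => |x - y| * A) (𝓝 x) (𝓝 0) := by
        have : Continuous fun y => |x - y| * A := by fun_prop
        simpa using this.tendsto x
      filter_upwards [h1.eventually (gt_mem_nhds (show 0 < ε ^ 2 by positivity))] with y hy f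
      have := (f.2.2 x y).trans_lt hy
      rw [dist_eq_norm]
      exact lt_of_pow_lt_pow_left₀ 2 hε.le this
  obtain ⟨g, -, σ, hσ, hg⟩ := hcomp.tendsto_subseq
    (x := fun n => (⟨u n, hcont _ (hA n)⟩ : C(ℝ, ℂ))) fun n => ⟨hC n, hA n⟩
  exact ⟨σ, g, hσ, g.continuous, ContinuousMap.tendsto_iff_tendstoLocallyUniformly.1 hg⟩

end Analysis

/-! ### Invariance under translations and phase shifts. -/

section Transform

variable {u : ℝ → ℂ} {z : ℂ} {a : ℝ}

theorem transform_facts (hu : u ∈ energySpace) (hz : ‖z‖ = 1) (a : ℝ) :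
    (fun x => z * u (x + a)) ∈ energySpace ∧
      weakDeriv (fun x => z * u (x + a)) =ᵐ[volume] fun x => z * weakDeriv u (x + a) := by
  have hp := energySpace_isPrimitive hu
  have hmp := measurePreserving_add_right volume a
  have h1 : MemLp (fun x => z * weakDeriv u (x + a)) 2 volume :=
    ((energySpace_memLp_weakDeriv hu).comp_measurePreserving hmp).const_mul z
  have h2 : IsPrimitive (fun x => z * u (x + a)) (fun x => z * weakDeriv u (x + a)) := by
    refine ⟨h1.locallyIntegrable (by norm_num), fun x => ?_⟩
    rw [intervalIntegral.integral_const_mul, intervalIntegral.integral_comp_add_right,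
      ← hp.sub_eq]
    ring
  refine ⟨⟨h2.continuous, ⟨_, h2.hasWeakDeriv, h1⟩, ?_⟩, weakDeriv_ae_eq h2.hasWeakDeriv⟩
  have := (energySpace_memLp_intensity hu).comp_measurePreserving hmp
  simpa [intensity, Function.comp_def, hz] using this

theorem intensity_transform (u : ℝ → ℂ) (hz : ‖z‖ = 1) (a x : ℝ) :
    intensity (fun x => z * u (x + a)) x = intensity u (x + a) := by
  simp [intensity, hz]

theorem inner_mul_mul_of_norm_eq_one (hz : ‖z‖ = 1) (w w' : ℂ) :
    inner ℝ (z * w) (z * w') = inner ℝ w w' := by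
  have h : z.re * z.re + z.im * z.im = 1 := by
    rw [← Complex.normSq_apply, ← Complex.sq_norm, hz]; norm_num
  simp only [Complex.inner, Complex.mul_re, Complex.conj_re, Complex.conj_im, Complex.mul_im]
  linear_combination (w.re * w'.re + w.im * w'.im) * h

theorem energy_transform (κ : ℝ) (hu : u ∈ energySpace) (hz : ‖z‖ = 1) (a : ℝ) :
    energy κ (fun x => z * u (x + a)) = energy κ u := by
  obtain ⟨h1, h2⟩ := transform_facts hu hz a
  rw [energy_eq_integral κ h1, energy_eq_integral κ hu,
    ← integral_add_right_eq_self (energyDensity κ u) a]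
  refine integral_congr_ae (h2.mono fun x hx => ?_)
  simp only [energyDensity, radialSlope, hx, intensity_transform u hz,
    inner_mul_mul_of_norm_eq_one hz, norm_mul, hz, one_mul]

theorem momentum_transform (hu : u ∈ energySpace) (hz : ‖z‖ = 1) (a : ℝ) :
    momentum (fun x => z * u (x + a)) = momentum u := by
  obtain ⟨h1, h2⟩ := transform_facts hu hz a
  rw [momentum_eq_integral, momentum_eq_integral,
    ← integral_add_right_eq_self (momentumDensity u) a]
  refine integral_congr_ae (h2.mono fun x hx => ?_)
  simp only [momentumDensity, angularSlope, hx, mul_left_comm Complex.I,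
    inner_mul_mul_of_norm_eq_one hz, norm_mul, hz, one_mul]

theorem transform_mem (hu : u ∈ nonvanishingSpace) (hz : ‖z‖ = 1) (a : ℝ) :
    (fun x => z * u (x + a)) ∈ nonvanishingSpace :=
  mem_nonvanishingSpace (transform_facts hu.1 hz a).1 fun x =>
    mul_ne_zero (norm_pos_iff.1 (by rw [hz]; exact one_pos)) (nonvanishingSpace_ne_zero hu _)

end Transform

/-! ### Sequences with vanishing defect: their slopes approach a function of the intensity. -/

/-- The sign of `x`, with value `-1` at the origin. -/
noncomputable def side (x : ℝ) : ℝ := if x ≤ 0 then -1 else 1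

/-- The product of the derivative of `v` with the conjugate of `v`. -/
noncomputable def slope (v : ℝ → ℂ) (x : ℝ) : ℂ := ⟨radialSlope v x, - angularSlope v x⟩

/-- The slope in terms of the position and the intensity for solitons of speed `c`. -/
noncomputable def slopeModel (κ c x y : ℝ) : ℂ :=
  ⟨side x * (y * √(2 - c ^ 2 - 2 * y) / (2 * √(1 - 2 * κ * (1 - y)))), c * y / 2⟩

theorem side_sq (x : ℝ) : side x ^ 2 = 1 := by unfold side; split_ifs <;> norm_num

theorem measurable_side : Measurable side :=
  Measurable.ite measurableSet_Iic measurable_const measurable_const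

section Model

variable {κ c : ℝ} {v : ℝ → ℂ}

theorem weakDeriv_eq_slope_mul {x : ℝ} (hx : v x ≠ 0) :
    weakDeriv v x = slope v x * (v x / (‖v x‖ ^ 2 : ℝ)) := by
  have h : slope v x = weakDeriv v x * (starRingEnd ℂ) (v x) := by
    apply Complex.ext <;>
    simp only [slope, radialSlope, angularSlope, Complex.inner, Complex.mul_re, Complex.conj_re,
      Complex.conj_im, Complex.mul_im, Complex.I_re, Complex.I_im] <;> ring
  have h0 : (starRingEnd ℂ) (v x) ≠ 0 := by simpa using hx
  rw [h, ← Complex.normSq_eq_norm_sq, ← Complex.mul_conj]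
  field_simp

/-- The two squares in the defect are those of the imaginary and real parts of the difference, the
latter enlarged by a square root that is at least `1`. A small defect thus makes the slope L²-close
to the model. -/
theorem sq_norm_slope_sub_le (hκ : κ ≤ 0) {x : ℝ} (hx : v x ≠ 0) :
    ‖slope v x - slopeModel κ c x (intensity v x)‖ ^ 2 ≤ 2 * ‖v x‖ ^ 2 * defect c κ 0 v x := by
  have hρ : 0 < ‖v x‖ ^ 2 := by have := norm_pos_iff.2 hx; positivity
  have hr : 1 - intensity v x = ‖v x‖ ^ 2 := by rw [intensity]; ring
  have hb : 1 ≤ √(1 - 2 * κ * ‖v x‖ ^ 2) := Real.one_le_sqrt.2 (by nlinarith)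
  rw [slope, slopeModel, hr, Complex.sq_norm, Complex.normSq_apply, defect]
  simp only [Complex.sub_re, Complex.sub_im]
  rw [show (if x ≤ 0 then -1 else 1 : ℝ) = side x from rfl]
  set b := √(1 - 2 * κ * ‖v x‖ ^ 2)
  set t := √(2 - c ^ 2 - 2 * intensity v x)
  set η := intensity v x
  set α := radialSlope v x
  set β := angularSlope v x
  have e1 : 2 * ‖v x‖ ^ 2 * ((β + c / 2 * η) ^ 2 / (2 * ‖v x‖ ^ 2) +
      (2 * α * b - side x * (η * t)) ^ 2 / (8 * ‖v x‖ ^ 2)) = (β + c / 2 * η) ^ 2 +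
      (2 * α * b - side x * (η * t)) ^ 2 / 4 := by field_simp; ring
  have e2 : 2 * α * b - side x * (η * t) = 2 * b * (α - side x * (η * t / (2 * b))) := by
    field_simp
  rw [e1, e2]
  have hb2 : 1 ≤ b ^ 2 := one_le_pow₀ hb
  nlinarith [mul_le_mul_of_nonneg_right hb2 (sq_nonneg (α - side x * (η * t / (2 * b))))]

theorem sq_norm_slopeModel_le (hκ : κ ≤ 0) (x : ℝ) {y : ℝ} (hy : y ≤ 1 - c ^ 2 / 2) :
    ‖slopeModel κ c x y‖ ^ 2 ≤ y ^ 2 * (1 - y) / 2 := by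
  have hy1 : 0 ≤ 1 - y := by nlinarith [sq_nonneg c]
  have hb : 1 ≤ √(1 - 2 * κ * (1 - y)) := Real.one_le_sqrt.2 (by nlinarith)
  have ht : √(2 - c ^ 2 - 2 * y) ^ 2 = 2 - c ^ 2 - 2 * y := Real.sq_sqrt (by linarith)
  rw [slopeModel, Complex.sq_norm, Complex.normSq_mk]
  set b := √(1 - 2 * κ * (1 - y))
  set t := √(2 - c ^ 2 - 2 * y)
  have e : side x * (y * t / (2 * b)) * (side x * (y * t / (2 * b))) =
      (y * t / 2) ^ 2 / b ^ 2 := by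
    rw [mul_mul_mul_comm, ← sq, side_sq]; field_simp
  have h2 : (y * t / 2) ^ 2 / b ^ 2 ≤ (y * t / 2) ^ 2 :=
    div_le_self (sq_nonneg _) (one_le_pow₀ hb)
  rw [e]
  have h3 : (y * t / 2) ^ 2 = y ^ 2 * (2 - c ^ 2 - 2 * y) / 4 := by rw [← ht]; ring
  nlinarith

theorem slopeModel_eq (κ c x y : ℝ) : slopeModel κ c x y =
    ((side x * (y * √(2 - c ^ 2 - 2 * y) / (2 * √(1 - 2 * κ * (1 - y)))) : ℝ) : ℂ) +
      ((c * y / 2 : ℝ) : ℂ) * Complex.I := by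
  rw [slopeModel, Complex.mk_eq_add_mul_I]

theorem tendsto_slopeModel (hκ : κ ≤ 0) {s η : ℕ → ℝ} {y : ℝ} (x : ℝ)
    (hs : Tendsto s atTop (𝓝 c)) (hη : Tendsto η atTop (𝓝 y)) (hy : y < 1) :
    Tendsto (fun n => slopeModel κ (s n) x (η n)) atTop (𝓝 (slopeModel κ c x y)) := by
  simp only [slopeModel_eq]
  have hb : 2 * √(1 - 2 * κ * (1 - y)) ≠ 0 := by
    have : 0 < √(1 - 2 * κ * (1 - y)) := Real.sqrt_pos.2 (by nlinarith)
    positivity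
  have h1 : Tendsto (fun n => √(2 - s n ^ 2 - 2 * η n)) atTop (𝓝 √(2 - c ^ 2 - 2 * y)) :=
    (((hs.pow 2).const_sub 2).sub (hη.const_mul 2)).sqrt
  have h2 : Tendsto (fun n => 2 * √(1 - 2 * κ * (1 - η n))) atTop
      (𝓝 (2 * √(1 - 2 * κ * (1 - y)))) :=
    (((((hη.const_sub 1).const_mul (2 * κ))).const_sub 1).sqrt).const_mul 2
  exact ((Complex.continuous_ofReal.tendsto _).comp (((hη.mul h1).div h2 hb).const_mul _)).add
    (((Complex.continuous_ofReal.tendsto _).comp ((hs.mul hη).div_const 2)).mul_const _)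

theorem memLp_slopeModel (hκ : κ ≤ 0) {η : ℝ → ℝ} (hη : Continuous η) (hm : MemLp η 2 volume)
    (hle : ∀ x, η x ≤ 1 - c ^ 2 / 2) {B : ℝ} (hB0 : 0 ≤ B) (hB : ∀ x, 1 - η x ≤ B ^ 2) :
    MemLp (fun x => slopeModel κ c x (η x)) 2 volume := by
  have h1 := hη.measurable
  have h2 : Measurable fun x => slopeModel κ c x (η x) := by
    simp only [slopeModel_eq]
    have := measurable_side
    fun_prop
  refine hm.of_le_mul (c := B) h2.aestronglyMeasurable (Eventually.of_forall fun x => ?_)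
  rw [← sq_le_sq₀ (norm_nonneg _) (by positivity), mul_pow, Real.norm_eq_abs, sq_abs]
  refine (sq_norm_slopeModel_le hκ x (hle x)).trans ?_
  have h3 : 0 ≤ 1 - η x := by nlinarith [hle x, sq_nonneg c]
  nlinarith [mul_le_mul_of_nonneg_left (hB x) (sq_nonneg (η x)), mul_nonneg (sq_nonneg (η x)) h3]

theorem memLp_slope (hv : v ∈ energySpace) : MemLp (slope v) 2 volume := by
  have h1 : MemLp (fun x => ((radialSlope v x : ℝ) : ℂ)) 2 volume := (memLp_radialSlope hv).ofReal
  have h2 : MemLp (fun x => ((angularSlope v x : ℝ) : ℂ)) 2 volume :=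
    (memLp_angularSlope hv).ofReal
  refine (h1.sub (h2.mul_const Complex.I)).ae_eq (Eventually.of_forall fun x => ?_)
  simp only [Pi.sub_apply, slope, Complex.mk_eq_add_mul_I]
  push_cast
  ring

end Model

/-- A sequence of maps, maximal in intensity at the origin, along which the defect of the
calibrated lower bound tends to zero. -/
structure NearSoliton (κ c : ℝ) (s : ℕ → ℝ) (u : ℕ → ℝ → ℂ) : Prop where
  mem : ∀ n, u n ∈ nonvanishingSpace
  speed_ge : ∀ n, c / 2 ≤ s n
  intensity_zero : ∀ n, intensity (u n) 0 = 1 - s n ^ 2 / 2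
  intensity_le : ∀ n x, intensity (u n) x ≤ 1 - s n ^ 2 / 2
  tendsto_speed : Tendsto s atTop (𝓝 c)
  tendsto_defect : Tendsto (fun n => ∫ x, defect (s n) κ 0 (u n) x) atTop (𝓝 0)
  tendsto_momentum : Tendsto (fun n => momentum (u n)) atTop (𝓝 (profileMomentum κ c))
  bound : ∃ A, ∀ n, energy κ (u n) ≤ A

/-- The difference between the slope of a map and the one of the solitons of speed `c`. -/
noncomputable def slopeResidual (κ c : ℝ) (v : ℝ → ℂ) (x : ℝ) : ℂ :=
  slope v x - slopeModel κ c x (intensity v x)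

namespace NearSoliton

variable {κ c : ℝ} {s : ℕ → ℝ} {u : ℕ → ℝ → ℂ} {v : ℝ → ℂ}

theorem comp (h : NearSoliton κ c s u) {σ : ℕ → ℕ} (hσ : StrictMono σ) :
    NearSoliton κ c (fun n => s (σ n)) (fun n => u (σ n)) where
  mem _ := h.mem _
  speed_ge _ := h.speed_ge _
  intensity_zero _ := h.intensity_zero _
  intensity_le _ := h.intensity_le _
  tendsto_speed := h.tendsto_speed.comp hσ.tendsto_atTop
  tendsto_defect := h.tendsto_defect.comp hσ.tendsto_atTop
  tendsto_momentum := h.tendsto_momentum.comp hσ.tendsto_atTop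
  bound := h.bound.imp fun _ hA _ => hA _

theorem exists_bound (h : NearSoliton κ c s u) (hκ : κ ≤ 0) :
    ∃ B, 0 < B ∧ (∀ n x, ‖u n x‖ ≤ B) ∧ (∀ n, ∫ x, ‖weakDeriv (u n) x‖ ^ 2 ≤ B) ∧
      ∀ n, ∫ x, intensity (u n) x ^ 2 ≤ B := by
  obtain ⟨A, hA⟩ := h.bound
  have hA0 : 0 ≤ A := (energy_nonneg hκ (h.mem 0).1).trans (hA 0)
  have h1 := fun n => integral_weakDeriv_sq_le hκ (h.mem n).1
  have h2 : ∀ n, 4 * energy κ (u n) ≤ 4 * A := fun n => by linarith [hA n]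
  refine ⟨3 + 2 * (4 * A), by positivity, fun n x => ?_, fun n => ?_, fun n => ?_⟩
  · exact energySpace_norm_le (h.mem n).1 ((h1 n).1.trans (h2 n)) ((h1 n).2.trans (h2 n)) x
  · linarith [(h1 n).1, h2 n]
  · linarith [(h1 n).2, h2 n]

theorem norm_sq_ge (h : NearSoliton κ c s u) (hc : 0 < c) (n : ℕ) (x : ℝ) :
    c ^ 2 / 8 ≤ ‖u n x‖ ^ 2 := by
  have h1 := h.intensity_le n x
  have h2 := h.speed_ge n
  rw [intensity] at h1
  nlinarith

theorem one_sub_intensity (v : ℝ → ℂ) (x : ℝ) : 1 - intensity v x = ‖v x‖ ^ 2 := by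
  rw [intensity]; ring

theorem memLp_slopeModel (h : NearSoliton κ c s u) (hκ : κ ≤ 0) (n : ℕ) :
    MemLp (fun x => slopeModel κ (s n) x (intensity (u n) x)) 2 volume := by
  obtain ⟨B, hB0, hB, -⟩ := h.exists_bound hκ
  refine QGP.memLp_slopeModel hκ (continuous_intensity (h.mem n).1.1)
    (energySpace_memLp_intensity (h.mem n).1) (h.intensity_le n) hB0.le fun x => ?_
  rw [one_sub_intensity]
  gcongr
  exact hB n x

theorem memLp_slopeResidual (h : NearSoliton κ c s u) (hκ : κ ≤ 0) (n : ℕ) :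
    MemLp (slopeResidual κ (s n) (u n)) 2 volume :=
  (memLp_slope (h.mem n).1).sub (h.memLp_slopeModel hκ n)

theorem tendsto_slopeResidual (h : NearSoliton κ c s u) (hκ : κ ≤ 0) (hc : 0 < c) :
    Tendsto (fun n => ∫ x, ‖slopeResidual κ (s n) (u n) x‖ ^ 2) atTop (𝓝 0) := by
  obtain ⟨B, hB0, hB, -⟩ := h.exists_bound hκ
  have hlim := h.tendsto_defect.const_mul (2 * B ^ 2)
  rw [mul_zero] at hlim
  refine squeeze_zero (fun n => integral_nonneg fun x => sq_nonneg _) (fun n => ?_) hlim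
  have hs : 0 < s n := by linarith [h.speed_ge n]
  have hi := (energy_sub_momentum_eq hκ hs (h.mem n) (h.intensity_le n) (h.intensity_zero n)).1
  rw [← integral_const_mul]
  refine integral_mono (h.memLp_slopeResidual hκ n).norm.integrable_sq (hi.const_mul _) fun x => ?_
  refine (sq_norm_slope_sub_le hκ (nonvanishingSpace_ne_zero (h.mem n) x)).trans ?_
  have := defect_nonneg (s n) κ 0 (u n) x
  gcongr
  exact hB n x

/-- Passage to the limit in integrals of the slope against a bounded convergent sequence. -/
theorem tendsto_integral_slope_mul (h : NearSoliton κ c s u) (hκ : κ ≤ 0) (hc : 0 < c)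
    (hv : ∀ x, Tendsto (fun n => u n x) atTop (𝓝 (v x))) {w : ℕ → ℝ → ℂ} {W : ℝ → ℂ} {K : ℝ}
    (hw : ∀ n, Continuous (w n)) (hK : ∀ n x, ‖w n x‖ ≤ K)
    (hW : ∀ x, Tendsto (fun n => w n x) atTop (𝓝 (W x))) (x : ℝ) :
    Tendsto (fun n => ∫ t in (0 : ℝ)..x, slope (u n) t * w n t) atTop
      (𝓝 (∫ t in (0 : ℝ)..x, slopeModel κ c t (intensity v t) * W t)) := by
  obtain ⟨B, hB0, hB, -⟩ := h.exists_bound hκ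
  have hK0 : 0 ≤ K := (norm_nonneg _).trans (hK 0 0)
  have hint : ∀ x, Tendsto (fun n => intensity (u n) x) atTop (𝓝 (intensity v x)) := fun x =>
    ((hv x).norm.pow 2).const_sub 1
  have hlt : ∀ x, intensity v x < 1 := fun x => by
    have := le_of_tendsto_of_tendsto' (hint x) (((h.tendsto_speed.pow 2).div_const 2).const_sub 1)
      fun n => h.intensity_le n x
    nlinarith
  have hRi := fun n => locallyIntegrable_intervalIntegrable
    ((h.memLp_slopeResidual hκ n).locallyIntegrable (by norm_num)) 0 x
  have hMi := fun n => locallyIntegrable_intervalIntegrable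
    ((h.memLp_slopeModel hκ n).locallyIntegrable (by norm_num)) 0 x
  -- The residual part vanishes in the limit by Cauchy–Schwarz on the interval; the model part
  -- depends continuously on speed and intensity and is uniformly bounded, so dominated convergence
  -- applies.
  have e : ∀ n, ∫ t in (0 : ℝ)..x, slope (u n) t * w n t =
      (∫ t in (0 : ℝ)..x, slopeResidual κ (s n) (u n) t * w n t) +
        ∫ t in (0 : ℝ)..x, slopeModel κ (s n) t (intensity (u n) t) * w n t := fun n => by
    rw [← intervalIntegral.integral_add ((hRi n).mul_continuousOn (hw n).continuousOn)
      ((hMi n).mul_continuousOn (hw n).continuousOn)]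
    refine intervalIntegral.integral_congr fun t _ => ?_
    simp only [slopeResidual]
    ring
  simp only [e]
  rw [← zero_add (∫ t in (0 : ℝ)..x, slopeModel κ c t (intensity v t) * W t)]
  refine Tendsto.add ?_ ?_
  · rw [tendsto_zero_iff_norm_tendsto_zero]
    have hlim : Tendsto (fun n => K * √(|x - 0| * ∫ x, ‖slopeResidual κ (s n) (u n) x‖ ^ 2))
        atTop (𝓝 0) := by
      have := (((h.tendsto_slopeResidual hκ hc).const_mul |x - 0|).sqrt).const_mul K
      simpa using this
    refine squeeze_zero (fun n => norm_nonneg _) (fun n => ?_) hlim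
    have hn := (h.memLp_slopeResidual hκ n).norm
    have hsq := sq_integral_le hn 0 x
    have h1 : |∫ t in (0 : ℝ)..x, ‖slopeResidual κ (s n) (u n) t‖| ≤
        √(|x - 0| * ∫ x, ‖slopeResidual κ (s n) (u n) x‖ ^ 2) := Real.abs_le_sqrt hsq
    refine (intervalIntegral.norm_integral_le_abs_of_norm_le
      (g := fun t => K * ‖slopeResidual κ (s n) (u n) t‖) (Eventually.of_forall fun t => ?_)
      ((hRi n).norm.const_mul K)).trans ?_
    · rw [norm_mul, mul_comm]
      exact mul_le_mul_of_nonneg_right (hK n t) (norm_nonneg _)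
    · rw [intervalIntegral.integral_const_mul, abs_mul, abs_of_nonneg hK0]
      exact mul_le_mul_of_nonneg_left h1 hK0
  · refine intervalIntegral.tendsto_integral_filter_of_dominated_convergence
      (fun _ => (1 + B ^ 2) * B * K) (Eventually.of_forall fun n => ?_)
      (Eventually.of_forall fun n => Eventually.of_forall fun t _ => ?_) (by simp)
      (Eventually.of_forall fun t _ => (tendsto_slopeModel hκ t h.tendsto_speed (hint t)
        (hlt t)).mul (hW t))
    · exact ((h.memLp_slopeModel hκ n).1.mul (hw n).aestronglyMeasurable).restrict
    · rw [norm_mul]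
      refine mul_le_mul ?_ (hK n t) (norm_nonneg _) (by positivity)
      rw [← sq_le_sq₀ (norm_nonneg _) (by positivity)]
      refine (sq_norm_slopeModel_le hκ t (h.intensity_le n t)).trans ?_
      rw [one_sub_intensity, mul_pow]
      have h1 : ‖u n t‖ ^ 2 ≤ B ^ 2 := by gcongr; exact hB n t
      have h2 : intensity (u n) t ^ 2 ≤ (1 + B ^ 2) ^ 2 := by
        rw [sq_le_sq, abs_of_nonneg (by positivity : 0 ≤ 1 + B ^ 2), abs_le, intensity]
        constructor <;> nlinarith [sq_nonneg ‖u n t‖]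
      calc _ ≤ (1 + B ^ 2) ^ 2 * B ^ 2 / 2 := by gcongr
        _ ≤ _ := by nlinarith [mul_nonneg (sq_nonneg (1 + B ^ 2)) (sq_nonneg B)]

end NearSoliton

/-! ### The soliton profile as the smallest solution of the limit equation. -/

section Comparison

variable {κ c : ℝ}

/-- The rate at which the soliton profile decays at intensity `y`. -/
noncomputable def decayRate (κ c y : ℝ) : ℝ :=
  y * √(2 - c ^ 2 - 2 * y) / √(1 - 2 * κ * (1 - y))

theorem two_mul_slopeModel_re (κ c x y : ℝ) :
    2 * (slopeModel κ c x y).re = side x * decayRate κ c y := by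
  simp only [slopeModel, decayRate]
  rw [mul_comm 2 √(1 - 2 * κ * (1 - y)), ← div_div]
  ring

theorem decayRate_intensityProfile (hκ : κ ≤ 0) (hc : c ^ 2 < 2) (x : ℝ) :
    decayRate κ c (intensityProfile c κ x) = |solitonRoot c κ x| * intensityProfile c κ x /
      weight c κ (solitonRoot c κ x) := by
  have h2 := two_mul_one_sub_intensityProfile hκ hc x
  have e1 : √(1 - 2 * κ * (1 - intensityProfile c κ x)) = weight c κ (solitonRoot c κ x) := by
    rw [weight, ← h2]; ring_nf
  have e2 : √(2 - c ^ 2 - 2 * intensityProfile c κ x) = |solitonRoot c κ x| := by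
    rw [← Real.sqrt_sq_eq_abs]; congr 1; linarith
  rw [decayRate, e1, e2]
  ring

/-- The rate is not Lipschitz at the top value `1 - c² / 2`, where solutions may rest for any time,
so uniqueness fails. The profile leaves the top at once and is therefore the smallest solution. -/
theorem intensityProfile_le_of_integral_eq (hκ : κ ≤ 0) (hc : c ^ 2 < 2) {g : ℝ → ℝ}
    (hg : Continuous g) (hle : ∀ x, g x ≤ 1 - c ^ 2 / 2)
    (heq : ∀ x, 0 ≤ x → g x = 1 - c ^ 2 / 2 - ∫ t in (0 : ℝ)..x, decayRate κ c (g t)) {x : ℝ}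
    (hx : 0 ≤ x) : intensityProfile c κ x ≤ g x := by
  have hb : ∀ x, √(1 - 2 * κ * (1 - g x)) ≠ 0 := fun x => by
    have : 0 ≤ 1 - g x := by nlinarith [hle x, sq_nonneg c]
    exact (Real.sqrt_pos.2 (by nlinarith)).ne'
  have hF : Continuous fun t => decayRate κ c (g t) :=
    (by fun_prop : Continuous fun t => g t * √(2 - c ^ 2 - 2 * g t)).div (by fun_prop) hb
  set G : ℝ → ℝ := fun x => 1 - c ^ 2 / 2 - ∫ t in (0 : ℝ)..x, decayRate κ c (g t) with hG
  have hGd : ∀ x, HasDerivAt G (-decayRate κ c (g x)) x := fun x =>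
    (intervalIntegral.integral_hasDerivAt_right (hF.intervalIntegrable _ _)
      (hF.stronglyMeasurableAtFilter _ _) hF.continuousAt).const_sub _
  -- The shift by `ε` starts the profile strictly below the top, and the factor `1 + ε` makes it
  -- decrease strictly faster than `g` at any contact; both are removed as `ε → 0`.
  have key : ∀ ε > 0, intensityProfile c κ ((1 + ε) * x + ε) ≤ g x := by
    intro ε hε
    have hd : ∀ y, HasDerivAt (fun y => intensityProfile c κ ((1 + ε) * y + ε))
        (-(solitonRoot c κ ((1 + ε) * y + ε) * intensityProfile c κ ((1 + ε) * y + ε) /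
          weight c κ (solitonRoot c κ ((1 + ε) * y + ε))) * (1 + ε)) y := fun y => by
      have h1 : HasDerivAt (fun y => (1 + ε) * y + ε) (1 + ε) y := by
        simpa using ((hasDerivAt_id y).const_mul (1 + ε)).add_const ε
      exact (hasDerivAt_intensityProfile hκ hc _).comp y h1
    have := image_le_of_deriv_right_lt_deriv_boundary (a := 0) (b := x)
      (fun y _ => (hd y).continuousAt.continuousWithinAt) (fun y _ => (hd y).hasDerivWithinAt)
      (B := G) ?_ hGd (fun y hy hyy => ?_) (right_mem_Icc.2 hx)
    · exact this.trans (heq x hx).ge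
    · simp only [hG, intervalIntegral.integral_same, sub_zero]
      rw [intensityProfile_eq hκ hc]
      nlinarith [sq_nonneg (solitonRoot c κ ((1 + ε) * 0 + ε))]
    · have h1 : intensityProfile c κ ((1 + ε) * y + ε) = g y := hyy.trans (heq y hy.1).symm
      have hpos : 0 < (1 + ε) * y + ε := by
        have := mul_nonneg (by linarith : 0 ≤ 1 + ε) hy.1
        linarith
      have hT : 0 < solitonRoot c κ ((1 + ε) * y + ε) := by
        rw [← solitonRoot_zero hκ hc]
        exact strictMono_solitonRoot hκ hc hpos
      rw [← h1, decayRate_intensityProfile hκ hc, abs_of_pos hT]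
      have hN := intensityProfile_pos hκ hc ((1 + ε) * y + ε)
      have hw := weight_pos hκ c (solitonRoot c κ ((1 + ε) * y + ε))
      have : 0 < solitonRoot c κ ((1 + ε) * y + ε) * intensityProfile c κ ((1 + ε) * y + ε) /
          weight c κ (solitonRoot c κ ((1 + ε) * y + ε)) := by positivity
      nlinarith
  have hlim : Tendsto (fun ε => intensityProfile c κ ((1 + ε) * x + ε)) (𝓝[>] 0)
      (𝓝 (intensityProfile c κ x)) := by
    have h1 : Continuous fun ε => intensityProfile c κ ((1 + ε) * x + ε) :=
      (continuous_intensityProfile hκ hc).comp (by fun_prop)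
    have := h1.tendsto 0
    simp only [add_zero, one_mul] at this
    exact this.mono_left nhdsWithin_le_nhds
  exact le_of_tendsto hlim (eventually_mem_nhdsWithin.mono fun ε hε => key ε hε)

theorem intensityProfile_neg (c κ x : ℝ) :
    intensityProfile c κ (-x) = intensityProfile c κ x := by
  simp [intensityProfile]

end Comparison

namespace NearSoliton

variable {κ c : ℝ} {s : ℕ → ℝ} {u : ℕ → ℝ → ℂ} {v : ℝ → ℂ}

theorem tendsto_intensity (hv : ∀ x, Tendsto (fun n => u n x) atTop (𝓝 (v x)))
    (x : ℝ) :
    Tendsto (fun n => intensity (u n) x) atTop (𝓝 (intensity v x)) :=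
  ((hv x).norm.pow 2).const_sub 1

theorem intensity_limit_le (h : NearSoliton κ c s u)
    (hv : ∀ x, Tendsto (fun n => u n x) atTop (𝓝 (v x))) (x : ℝ) : intensity v x ≤ 1 - c ^ 2 / 2 :=
  le_of_tendsto_of_tendsto' (tendsto_intensity hv x)
    (((h.tendsto_speed.pow 2).div_const 2).const_sub 1) fun n => h.intensity_le n x

theorem intensity_limit_zero (h : NearSoliton κ c s u)
    (hv : ∀ x, Tendsto (fun n => u n x) atTop (𝓝 (v x))) : intensity v 0 = 1 - c ^ 2 / 2 :=
  tendsto_nhds_unique (tendsto_intensity hv 0)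
    ((((h.tendsto_speed.pow 2).div_const 2).const_sub 1).congr fun n => (h.intensity_zero n).symm)

theorem intervalIntegrable_slopeModel (h : NearSoliton κ c s u) (hκ : κ ≤ 0)
    (hv : ∀ x, Tendsto (fun n => u n x) atTop (𝓝 (v x))) (hvc : Continuous v) (a b : ℝ) :
    IntervalIntegrable (fun t => slopeModel κ c t (intensity v t)) volume a b := by
  have hm := measurable_side
  have h1 := (continuous_intensity hvc).measurable
  have h2 : Measurable fun x => slopeModel κ c x (intensity v x) := by
    simp only [slopeModel_eq]
    fun_prop
  have h3 : Continuous fun t => √(intensity v t ^ 2 * (1 - intensity v t) / 2) := by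
    have := continuous_intensity hvc
    fun_prop
  refine (h3.intervalIntegrable a b).mono_fun h2.aestronglyMeasurable
    (Eventually.of_forall fun t => ?_)
  refine (Real.le_sqrt_of_sq_le (sq_norm_slopeModel_le hκ t (h.intensity_limit_le hv t))).trans ?_
  exact le_abs_self _

/-- The intensity has derivative `-2` times the real part of the slope, so the limit of the slopes
against the constant `1` gives its equation. Plateau solitons satisfy this equation too; it does not
identify the limit by itself. -/
theorem intensity_limit_eq (h : NearSoliton κ c s u) (hκ : κ ≤ 0) (hc0 : 0 < c)
    (hv : ∀ x, Tendsto (fun n => u n x) atTop (𝓝 (v x))) (hvc : Continuous v) (x : ℝ) : intensity v x = 1 - c ^ 2 / 2 -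
    ∫ t in (0 : ℝ)..x, side t * decayRate κ c (intensity v t) := by
  have h1 := h.tendsto_integral_slope_mul hκ hc0 hv (w := fun _ _ => 1) (W := fun _ => 1) (K := 1)
    (fun _ => continuous_const) (fun _ _ => by simp) (fun _ => tendsto_const_nhds) x
  simp only [mul_one] at h1
  have h2 := (Complex.continuous_re.tendsto _).comp h1
  have e1 : (∫ t in (0 : ℝ)..x, slopeModel κ c t (intensity v t)).re =
      ∫ t in (0 : ℝ)..x, (slopeModel κ c t (intensity v t)).re :=
    (Complex.reCLM.intervalIntegral_comp_comm
      (h.intervalIntegrable_slopeModel hκ hv hvc 0 x)).symm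
  have e2 : ∀ n, -2 * (∫ t in (0 : ℝ)..x, slope (u n) t).re =
      intensity (u n) x - intensity (u n) 0 := fun n => by
    rw [(energySpace_isPrimitive_intensity (h.mem n).1).sub_eq, intervalIntegral.integral_const_mul]
    congr 1
    exact (Complex.reCLM.intervalIntegral_comp_comm (locallyIntegrable_intervalIntegrable
      ((memLp_slope (h.mem n).1).locallyIntegrable (by norm_num)) 0 x)).symm
  have h3 := tendsto_nhds_unique ((h2.const_mul (-2)).congr e2)
    ((tendsto_intensity hv x).sub (tendsto_intensity hv 0))
  rw [e1, h.intensity_limit_zero hv, neg_mul, ← intervalIntegral.integral_const_mul] at h3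
  simp only [two_mul_slopeModel_re] at h3
  linarith

theorem intensityProfile_le_limit (h : NearSoliton κ c s u) (hκ : κ ≤ 0) (hc0 : 0 < c) (hc : c ^ 2 < 2)
    (hv : ∀ x, Tendsto (fun n => u n x) atTop (𝓝 (v x))) (hvc : Continuous v) (x : ℝ) : intensityProfile c κ x ≤ intensity v x := by
  have heq := h.intensity_limit_eq hκ hc0 hv hvc
  have hle := h.intensity_limit_le hv
  have hcont := continuous_intensity hvc
  rcases le_total 0 x with hx | hx
  · refine intensityProfile_le_of_integral_eq hκ hc hcont hle (fun y hy => ?_) hx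
    rw [heq y]
    congr 1
    refine intervalIntegral.integral_congr_ae (Eventually.of_forall fun t ht => ?_)
    rw [uIoc_of_le hy] at ht
    simp [side, not_le.2 ht.1]
  · have := intensityProfile_le_of_integral_eq hκ hc (g := fun x => intensity v (-x))
      (hcont.comp continuous_neg) (fun x => hle _) (fun y hy => ?_) (neg_nonneg.2 hx)
    · simpa [intensityProfile_neg] using this
    · rw [heq (-y)]
      congr 1
      rw [intervalIntegral.integral_comp_neg (fun t => decayRate κ c (intensity v t)), neg_zero,
        intervalIntegral.integral_symm, ← intervalIntegral.integral_neg]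
      refine intervalIntegral.integral_congr_ae (Eventually.of_forall fun t ht => ?_)
      rw [uIoc_of_le (by linarith)] at ht
      simp [side, ht.2]

end NearSoliton
-- Identification of the limit intensity by its momentum.
namespace NearSoliton

variable {κ c : ℝ} {s : ℕ → ℝ} {u : ℕ → ℝ → ℂ} {v : ℝ → ℂ}

theorem integrable_sq_div (h : NearSoliton κ c s u) (hc0 : 0 < c) (n : ℕ) :
    MemLp (fun x => intensity (u n) x / (1 - intensity (u n) x)) 2 volume ∧
    Integrable (fun x => s n / 4 * (intensity (u n) x ^ 2 / (1 - intensity (u n) x))) := by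
  have hm := energySpace_memLp_intensity (h.mem n).1
  have hcont := continuous_intensity (h.mem n).1.1
  have hne : ∀ x, 1 - intensity (u n) x ≠ 0 := fun x => by
    linarith [intensity_lt_one (h.mem n) x]
  have h1 : MemLp (fun x => intensity (u n) x / (1 - intensity (u n) x)) 2 volume := by
    refine hm.of_le_mul (c := 8 / c ^ 2) (hcont.div (by fun_prop) hne).aestronglyMeasurable
      (Eventually.of_forall fun x => ?_)
    have h2 := h.norm_sq_ge hc0 n x
    rw [norm_div, one_sub_intensity, Real.norm_of_nonneg (sq_nonneg ‖u n x‖), div_eq_mul_inv,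
      mul_comm]
    refine mul_le_mul_of_nonneg_right ?_ (norm_nonneg _)
    rw [← inv_div]
    exact inv_anti₀ (by positivity) h2
  refine ⟨h1, ((hm.integrable_mul h1).const_mul (s n / 4)).congr
    (Eventually.of_forall fun x => ?_)⟩
  simp only [Pi.mul_apply]
  ring

/-- The momentum density is `s / 4 * η² / (1 - η)` plus half the imaginary residual times `η / (1 -
η)`. The residual tends to zero in L², and the other factor is bounded there because the modulus
stays away from zero. -/
theorem tendsto_integral_sq_div (h : NearSoliton κ c s u) (hκ : κ ≤ 0) (hc0 : 0 < c) :
    Tendsto (fun n => ∫ x, s n / 4 * (intensity (u n) x ^ 2 / (1 - intensity (u n) x))) atTop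
      (𝓝 (profileMomentum κ c)) := by
  obtain ⟨B, hB0, -, -, hB⟩ := h.exists_bound hκ
  set r : ℕ → ℝ → ℝ := fun n x => (slopeResidual κ (s n) (u n) x).im with hr
  set g : ℕ → ℝ → ℝ := fun n x => intensity (u n) x / (1 - intensity (u n) x) with hg
  have hrm : ∀ n, MemLp (r n) 2 volume := fun n => (h.memLp_slopeResidual hκ n).im
  have hgm : ∀ n, MemLp (g n) 2 volume := fun n => (h.integrable_sq_div hc0 n).1
  have e : ∀ n, momentum (u n) - 1 / 2 * ∫ x, r n x * g n x =
      ∫ x, s n / 4 * (intensity (u n) x ^ 2 / (1 - intensity (u n) x)) := fun n => by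
    have hi : Integrable (fun x => r n x * g n x) := (hrm n).integrable_mul (hgm n)
    rw [momentum_eq_integral, ← integral_const_mul,
      ← integral_sub (integrable_momentumDensity (h.mem n)) (hi.const_mul _)]
    refine integral_congr_ae (Eventually.of_forall fun x => ?_)
    have hρ : 1 - intensity (u n) x ≠ 0 := by linarith [intensity_lt_one (h.mem n) x]
    simp only [momentumDensity, hr, hg, slopeResidual, slope, slopeModel, Complex.sub_im,
      ← one_sub_intensity]
    field_simp
    ring
  have hlim : Tendsto (fun n => ∫ x, r n x * g n x) atTop (𝓝 0) := by
    rw [tendsto_zero_iff_abs_tendsto_zero]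
    have h0 : Tendsto (fun n => √((∫ x, ‖slopeResidual κ (s n) (u n) x‖ ^ 2) *
        ((8 / c ^ 2) ^ 2 * B))) atTop (𝓝 0) := by
      have := ((h.tendsto_slopeResidual hκ hc0).mul_const ((8 / c ^ 2) ^ 2 * B)).sqrt
      simpa using this
    refine squeeze_zero (fun n => abs_nonneg _) (fun n => Real.abs_le_sqrt ?_) h0
    refine (sq_integral_mul_le (hrm n) (hgm n)).trans ?_
    refine mul_le_mul ?_ ?_ (integral_nonneg fun x => sq_nonneg _)
      (integral_nonneg fun x => sq_nonneg _)
    · refine integral_mono (hrm n).integrable_sq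
        (h.memLp_slopeResidual hκ n).norm.integrable_sq fun x => ?_
      rw [← sq_abs]
      exact pow_le_pow_left₀ (abs_nonneg _) (Complex.abs_im_le_norm _) 2
    · have hi := (energySpace_memLp_intensity (h.mem n).1).integrable_sq
      calc ∫ x, g n x ^ 2 ≤ ∫ x, (8 / c ^ 2) ^ 2 * intensity (u n) x ^ 2 := by
            refine integral_mono (hgm n).integrable_sq (hi.const_mul _) fun x => ?_
            have h2 := h.norm_sq_ge hc0 n x
            simp only [hg, one_sub_intensity]
            rw [div_pow, div_eq_mul_inv, mul_comm, ← inv_pow]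
            refine mul_le_mul_of_nonneg_right ?_ (sq_nonneg _)
            refine pow_le_pow_left₀ (by positivity) ?_ 2
            rw [← inv_div]
            exact inv_anti₀ (by positivity) h2
        _ = (8 / c ^ 2) ^ 2 * ∫ x, intensity (u n) x ^ 2 := integral_const_mul _ _
        _ ≤ _ := by gcongr; exact hB n
  have := h.tendsto_momentum.sub (hlim.const_mul (1 / 2))
  rw [mul_zero, sub_zero] at this
  exact this.congr e

theorem sq_div_le_sq_div {a b : ℝ} (ha : 0 ≤ a) (hab : a ≤ b) (hb : b < 1) :
    a ^ 2 / (1 - a) ≤ b ^ 2 / (1 - b) :=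
  div_le_div₀ (sq_nonneg _) (pow_le_pow_left₀ ha hab 2) (by linarith) (by linarith)

theorem eq_of_sq_div_eq {a b : ℝ} (ha : 0 < a) (hab : a ≤ b) (hb : b < 1)
    (h : a ^ 2 / (1 - a) = b ^ 2 / (1 - b)) : a = b := by
  rw [div_eq_div_iff (by linarith) (by linarith)] at h
  by_contra hne
  have : a < b := lt_of_le_of_ne hab hne
  nlinarith [mul_pos (sub_pos.2 this) ha, mul_pos (sub_pos.2 this) (sub_pos.2 hb)]

/-- The limit has the intensity of the soliton. -/
theorem intensity_limit_eq_profile (h : NearSoliton κ c s u) (hκ : κ ≤ 0) (hc0 : 0 < c)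
    (hc : c ^ 2 < 2) (hv : ∀ x, Tendsto (fun n => u n x) atTop (𝓝 (v x))) (hvc : Continuous v)
    (x : ℝ) : intensity v x = intensityProfile c κ x := by
  have hle := h.intensityProfile_le_limit hκ hc0 hc hv hvc
  have hlt : ∀ x, intensity v x < 1 := fun x => by
    have := h.intensity_limit_le hv x
    nlinarith
  have hpos := fun x => intensityProfile_pos hκ hc x
  obtain ⟨h1, h2⟩ := integral_sq_div_intensityProfile hκ hc0 hc
  have hcv := continuous_intensity hvc
  have hcp := continuous_intensityProfile hκ hc
  -- The limit intensity dominates the profile, and by Fatou's lemma it cannot carry more momentum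
  -- than the soliton, as it would if it were larger anywhere.
  have key := eq_of_le_of_tendsto_integral
    (f := fun n x => s n / 4 * (intensity (u n) x ^ 2 / (1 - intensity (u n) x)))
    (g := fun x => c / 4 * (intensity v x ^ 2 / (1 - intensity v x)))
    (fun n x => by
      have h3 := intensity_lt_one (h.mem n) x
      have h4 := h.speed_ge n
      exact mul_nonneg (by linarith) (div_nonneg (sq_nonneg _) (by linarith)))
    (fun n => (h.integrable_sq_div hc0 n).2)
    (fun x => (h.tendsto_speed.div_const 4).mul (((tendsto_intensity hv x).pow 2).div
      ((tendsto_intensity hv x).const_sub 1) (by linarith [hlt x]))) h1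
    (fun x => mul_le_mul_of_nonneg_left (sq_div_le_sq_div (hpos x).le (hle x) (hlt x))
      (by linarith))
    (fun x => mul_nonneg (by linarith) (div_nonneg (sq_nonneg _) (by linarith [hle x, hlt x])))
    (by rw [h2]; exact h.tendsto_integral_sq_div hκ hc0)
    (((hcv.pow 2).div (by fun_prop) fun x => by linarith [hlt x]).const_mul _)
    (((hcp.pow 2).div (by fun_prop) fun x => by linarith [hle x, hlt x]).const_mul _)
  have h5 := mul_left_cancel₀ (by positivity : c / 4 ≠ 0) (congrFun key x)
  exact (eq_of_sq_div_eq (hpos x) (hle x) (hlt x) h5).symm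

/-- Convergence of the intensities and of the slopes in `L²`. -/
theorem tendsto_integral_sq_sub (h : NearSoliton κ c s u) (hκ : κ ≤ 0) (hc0 : 0 < c)
    (hc : c ^ 2 < 2) (hv : ∀ x, Tendsto (fun n => u n x) atTop (𝓝 (v x))) (hvc : Continuous v) :
    Tendsto (fun n => ∫ x, (intensity (u n) x - intensityProfile c κ x) ^ 2) atTop (𝓝 0) ∧
    Tendsto (fun n => ∫ x, ‖slopeModel κ (s n) x (intensity (u n) x) -
      slopeModel κ c x (intensityProfile c κ x)‖ ^ 2) atTop (𝓝 0) := by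
  obtain ⟨B, hB0, hB, -⟩ := h.exists_bound hκ
  obtain ⟨h1, h2⟩ := integral_sq_div_intensityProfile hκ hc0 hc
  have hN : ∀ x, intensityProfile c κ x ≤ 1 - c ^ 2 / 2 := fun x => by
    rw [intensityProfile_eq hκ hc]; nlinarith [sq_nonneg (solitonRoot c κ x)]
  have hNpos := fun x => intensityProfile_pos hκ hc x
  have hNlt := fun x => intensityProfile_lt_one hκ hc0 hc x
  have hNm : MemLp (intensityProfile c κ) 2 volume :=
    (memLp_two_iff_integrable_sq (continuous_intensityProfile hκ hc).aestronglyMeasurable).2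
      (integral_sq_intensityProfile hκ hc).1
  have hMm : MemLp (fun x => slopeModel κ c x (intensityProfile c κ x)) 2 volume :=
    QGP.memLp_slopeModel hκ (continuous_intensityProfile hκ hc) hNm hN zero_le_one fun x => by
      linarith [hNpos x]
  have hηm := fun n => energySpace_memLp_intensity (h.mem n).1
  have hi1 : ∀ n, Integrable (fun x => (intensity (u n) x - intensityProfile c κ x) ^ 2) :=
    fun n => ((hηm n).sub hNm).integrable_sq
  have hi2 : ∀ n, Integrable (fun x => ‖slopeModel κ (s n) x (intensity (u n) x) -
      slopeModel κ c x (intensityProfile c κ x)‖ ^ 2) := fun n =>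
    ((h.memLp_slopeModel hκ n).sub hMm).norm.integrable_sq
  set f : ℕ → ℝ → ℝ := fun n x => (intensity (u n) x - intensityProfile c κ x) ^ 2 +
    ‖slopeModel κ (s n) x (intensity (u n) x) - slopeModel κ c x (intensityProfile c κ x)‖ ^ 2
  -- Chosen so that `2η² + 2|slopeModel|² ≤ L * (r / 4 * η² / (1 - η))` whenever `r ≥ c / 2` and `1
  -- - η ≤ 1 + B²`. The integrals of the right side converge, so it can serve as a varying
  -- dominating function.
  set L : ℝ := (3 + B ^ 2) * (8 / c * (1 + B ^ 2)) with hL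
  have hs : ∀ n, 0 < s n := fun n => by linarith [h.speed_ge n]
  have elem : ∀ (r y M : ℝ), c / 2 ≤ r → y < 1 → 1 - y ≤ 1 + B ^ 2 → M ≤ y ^ 2 * (1 - y) / 2 →
      2 * y ^ 2 + 2 * M ≤ L * (r / 4 * (y ^ 2 / (1 - y))) := by
    intro r y M hr hy hyB hM
    have hy0 : 0 < 1 - y := by linarith
    have hr0 : 0 < r := by linarith
    have e1 : 2 * y ^ 2 + 2 * M ≤ y ^ 2 * (3 + B ^ 2) := by
      nlinarith [mul_le_mul_of_nonneg_left hyB (sq_nonneg y)]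
    have e2 : 3 + B ^ 2 ≤ L * (r / 4) / (1 - y) := by
      rw [le_div_iff₀ hy0]
      have e3 : L * (c / 8) = (3 + B ^ 2) * (1 + B ^ 2) := by rw [hL]; field_simp
      have e4 : L * (c / 8) ≤ L * (r / 4) :=
        mul_le_mul_of_nonneg_left (by linarith) (by positivity)
      have e5 : (3 + B ^ 2) * (1 - y) ≤ (3 + B ^ 2) * (1 + B ^ 2) := by gcongr
      linarith
    calc _ ≤ y ^ 2 * (3 + B ^ 2) := e1
      _ ≤ y ^ 2 * (L * (r / 4) / (1 - y)) := by gcongr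
      _ = _ := by ring
  have hf0 := tendsto_integral_zero_of_le (f := f)
    (g := fun n x => L * (s n / 4 * (intensity (u n) x ^ 2 / (1 - intensity (u n) x))) +
      L * (c / 4 * (intensityProfile c κ x ^ 2 / (1 - intensityProfile c κ x))))
    (G := fun x => L * (c / 4 * (intensityProfile c κ x ^ 2 / (1 - intensityProfile c κ x))) +
      L * (c / 4 * (intensityProfile c κ x ^ 2 / (1 - intensityProfile c κ x))))
    (fun n x => by positivity) (fun n x => ?_) (fun n => (hi1 n).add (hi2 n))
    (fun n => ((h.integrable_sq_div hc0 n).2.const_mul L).add (h1.const_mul L))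
    ((h1.const_mul L).add (h1.const_mul L)) (fun x => ?_) (fun x => ?_) ?_
  · constructor
    · exact squeeze_zero (fun n => integral_nonneg fun x => sq_nonneg _) (fun n =>
        integral_mono (hi1 n) ((hi1 n).add (hi2 n)) fun x => le_add_of_nonneg_right (sq_nonneg _))
        hf0
    · exact squeeze_zero (fun n => integral_nonneg fun x => sq_nonneg _) (fun n =>
        integral_mono (hi2 n) ((hi1 n).add (hi2 n)) fun x => le_add_of_nonneg_left (sq_nonneg _))
        hf0
  · have k1 := elem (s n) (intensity (u n) x)
      (‖slopeModel κ (s n) x (intensity (u n) x)‖ ^ 2) (h.speed_ge n)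
      (intensity_lt_one (h.mem n) x) (by
        rw [one_sub_intensity]
        have : ‖u n x‖ ^ 2 ≤ B ^ 2 := by gcongr; exact hB n x
        linarith) (sq_norm_slopeModel_le hκ x (h.intensity_le n x))
    have k2 := elem c (intensityProfile c κ x)
      (‖slopeModel κ c x (intensityProfile c κ x)‖ ^ 2) (by linarith) (hNlt x)
      (by nlinarith [hNpos x, sq_nonneg B]) (sq_norm_slopeModel_le hκ x (hN x))
    have k3 := parallelogram_law_with_norm ℝ (slopeModel κ (s n) x (intensity (u n) x))
      (slopeModel κ c x (intensityProfile c κ x))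
    simp only [f]
    nlinarith [sq_nonneg (intensity (u n) x + intensityProfile c κ x),
      norm_nonneg (slopeModel κ (s n) x (intensity (u n) x) +
        slopeModel κ c x (intensityProfile c κ x))]
  · have e := h.intensity_limit_eq_profile hκ hc0 hc hv hvc x
    have t1 := tendsto_intensity hv x
    rw [e] at t1
    have t2 := tendsto_slopeModel hκ x h.tendsto_speed t1 (hNlt x)
    have := ((t1.sub_const (intensityProfile c κ x)).pow 2).add
      (((t2.sub_const (slopeModel κ c x (intensityProfile c κ x))).norm).pow 2)
    simpa using this
  · have e := h.intensity_limit_eq_profile hκ hc0 hc hv hvc x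
    have t1 := tendsto_intensity hv x
    rw [e] at t1
    exact (((h.tendsto_speed.div_const 4).mul ((t1.pow 2).div (t1.const_sub 1)
      (by linarith [hNlt x]))).const_mul L).add_const _
  · have e1 : ∀ n, L * (∫ x, s n / 4 * (intensity (u n) x ^ 2 / (1 - intensity (u n) x))) +
        L * profileMomentum κ c = ∫ x, (L * (s n / 4 * (intensity (u n) x ^ 2 /
        (1 - intensity (u n) x))) + L * (c / 4 * (intensityProfile c κ x ^ 2 /
        (1 - intensityProfile c κ x)))) := fun n => by
      rw [integral_add ((h.integrable_sq_div hc0 n).2.const_mul L) (h1.const_mul L),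
        integral_const_mul L, integral_const_mul L, h2]
    rw [integral_add (h1.const_mul L) (h1.const_mul L), integral_const_mul L, h2]
    exact (((h.tendsto_integral_sq_div hκ hc0).const_mul L).add_const _).congr e1

end NearSoliton

theorem slopeModel_intensityProfile {κ c : ℝ} (hκ : κ ≤ 0) (hc0 : 0 < c) (hc : c ^ 2 < 2) (x : ℝ) :
    slopeModel κ c x (intensityProfile c κ x) =
      solitonLogDeriv c κ x * ((1 - intensityProfile c κ x : ℝ) : ℂ) := by
  have hN : 0 < 1 - intensityProfile c κ x := by
    linarith [intensityProfile_lt_one hκ hc0 hc x]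
  have h2 := two_mul_one_sub_intensityProfile hκ hc x
  have e1 : √(1 - 2 * κ * (1 - intensityProfile c κ x)) = weight c κ (solitonRoot c κ x) := by
    rw [weight, ← h2]; ring_nf
  have e2 : √(2 - c ^ 2 - 2 * intensityProfile c κ x) = |solitonRoot c κ x| := by
    rw [← Real.sqrt_sq_eq_abs]; congr 1; linarith
  have e3 : side x * |solitonRoot c κ x| = solitonRoot c κ x := by
    unfold side
    split_ifs with h
    · have := solitonRoot_nonneg hκ hc (neg_nonneg.2 h)
      rw [solitonRoot_neg hκ hc] at this
      rw [abs_of_nonpos (by linarith)]; ring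
    · rw [abs_of_nonneg (solitonRoot_nonneg hκ hc (not_le.1 h).le), one_mul]
  have hw := weight_pos hκ c (solitonRoot c κ x)
  apply Complex.ext
  · simp only [slopeModel, solitonLogDeriv, Complex.mul_re, Complex.ofReal_re, Complex.ofReal_im,
      e1, e2]
    rw [show side x * (intensityProfile c κ x * |solitonRoot c κ x| /
      (2 * weight c κ (solitonRoot c κ x))) = intensityProfile c κ x *
      (side x * |solitonRoot c κ x|) / (2 * weight c κ (solitonRoot c κ x)) by ring, e3]
    field_simp
    ring
  · simp only [slopeModel, solitonLogDeriv, Complex.mul_im, Complex.ofReal_re, Complex.ofReal_im]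
    field_simp
    ring

/-! ### Phase of the limit and strong convergence of the derivatives. -/

namespace NearSoliton

variable {κ c : ℝ} {s : ℕ → ℝ} {u : ℕ → ℝ → ℂ} {v : ℝ → ℂ}

theorem norm_div_norm_sq_le (h : NearSoliton κ c s u) (hc0 : 0 < c) (n : ℕ) (x : ℝ) :
    ‖u n x / (‖u n x‖ ^ 2 : ℝ)‖ ≤ √(8 / c ^ 2) := by
  have h1 := h.norm_sq_ge hc0 n x
  have h0 : 0 < ‖u n x‖ ^ 2 := lt_of_lt_of_le (by positivity) h1
  refine Real.le_sqrt_of_sq_le ?_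
  rw [norm_div, Complex.norm_real, Real.norm_of_nonneg h0.le, div_pow, ← inv_div (c ^ 2)]
  have e : ‖u n x‖ ^ 2 / (‖u n x‖ ^ 2) ^ 2 = (‖u n x‖ ^ 2)⁻¹ := by field_simp
  rw [e]
  exact inv_anti₀ (by positivity) h1

theorem norm_sq_limit (h : NearSoliton κ c s u) (hκ : κ ≤ 0) (hc0 : 0 < c)
    (hc : c ^ 2 < 2) (hv : ∀ x, Tendsto (fun n => u n x) atTop (𝓝 (v x))) (hvc : Continuous v)
    (x : ℝ) : ‖v x‖ ^ 2 = 1 - intensityProfile c κ x := by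
  rw [← h.intensity_limit_eq_profile hκ hc0 hc hv hvc x, one_sub_intensity]

theorem limit_ne_zero (h : NearSoliton κ c s u) (hκ : κ ≤ 0) (hc0 : 0 < c)
    (hc : c ^ 2 < 2) (hv : ∀ x, Tendsto (fun n => u n x) atTop (𝓝 (v x))) (hvc : Continuous v)
    (x : ℝ) : v x ≠ 0 := fun h0 => by
  have h1 := h.norm_sq_limit hκ hc0 hc hv hvc x
  have h2 := intensityProfile_lt_one hκ hc0 hc x
  rw [h0] at h1
  simp at h1
  linarith

theorem tendsto_div_norm_sq (h : NearSoliton κ c s u) (hκ : κ ≤ 0) (hc0 : 0 < c)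
    (hc : c ^ 2 < 2) (hv : ∀ x, Tendsto (fun n => u n x) atTop (𝓝 (v x))) (hvc : Continuous v)
    (x : ℝ) : Tendsto (fun n => u n x / (‖u n x‖ ^ 2 : ℝ)) atTop (𝓝 (v x / (‖v x‖ ^ 2 : ℝ))) := by
  refine (hv x).div ((Complex.continuous_ofReal.tendsto _).comp ((hv x).norm.pow 2)) ?_
  have := norm_pos_iff.2 (h.limit_ne_zero hκ hc0 hc hv hvc x)
  exact Complex.ofReal_ne_zero.2 (by positivity)

theorem continuous_div_norm_sq {w : ℝ → ℂ} (hw : Continuous w) (h0 : ∀ x, w x ≠ 0) :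
    Continuous fun x => w x / (‖w x‖ ^ 2 : ℝ) := by
  refine hw.div (Complex.continuous_ofReal.comp (hw.norm.pow 2)) fun x => ?_
  have := norm_pos_iff.2 (h0 x)
  exact Complex.ofReal_ne_zero.2 (by positivity)

theorem slopeModel_mul_limit (h : NearSoliton κ c s u) (hκ : κ ≤ 0) (hc0 : 0 < c)
    (hc : c ^ 2 < 2) (hv : ∀ x, Tendsto (fun n => u n x) atTop (𝓝 (v x))) (hvc : Continuous v)
    (x : ℝ) : slopeModel κ c x (intensityProfile c κ x) * (v x / (‖v x‖ ^ 2 : ℝ)) =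
      solitonLogDeriv c κ x * v x := by
  have hN : 0 < 1 - intensityProfile c κ x := by
    linarith [intensityProfile_lt_one hκ hc0 hc x]
  have := Complex.ofReal_ne_zero.2 hN.ne'
  rw [h.norm_sq_limit hκ hc0 hc hv hvc, slopeModel_intensityProfile hκ hc0 hc]
  field_simp

/-- The identity `u' = slope * u / |u|²` is integrated and passed to the limit, where the slope has
become that of the soliton. -/
theorem hasDerivAt_limit (h : NearSoliton κ c s u) (hκ : κ ≤ 0) (hc0 : 0 < c)
    (hc : c ^ 2 < 2) (hv : ∀ x, Tendsto (fun n => u n x) atTop (𝓝 (v x))) (hvc : Continuous v)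
    (x : ℝ) : HasDerivAt v (solitonLogDeriv c κ x * v x) x := by
  have key : ∀ x, v x = v 0 + ∫ t in (0 : ℝ)..x, solitonLogDeriv c κ t * v t := by
    intro x
    have h1 := h.tendsto_integral_slope_mul hκ hc0 hv
      (fun n => continuous_div_norm_sq (h.mem n).1.1 (nonvanishingSpace_ne_zero (h.mem n)))
      (h.norm_div_norm_sq_le hc0) (h.tendsto_div_norm_sq hκ hc0 hc hv hvc) x
    simp only [h.intensity_limit_eq_profile hκ hc0 hc hv hvc,
      h.slopeModel_mul_limit hκ hc0 hc hv hvc] at h1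
    have e : ∀ n, ∫ t in (0 : ℝ)..x, slope (u n) t * (u n t / (‖u n t‖ ^ 2 : ℝ)) =
        u n x - u n 0 := fun n => by
      rw [(energySpace_isPrimitive (h.mem n).1).sub_eq]
      exact intervalIntegral.integral_congr fun t _ =>
        (weakDeriv_eq_slope_mul (nonvanishingSpace_ne_zero (h.mem n) t)).symm
    simp only [e] at h1
    rw [tendsto_nhds_unique h1 ((hv x).sub (hv 0))]
    ring
  have hcont := (continuous_solitonLogDeriv hκ hc0 hc).mul hvc
  have := (intervalIntegral.integral_hasDerivAt_right (hcont.intervalIntegrable 0 x)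
    (hcont.stronglyMeasurableAtFilter _ _) hcont.continuousAt).const_add (v 0)
  exact this.congr_of_eventuallyEq (Eventually.of_forall key)

/-- The limit and the soliton solve the same linear equation `y' = solitonLogDeriv * y`, so their
quotient is constant; it is unimodular because the intensities agree. -/
theorem exists_phase (h : NearSoliton κ c s u) (hκ : κ ≤ 0) (hc0 : 0 < c)
    (hc : c ^ 2 < 2) (hv : ∀ x, Tendsto (fun n => u n x) atTop (𝓝 (v x))) (hvc : Continuous v) :
    ∃ θ : ℝ, ∀ x, v x = Complex.exp (Complex.I * θ) * darkSoliton c κ x := by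
  have hU : darkSoliton c κ = plateauSoliton c κ 0 := darkSoliton_eq_plateauSoliton hc0.ne' κ
  have hU0 : ∀ x, darkSoliton c κ x ≠ 0 := fun x => by
    rw [hU]
    exact nonvanishingSpace_ne_zero (plateauSoliton_mem hκ hc0 hc le_rfl) x
  have hd : ∀ x, HasDerivAt (darkSoliton c κ) (solitonLogDeriv c κ x * darkSoliton c κ x) x :=
    fun x => by
      have := hasDerivAt_plateauSoliton hκ hc0 hc le_rfl x
      rwa [overshoot_zero, ← hU] at this
  have hq : ∀ x, HasDerivAt (fun x => v x / darkSoliton c κ x) 0 x := fun x => by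
    refine ((h.hasDerivAt_limit hκ hc0 hc hv hvc x).div (hd x) (hU0 x)).congr_deriv ?_
    rw [div_eq_zero_iff]
    left
    ring
  have hconst : ∀ x, v x / darkSoliton c κ x = v 0 / darkSoliton c κ 0 := fun x =>
    is_const_of_deriv_eq_zero (fun x => (hq x).differentiableAt) (fun x => (hq x).deriv) x 0
  have hnorm : ‖v 0 / darkSoliton c κ 0‖ = 1 := by
    have h1 := h.norm_sq_limit hκ hc0 hc hv hvc 0
    have h2 := norm_plateauSoliton_sq hκ hc0 hc 0 0
    rw [← hU, overshoot_zero, ← h1] at h2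
    have h3 := (sq_eq_sq₀ (norm_nonneg _) (norm_nonneg _)).1 h2
    rw [norm_div, h3, div_self]
    exact (norm_pos_iff.2 (h.limit_ne_zero hκ hc0 hc hv hvc 0)).ne'
  refine ⟨(v 0 / darkSoliton c κ 0).arg, fun x => ?_⟩
  have h4 := Complex.norm_mul_exp_arg_mul_I (v 0 / darkSoliton c κ 0)
  rw [hnorm, Complex.ofReal_one, one_mul, mul_comm] at h4
  rw [h4, ← hconst x, div_mul_cancel₀ _ (hU0 x)]

/-- Derivatives are slopes times `u / |u|²`. The slopes converge in L², while these multipliers are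
only bounded and pointwise convergent; this suffices once they are paired with the fixed L² limit
slope `M`. -/
theorem tendsto_integral_weakDeriv_sub (h : NearSoliton κ c s u) (hκ : κ ≤ 0) (hc0 : 0 < c)
    (hc : c ^ 2 < 2) (hv : ∀ x, Tendsto (fun n => u n x) atTop (𝓝 (v x))) (hvc : Continuous v)
    {z : ℂ} (hz : ∀ x, v x = z * darkSoliton c κ x) :
    Tendsto (fun n => ∫ x, ‖weakDeriv (u n) x - z * weakDeriv (darkSoliton c κ) x‖ ^ 2) atTop
      (𝓝 0) := by
  have hU : darkSoliton c κ = plateauSoliton c κ 0 := darkSoliton_eq_plateauSoliton hc0.ne' κ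
  have hN : ∀ x, intensityProfile c κ x ≤ 1 - c ^ 2 / 2 := fun x => by
    rw [intensityProfile_eq hκ hc]; nlinarith [sq_nonneg (solitonRoot c κ x)]
  have hMm : MemLp (fun x => slopeModel κ c x (intensityProfile c κ x)) 2 volume :=
    QGP.memLp_slopeModel hκ (continuous_intensityProfile hκ hc)
      ((memLp_two_iff_integrable_sq (continuous_intensityProfile hκ hc).aestronglyMeasurable).2
        (integral_sq_intensityProfile hκ hc).1) hN zero_le_one fun x => by
      linarith [intensityProfile_pos hκ hc x]
  set M : ℝ → ℂ := fun x => slopeModel κ c x (intensityProfile c κ x) with hM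
  set w : ℕ → ℝ → ℂ := fun n x => u n x / (‖u n x‖ ^ 2 : ℝ) with hw
  set W : ℝ → ℂ := fun x => v x / (‖v x‖ ^ 2 : ℝ) with hW
  set K := √(8 / c ^ 2) with hK
  have hwK : ∀ n x, ‖w n x‖ ≤ K := h.norm_div_norm_sq_le hc0
  have hwc : ∀ n, Continuous (w n) := fun n =>
    continuous_div_norm_sq (h.mem n).1.1 (nonvanishingSpace_ne_zero (h.mem n))
  have hWc : Continuous W := continuous_div_norm_sq hvc (h.limit_ne_zero hκ hc0 hc hv hvc)
  have hwW : ∀ x, Tendsto (fun n => w n x) atTop (𝓝 (W x)) :=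
    h.tendsto_div_norm_sq hκ hc0 hc hv hvc
  have hWK : ∀ x, ‖W x‖ ≤ K := fun x => le_of_tendsto' (hwW x).norm fun n => hwK n x
  have hK0 : 0 ≤ K := Real.sqrt_nonneg _
  have hSm : ∀ n, MemLp (fun x => slope (u n) x - M x) 2 volume := fun n =>
    (memLp_slope (h.mem n).1).sub hMm
  have hMsq : Integrable (fun x => ‖M x‖ ^ 2) := hMm.norm.integrable_sq
  have hdi : ∀ n, Integrable (fun x => ‖M x‖ ^ 2 * ‖w n x - W x‖ ^ 2) := fun n => by
    refine (hMsq.mul_const ((2 * K) ^ 2)).mono'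
      (hMsq.1.mul (((hwc n).sub hWc).norm.pow 2).aestronglyMeasurable)
      (Eventually.of_forall fun x => ?_)
    rw [Real.norm_of_nonneg (by positivity)]
    have : ‖w n x - W x‖ ≤ 2 * K := (norm_sub_le _ _).trans (by linarith [hwK n x, hWK x])
    gcongr
  have t1 : Tendsto (fun n => ∫ x, ‖slope (u n) x - M x‖ ^ 2) atTop (𝓝 0) := by
    have hR := h.tendsto_slopeResidual hκ hc0
    have hD := (h.tendsto_integral_sq_sub hκ hc0 hc hv hvc).2
    have hlim := (hR.const_mul 2).add (hD.const_mul 2)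
    rw [mul_zero, add_zero] at hlim
    refine squeeze_zero (fun n => integral_nonneg fun x => sq_nonneg _) (fun n => ?_) hlim
    have i1 := (h.memLp_slopeResidual hκ n).norm.integrable_sq
    have i2 : Integrable fun x => ‖slopeModel κ (s n) x (intensity (u n) x) - M x‖ ^ 2 :=
      ((h.memLp_slopeModel hκ n).sub hMm).norm.integrable_sq
    rw [← integral_const_mul, ← integral_const_mul,
      ← integral_add (i1.const_mul 2) (i2.const_mul 2)]
    refine integral_mono (hSm n).norm.integrable_sq ((i1.const_mul 2).add (i2.const_mul 2))
      fun x => ?_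
    have e : slope (u n) x - M x = slopeResidual κ (s n) (u n) x +
        (slopeModel κ (s n) x (intensity (u n) x) - M x) := by
      rw [slopeResidual]; ring
    have := norm_add_le (slopeResidual κ (s n) (u n) x)
      (slopeModel κ (s n) x (intensity (u n) x) - M x)
    simp only
    rw [e]
    nlinarith [norm_nonneg (slopeResidual κ (s n) (u n) x +
        (slopeModel κ (s n) x (intensity (u n) x) - M x)), sq_nonneg
      (‖slopeResidual κ (s n) (u n) x‖ - ‖slopeModel κ (s n) x (intensity (u n) x) - M x‖)]
  have t2 : Tendsto (fun n => ∫ x, ‖M x‖ ^ 2 * ‖w n x - W x‖ ^ 2) atTop (𝓝 0) := by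
    rw [← integral_zero ℝ ℝ]
    refine tendsto_integral_of_dominated_convergence (fun x => ‖M x‖ ^ 2 * (2 * K) ^ 2)
      (fun n => (hdi n).1) (hMsq.mul_const _)
      (fun n => Eventually.of_forall fun x => ?_) (Eventually.of_forall fun x => ?_)
    · rw [Real.norm_of_nonneg (by positivity)]
      have : ‖w n x - W x‖ ≤ 2 * K := (norm_sub_le _ _).trans (by linarith [hwK n x, hWK x])
      gcongr
    · have := (((hwW x).sub_const (W x)).norm.pow 2).const_mul (‖M x‖ ^ 2)
      simpa using this
  have hlim := (t1.const_mul (2 * K ^ 2)).add (t2.const_mul 2)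
  rw [mul_zero, mul_zero, add_zero] at hlim
  refine squeeze_zero (fun n => integral_nonneg fun x => sq_nonneg _) (fun n => ?_) hlim
  have i1 : Integrable fun x => ‖slope (u n) x - M x‖ ^ 2 := (hSm n).norm.integrable_sq
  rw [← integral_const_mul, ← integral_const_mul,
    ← integral_add (i1.const_mul _) ((hdi n).const_mul 2)]
  refine integral_mono_of_nonneg (Eventually.of_forall fun x => sq_nonneg _)
    ((i1.const_mul _).add ((hdi n).const_mul 2)) ?_
  have hUd := (plateauSoliton_facts hκ hc0 hc le_rfl).2
  rw [← hU] at hUd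
  filter_upwards [hUd] with x hx
  have e1 : z * weakDeriv (darkSoliton c κ) x = M x * W x := by
    rw [hx, overshoot_zero, hM, hW]
    simp only
    rw [h.slopeModel_mul_limit hκ hc0 hc hv hvc, hz]
    ring
  have e2 : weakDeriv (u n) x - z * weakDeriv (darkSoliton c κ) x =
      (slope (u n) x - M x) * w n x + M x * (w n x - W x) := by
    rw [e1, weakDeriv_eq_slope_mul (nonvanishingSpace_ne_zero (h.mem n) x)]
    simp only [hw]
    ring
  rw [e2]
  have h1 : ‖(slope (u n) x - M x) * w n x + M x * (w n x - W x)‖ ≤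
      ‖slope (u n) x - M x‖ * K + ‖M x‖ * ‖w n x - W x‖ := by
    refine (norm_add_le _ _).trans ?_
    rw [norm_mul, norm_mul]
    gcongr
    exact hwK n x
  calc _ ≤ (‖slope (u n) x - M x‖ * K + ‖M x‖ * ‖w n x - W x‖) ^ 2 := by gcongr
    _ ≤ _ := by
      nlinarith [sq_nonneg (‖slope (u n) x - M x‖ * K - ‖M x‖ * ‖w n x - W x‖)]

/-- A near soliton sequence converges to a soliton along a subsequence. -/
theorem exists_subseq (h : NearSoliton κ c s u) (hκ : κ ≤ 0) (hc0 : 0 < c) (hc : c ^ 2 < 2) :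
    ∃ (θ : ℝ) (σ : ℕ → ℕ), StrictMono σ ∧
      TendstoLocallyUniformly (fun n => u (σ n))
        (fun x => Complex.exp (Complex.I * θ) * darkSoliton c κ x) atTop ∧
      Tendsto (fun n => eLpNorm (fun x => intensity (u (σ n)) x - intensity (darkSoliton c κ) x)
        2 volume) atTop (𝓝 0) ∧
      Tendsto (fun n => eLpNorm (fun x => weakDeriv (u (σ n)) x -
        Complex.exp (Complex.I * θ) * weakDeriv (darkSoliton c κ) x) 2 volume) atTop (𝓝 0) := by
  obtain ⟨B, hB0, hB, hB', -⟩ := h.exists_bound hκ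
  obtain ⟨σ, v, hσ, hvc, hloc⟩ := exists_subseq_tendstoLocallyUniformly hB (A := B)
    fun n x y => by
      refine ((energySpace_isPrimitive (h.mem n).1).norm_sub_sq_le
        (energySpace_memLp_weakDeriv (h.mem n).1) y x).trans ?_
      gcongr
      exact hB' n
  have h' := h.comp hσ
  have hv : ∀ x, Tendsto (fun n => u (σ n) x) atTop (𝓝 (v x)) := fun x =>
    (tendstoLocallyUniformlyOn_univ.2 hloc).tendsto_at (mem_univ x)
  obtain ⟨θ, hθ⟩ := h'.exists_phase hκ hc0 hc hv hvc
  have hU : darkSoliton c κ = plateauSoliton c κ 0 := darkSoliton_eq_plateauSoliton hc0.ne' κ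
  have hUm : darkSoliton c κ ∈ energySpace := by
    rw [hU]; exact (plateauSoliton_facts hκ hc0 hc le_rfl).1
  have hUi : ∀ x, intensity (darkSoliton c κ) x = intensityProfile c κ x := fun x => by
    rw [hU, intensity_plateauSoliton hκ hc0 hc, overshoot_zero]
  refine ⟨θ, σ, hσ, ?_, ?_, ?_⟩
  · rwa [← show v = _ from funext hθ]
  · refine tendsto_eLpNorm_zero (fun n => (energySpace_memLp_intensity (h'.mem n).1).sub
      (energySpace_memLp_intensity hUm)) ?_
    simpa [hUi] using (h'.tendsto_integral_sq_sub hκ hc0 hc hv hvc).1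
  · exact tendsto_eLpNorm_zero (fun n => (energySpace_memLp_weakDeriv (h'.mem n).1).sub
      ((energySpace_memLp_weakDeriv hUm).const_mul _))
      (h'.tendsto_integral_weakDeriv_sub hκ hc0 hc hv hvc hθ)

end NearSoliton

/-! ### Compactness of minimizing sequences and uniqueness of minimizers. -/

section Minimizing

variable {κ cs c : ℝ} {s : ℕ → ℝ} {u : ℕ → ℝ → ℂ}

/-- At momentum `p c` the tangent function has its strict minimum at `c`, even against speed `0` and
against its limit `√2 * p c` at `√2`. The speeds minimize it asymptotically, so `c` is their only
cluster point. -/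
theorem tendsto_speed_of_minimizing (hκ : κ ≤ 0)
    (hcs : SolitonBranch.IsCritical (profileEnergy κ) (profileMomentum κ) √2 cs)
    (hc : c ∈ Ioo cs √2) (hs0 : ∀ n, 0 < s n) (hs : ∀ n, s n < √2)
    (hle : ∀ n, profileEnergy κ (s n) - s n * profileMomentum κ (s n) + s n * momentum (u n) ≤
      energy κ (u n))
    (hE : Tendsto (fun n => energy κ (u n)) atTop (𝓝 (profileEnergy κ c)))
    (hp : Tendsto (fun n => momentum (u n)) atTop (𝓝 (profileMomentum κ c))) :
    Tendsto s atTop (𝓝 c) := by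
  obtain ⟨c₀, hb⟩ := exists_solitonBranch hκ
  set q := profileMomentum κ c with hq
  have h1 : ∀ n, profileEnergy κ (s n) - s n * profileMomentum κ (s n) + s n * q ≤
      energy κ (u n) - s n * (momentum (u n) - q) := fun n => by linarith [hle n]
  have h2 : Tendsto (fun n => s n * (momentum (u n) - q)) atTop (𝓝 0) := by
    have h3 : Tendsto (fun n => √2 * |momentum (u n) - q|) atTop (𝓝 0) := by
      have := ((hp.sub_const q).abs).const_mul √2
      simpa using this
    rw [tendsto_zero_iff_abs_tendsto_zero]
    refine squeeze_zero (fun n => abs_nonneg _) (fun n => ?_) h3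
    simp only [Function.comp]
    rw [abs_mul, abs_of_pos (hs0 n)]
    exact mul_le_mul_of_nonneg_right (hs n).le (abs_nonneg _)
  have h3 := hE.sub h2
  rw [sub_zero] at h3
  refine isCompact_Icc.tendsto_nhds_of_unique_mapClusterPt
    (Eventually.of_forall fun n => (⟨(hs0 n).le, (hs n).le⟩ : s n ∈ Icc 0 √2)) fun d hd hcl => ?_
  obtain ⟨φ, hφ, hlim⟩ := hcl.tendsto_subseq
  have h4 := h3.comp hφ.tendsto_atTop
  by_contra hne
  rcases hd.2.lt_or_eq with hlt | rfl
  · have h5 := ((hb.hasDerivAt_tangent q hd.1 hlt).continuousAt.tendsto).comp hlim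
    exact (hcs.tangent_lt c hc d ⟨hd.1, hlt⟩ hne).not_ge
      (le_of_tendsto_of_tendsto' h5 h4 fun n => h1 (φ n))
  · have h5 := (hb.tendsto_tangent q).comp (tendsto_nhdsWithin_iff.2
      ⟨hlim, Eventually.of_forall fun n => hs (φ n)⟩)
    exact (hcs.energy_lt_mul c ⟨hc.1.le, hc.2⟩).not_ge
      (le_of_tendsto_of_tendsto' h5 h4 fun n => h1 (φ n))

/-- The integral of the defect is the gap in the calibrated bound, and the gap closes once the
speeds converge to `c`. The shift by `N` discards the terms of speed below `c / 2`. -/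
theorem exists_nearSoliton (hκ : κ ≤ 0)
    (hcs : SolitonBranch.IsCritical (profileEnergy κ) (profileMomentum κ) √2 cs)
    (hc : c ∈ Ioo cs √2) (hu : ∀ n, u n ∈ nonvanishingSpace) (h0 : ∀ n, 0 < intensity (u n) 0)
    (hmax : ∀ n x, intensity (u n) x ≤ intensity (u n) 0)
    (hE : Tendsto (fun n => energy κ (u n)) atTop (𝓝 (profileEnergy κ c)))
    (hp : Tendsto (fun n => momentum (u n)) atTop (𝓝 (profileMomentum κ c))) :
    ∃ (s : ℕ → ℝ) (N : ℕ), NearSoliton κ c (fun n => s (n + N)) (fun n => u (n + N)) := by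
  choose s hs0 hs hs1 using fun n => exists_speed_of_max (hu n) (h0 n)
  have hlim := tendsto_speed_of_minimizing hκ hcs hc hs0 hs
    (fun n => tangent_le_energy hκ (hu n) (hs0 n) (hs n) (hs1 n) (hmax n)) hE hp
  have hc0 : 0 < c := hcs.nonneg.trans_lt hc.1
  obtain ⟨N, hN⟩ := eventually_atTop.1 (hlim.eventually (lt_mem_nhds (half_lt_self hc0)))
  obtain ⟨c₀, hb⟩ := exists_solitonBranch hκ
  have hshift := tendsto_add_atTop_nat N
  have hD : Tendsto (fun n => ∫ x, defect (s n) κ 0 (u n) x) atTop (𝓝 0) := by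
    -- The term `s n * 0` presents the total calibration as the tangent function at momentum `0`,
    -- whose continuity in the speed is available.
    have e : ∀ n, energy κ (u n) - s n * momentum (u n) -
        (profileEnergy κ (s n) - s n * profileMomentum κ (s n) + s n * 0) =
        ∫ x, defect (s n) κ 0 (u n) x := fun n => by
      have h := (energy_sub_momentum_eq hκ (hs0 n) (hu n)
        (fun x => (hmax n x).trans (hs1 n).le) (hs1 n)).2
      rw [two_mul_calibration_eq hκ (hs0 n) (sq_lt_two_of_lt (hs0 n).le (hs n))] at h
      linarith
    have h1 := ((hb.hasDerivAt_tangent 0 hc0.le hc.2).continuousAt.tendsto).comp hlim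
    have := (hE.sub (hlim.mul hp)).sub h1
    rw [show profileEnergy κ c - c * profileMomentum κ c -
      (profileEnergy κ c - c * profileMomentum κ c + c * 0) = 0 by ring] at this
    exact this.congr e
  obtain ⟨A, hA⟩ := hE.bddAbove_range
  exact ⟨s, N, fun n => hu _, fun n => (hN _ (Nat.le_add_left _ _)).le, fun n => hs1 _,
    fun n x => (hmax _ x).trans (hs1 _).le, hlim.comp hshift, hD.comp hshift, hp.comp hshift,
    A, fun n => hA ⟨_, rfl⟩⟩

/-- A map of modulus at least `1` everywhere has `√2 p ≤ E`, which eventually contradicts `E c < √2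
* p c`. -/
theorem eventually_exists_intensity_pos (hκ : κ ≤ 0)
    (hcs : SolitonBranch.IsCritical (profileEnergy κ) (profileMomentum κ) √2 cs)
    (hc : c ∈ Ioo cs √2) (hu : ∀ n, u n ∈ nonvanishingSpace)
    (hE : Tendsto (fun n => energy κ (u n)) atTop (𝓝 (profileEnergy κ c)))
    (hp : Tendsto (fun n => momentum (u n)) atTop (𝓝 (profileMomentum κ c))) :
    ∀ᶠ n in atTop, ∃ y, 0 < intensity (u n) y := by
  filter_upwards [hE.eventually_lt (hp.const_mul √2)
    (hcs.energy_lt_mul c ⟨hc.1.le, hc.2⟩)] with n hn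
  by_contra! hle
  exact hn.not_ge (sqrt_two_mul_momentum_le_energy hκ (hu n) hle)

theorem translate_facts {w : ℝ → ℂ} (hw : w ∈ nonvanishingSpace) (κ a : ℝ) :
    (fun x => w (x + a)) ∈ nonvanishingSpace ∧
      weakDeriv (fun x => w (x + a)) =ᵐ[volume] (fun x => weakDeriv w (x + a)) ∧
      energy κ (fun x => w (x + a)) = energy κ w ∧ momentum (fun x => w (x + a)) = momentum w := by
  have h1 := transform_mem hw norm_one a
  have h2 := (transform_facts hw.1 norm_one a).2
  have h3 := energy_transform κ hw.1 norm_one a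
  have h4 := momentum_transform hw.1 norm_one a
  simp only [one_mul] at h1 h2 h3 h4
  exact ⟨h1, h2, h3, h4⟩

/-- Minimizing sequences are compact up to translations. -/
theorem exists_subseq_of_minimizing (hκ : κ ≤ 0)
    (hcs : SolitonBranch.IsCritical (profileEnergy κ) (profileMomentum κ) √2 cs)
    (hc : c ∈ Ioo cs √2) (hu : ∀ n, u n ∈ nonvanishingSpace)
    (hE : Tendsto (fun n => energy κ (u n)) atTop (𝓝 (profileEnergy κ c)))
    (hp : Tendsto (fun n => momentum (u n)) atTop (𝓝 (profileMomentum κ c))) :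
    ∃ (θ : ℝ) (σ : ℕ → ℕ) (a : ℕ → ℝ), StrictMono σ ∧
      TendstoLocallyUniformly (fun n x => u (σ n) (x + a n))
        (fun x => Complex.exp (Complex.I * θ) * darkSoliton c κ x) atTop ∧
      Tendsto (fun n => eLpNorm (fun x => (1 - ‖u (σ n) (x + a n)‖ ^ 2) -
        (1 - ‖darkSoliton c κ x‖ ^ 2)) 2 volume) atTop (𝓝 0) ∧
      Tendsto (fun n => eLpNorm (fun x => weakDeriv (u (σ n)) (x + a n) -
        Complex.exp (Complex.I * θ) * weakDeriv (darkSoliton c κ) x) 2 volume) atTop (𝓝 0) := by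
  have hc0 : 0 < c := hcs.nonneg.trans_lt hc.1
  obtain ⟨N, hN⟩ := eventually_atTop.1 (eventually_exists_intensity_pos hκ hcs hc hu hE hp)
  have hex : ∀ n, ∃ a, 0 < intensity (u (n + N)) a ∧
      ∀ x, intensity (u (n + N)) x ≤ intensity (u (n + N)) a := fun n => by
    obtain ⟨y, hy⟩ := hN (n + N) (Nat.le_add_left _ _)
    exact exists_max_intensity (hu _).1 hy
  choose a ha hamax using hex
  have hf := fun n => translate_facts (hu (n + N)) κ (a n)
  obtain ⟨s, M, hns⟩ := exists_nearSoliton (u := fun n x => u (n + N) (x + a n)) hκ hcs hc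
    (fun n => (hf n).1) (fun n => by simpa [intensity] using ha n)
    (fun n x => by simpa [intensity] using hamax n (x + a n))
    ((hE.comp (tendsto_add_atTop_nat N)).congr fun n => (hf n).2.2.1.symm)
    ((hp.comp (tendsto_add_atTop_nat N)).congr fun n => (hf n).2.2.2.symm)
  obtain ⟨θ, σ, hσ, h1, h2, h3⟩ := hns.exists_subseq hκ hc0 (sq_lt_two_of_lt hc0.le hc.2)
  refine ⟨θ, fun n => σ n + M + N, fun n => a (σ n + M), fun m n hmn => ?_, h1, h2, ?_⟩
  · simpa using hσ hmn
  · refine h3.congr fun n => eLpNorm_congr_ae ?_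
    filter_upwards [(hf (σ n + M)).2.1] with x hx
    rw [hx]

/-- A minimizer, translated so that its intensity is maximal at `0`, forms a constant minimizing
sequence and is its own limit, so the identification of limits applies to it. -/
theorem minimizers_eq_orbit (hκ : κ ≤ 0)
    (hcs : SolitonBranch.IsCritical (profileEnergy κ) (profileMomentum κ) √2 cs)
    (hc : c ∈ Ioo cs √2) :
    minimizers κ (profileMomentum κ c) = orbit (darkSoliton c κ) := by
  have hc0 : 0 < c := hcs.nonneg.trans_lt hc.1
  have hc2 := sq_lt_two_of_lt hc0.le hc.2
  ext w
  constructor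
  · rintro ⟨⟨hw, hp⟩, hE⟩
    rw [minEnergy_profileMomentum hκ hcs hc] at hE
    have hEt : Tendsto (fun _ : ℕ => energy κ w) atTop (𝓝 (profileEnergy κ c)) := by
      rw [hE]; exact tendsto_const_nhds
    have hpt : Tendsto (fun _ : ℕ => momentum w) atTop (𝓝 (profileMomentum κ c)) := by
      rw [hp]; exact tendsto_const_nhds
    obtain ⟨-, y, hy⟩ := (eventually_exists_intensity_pos hκ hcs hc (fun _ => hw) hEt hpt).exists
    obtain ⟨a, ha, hamax⟩ := exists_max_intensity hw.1 hy
    have hf := translate_facts hw κ a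
    obtain ⟨s, M, hns⟩ := exists_nearSoliton (u := fun _ x => w (x + a)) hκ hcs hc
      (fun _ => hf.1) (fun _ => by simpa [intensity] using ha)
      (fun _ x => by simpa [intensity] using hamax (x + a))
      (by rwa [hf.2.2.1]) (by rwa [hf.2.2.2])
    obtain ⟨θ, hθ⟩ := hns.exists_phase hκ hc0 hc2 (v := fun x => w (x + a))
      (fun _ => tendsto_const_nhds) hf.1.1.1
    refine ⟨a, θ, fun x => ?_⟩
    rw [← hθ (x - a), sub_add_cancel]
  · rintro ⟨a, φ, hw⟩
    have hz : ‖Complex.exp (Complex.I * φ)‖ = 1 := by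
      rw [mul_comm]; exact Complex.norm_exp_ofReal_mul_I φ
    obtain ⟨hm, hmp⟩ := darkSoliton_mem_admissible hκ hc0 hc.2
    have e : w = fun x => Complex.exp (Complex.I * φ) * darkSoliton c κ (x + -a) := by
      funext x; rw [hw x, sub_eq_add_neg]
    rw [e]
    refine ⟨⟨transform_mem hm hz _, ?_⟩, ?_⟩
    · rw [momentum_transform hm.1 hz, hmp]
    · rw [energy_transform κ hm.1 hz, minEnergy_profileMomentum hκ hcs hc,
        energy_darkSoliton hκ hc0.le hc2]

end Minimizing
end QGP

theorem theorem1p10 (κ : ℝ) (hκ : κ ≤ 0) :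
    -- the critical speed, the critical momentum and the function `c(q)` are what they should be
    IsGreatest (QGP.blackEnergySpeeds κ) (QGP.criticalSpeed κ) ∧
    (0 < QGP.criticalSpeed κ →
      QGP.criticalMomentum κ = QGP.momentum (QGP.darkSoliton (QGP.criticalSpeed κ) κ)) ∧
    (QGP.criticalSpeed κ = 0 → QGP.criticalMomentum κ = Real.pi / 2) ∧
    Set.BijOn (QGP.solitonMomentum κ) (Set.Ioo (QGP.criticalSpeed κ) √2)
      (Set.Ioo 0 (QGP.criticalMomentum κ)) ∧
    -- below the critical momentum: the minimizers, and compactness of minimizing sequences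
    (∀ q : ℝ, 0 < q → q < QGP.criticalMomentum κ →
      QGP.minEnergy κ q = QGP.energy κ (QGP.darkSoliton (QGP.speedOfMomentum κ q) κ) ∧
      QGP.minimizers κ q = QGP.orbit (QGP.darkSoliton (QGP.speedOfMomentum κ q) κ) ∧
      ∀ u : ℕ → ℝ → ℂ, (∀ n, u n ∈ QGP.nonvanishingSpace) →
        Filter.Tendsto (fun n => QGP.energy κ (u n)) Filter.atTop
          (nhds (QGP.minEnergy κ q)) →
        Filter.Tendsto (fun n => QGP.momentum (u n)) Filter.atTop (nhds q) →
        ∃ (θ : ℝ) (σ : ℕ → ℕ) (a : ℕ → ℝ), StrictMono σ ∧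
          TendstoLocallyUniformly (fun n x => u (σ n) (x + a n))
            (fun x => Complex.exp (Complex.I * θ) *
              QGP.darkSoliton (QGP.speedOfMomentum κ q) κ x) Filter.atTop ∧
          Filter.Tendsto (fun n => MeasureTheory.eLpNorm
            (fun x => (1 - ‖u (σ n) (x + a n)‖ ^ 2) -
              (1 - ‖QGP.darkSoliton (QGP.speedOfMomentum κ q) κ x‖ ^ 2))
            2 MeasureTheory.volume) Filter.atTop (nhds 0) ∧
          Filter.Tendsto (fun n => MeasureTheory.eLpNorm
            (fun x => QGP.weakDeriv (u (σ n)) (x + a n) -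
              Complex.exp (Complex.I * θ) *
                QGP.weakDeriv (QGP.darkSoliton (QGP.speedOfMomentum κ q) κ) x)
            2 MeasureTheory.volume) Filter.atTop (nhds 0)) ∧
    StrictMonoOn (QGP.minEnergy κ) (Set.Ioo 0 (QGP.criticalMomentum κ)) ∧
    -- above the critical momentum
    (∀ q : ℝ, QGP.criticalMomentum κ ≤ q →
      QGP.minEnergy κ q = QGP.energy κ (QGP.darkSoliton 0 κ)) ∧
    (∀ q : ℝ, QGP.criticalMomentum κ < q → QGP.minimizers κ q = ∅) := by
  obtain ⟨c₀, hb⟩ := QGP.exists_solitonBranch hκ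
  obtain ⟨cs, hcs⟩ := hb.exists_isCritical
  have hQ := QGP.criticalMomentum_eq hκ hcs
  have hs := QGP.criticalSpeed_eq hκ hcs
  have h0 : QGP.energy κ (QGP.darkSoliton 0 κ) = QGP.profileEnergy κ 0 :=
    QGP.energy_darkSoliton hκ le_rfl (by norm_num)
  rw [hQ, hs, h0]
  refine ⟨QGP.isGreatest_blackEnergySpeeds hκ hcs, fun hpos => ?_, fun hz => ?_,
    hcs.bijOn.congr (QGP.eqOn_solitonMomentum hκ hcs), fun q hq0 hq => ?_,
    QGP.strictMonoOn_minEnergy hκ hcs, fun q hq => QGP.minEnergy_of_le hκ hcs hq,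
    fun q hq => QGP.minimizers_eq_empty hκ hcs hq⟩
  · exact (QGP.momentum_darkSoliton hκ hpos (QGP.sq_lt_two_of_lt hpos.le hcs.lt)).symm
  · rw [hz, QGP.profileMomentum_zero]
  · obtain ⟨hc, hcq⟩ := QGP.speedOfMomentum_spec hκ hcs ⟨hq0, hq⟩
    set c := QGP.speedOfMomentum κ q
    have hc0 : 0 < c := hcs.nonneg.trans_lt hc.1
    rw [← hcq, QGP.minEnergy_profileMomentum hκ hcs hc,
      QGP.energy_darkSoliton hκ hc0.le (QGP.sq_lt_two_of_lt hc0.le hc.2)]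
    exact ⟨rfl, QGP.minimizers_eq_orbit hκ hcs hc, fun u hu hE hp =>
      QGP.exists_subseq_of_minimizing hκ hcs hc hu hE hp⟩
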